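/- Let $\Bbbk$ be a field; all vector spaces are finite dimensional over $\Bbbk$ and all structure maps $\alpha$ are linear automorphisms. A Hom-algebra $(A,\alpha,\mu,1)$ satisfies $\alpha(a)(bc)=(ab)\alpha(c)$, $\alpha(1)=1$, $1a=a1=\alpha(a)$; a Hom-coalgebra $(C,\alpha,\Delta,\varepsilon)$ satisfies $\varepsilon\circ\alpha=\varepsilon$, $\alpha(c_1)\otimes\Delta(c_2)=\Delta(c_1)\otimes\alpha(c_2)$, $\varepsilon(c_1)c_2=c_1\varepsilon(c_2)=\alpha(c)$; a Hom-bialgebra is both, with the same $\alpha$, such that $\Delta,\varepsilon$ are multiplicative and unital. A right Hom-module $(U,\alpha_U)$ over $A$ satisfies $(u\cdot a)\cdot\alpha_A(b)=\alpha_U(u)\cdot(ab)$, $u\cdot 1=\alpha_U(u)$. A right Hom-comodule $(U,\alpha_U)$ over $C$, with coaction $u\mapsto u_{(0)}\otimes u_{(1)}$, satisfies $\alpha_U(u_{(0)})\otimes\Delta(u_{(1)})=\rho(u_{(0)})\otimes\alpha_C(u_{(1)})$, $\varepsilon(u_{(1)})u_{(0)}=\alpha_U(u)$. For $i,j\in\mathbb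 Z$ let $\overline{\mathcal H}^{i,j}$ be the category of pairs $(X,\alpha_X)$ and linear maps commuting with the $\alpha$'s, with $(X,\alpha_X)\otimes(Y,\alpha_Y)=(X\otimes Y,\alpha_X\otimes\alpha_Y)$, unit $(\Bbbk,\mathrm{id})$, and constraints $(x\otimes y)\otimes z\mapsto\alpha_X^{i+1}(x)\otimes(y\otimes\alpha_Z^{-j-1}(z))$, $\lambda\otimes x\mapsto\lambda\alpha_X^{j+1}(x)$, $x\otimes\lambda\mapsto\lambda\alpha_X^{i+1}(x)$. For a Hom-bialgebra $S$, let $Corep^{i,j}(S)$ be the monoidal category of right $S$-Hom-comodules and colinear maps, with coaction $u\otimes v\mapsto(u_{(0)}\otimes v_{(0)})\otimes\alpha_S^i(u_{(1)})\alpha_S^j(v_{(1)})$ on $U\otimes V$, coaction $\lambda\mapsto\lambda\otimes1_S$ on $\Bbbk$, and the constraints of $\overline{\mathcal H}^{i,j}$. Moreover $\ddot S=\_\otimes S$ is a bicomonad (monoidal comonad) on $\overline{\mathcal H}^{i,j}$ with $\delta(x\otimes s)=(\alpha_X(x)\otimes s_1)\otimes\alpha_S^{-1}(s_2)$, $\epsilon(x\otimes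 s)=\varepsilon(s)\alpha_X^{-1}(x)$, $\ddot S_2((x\otimes s)\otimes(y\otimes t))=(x\otimes y)\otimes\alpha_S^i(s)\alpha_S^j(t)$, $\ddot S_0(\lambda)=\lambda\otimes1_S$. Let $H,A$ be Hom-bialgebras. Let $A^{*cop}$ be the Hom-bialgebra on $A^*$ with $\alpha(f)=f\circ\alpha_A^{-1}$, unit $\varepsilon_A$, $(f*g)(y)=f(\alpha_A^{-2}(y_1))\,g(\alpha_A^{-2}(y_2))$, counit $f\mapsto f(1_A)$, and comultiplication $\overline\Delta(f)(x\otimes y)=f(\alpha_A^{-2}(yx))$. A *Hom-monoidal entwining datum* $(H,A,\Phi)$ is given by a linear map $\Phi:H\otimes A\to A\otimes H$, $\Phi(h\otimes a)=\sum a_\Phi\otimes h^\Phi$, with $(\alpha_A\otimes\alpha_H)\Phi=\Phi(\alpha_H\otimes\alpha_A)$ and, for all $a,b\in A$, $h,g\in H$ (with $\Psi=\Phi$): - (E1) $\sum a_\Phi b_\Psi\otimes\alpha_H(h^{\Phi\Psi})=\sum(ab)_\Phi\otimes\alpha_H(h)^\Phi$; - (E2) $\sum\alpha_A(a)_{\Psi\Phi}\otimes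 h_1{}^\Phi\otimes h_2{}^\Psi=\sum\alpha_A(a_\Phi)\otimes(h^\Phi)_1\otimes(h^\Phi)_2$; - (E3) $\sum\varepsilon_H(h^\Phi)a_\Phi=\varepsilon_H(h)a$; - (E4) $\sum(1_A)_\Phi\otimes h^\Phi=1_A\otimes h$; - (E5) $\sum a_{1\Phi}\otimes a_{2\Psi}\otimes\alpha_H^2(h)^\Phi\alpha_H^2(g)^\Psi=\sum(a_\Phi)_1\otimes(a_\Phi)_2\otimes\alpha_H^2((hg)^\Phi)$; - (E6) $\sum\varepsilon_A(a_\Phi)(1_H)^\Phi=\varepsilon_A(a)1_H$. Let $\varphi:A^{*cop}\otimes H\to H\otimes A^{*cop}$, $\varphi(f\otimes h)=\sum h^\varphi\otimes f^\varphi:=\sum_r f((e_r)_\Phi)\,h^\Phi\otimes e^r$, with $(e_r)$, $(e^r)$ dual bases of $A$ and $A^*$. For $n\in\mathbb Z$ let $\mathcal M(\Phi)^H_A(n)$ be the category of $n$-th Hom-entwined modules, i.e. pairs $(U,\alpha_U)$ that are right $A$-Hom-modules and right $H$-Hom-comodules with $$\rho(u\cdot a)=\sum u_{(0)}\cdot\alpha_A(a_\Phi)\otimes\alpha_H^{-n}\bigl(\alpha_H^{n+1}(u_{(1)})^\Phi\bigr),$$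 and $A$-linear $H$-colinear maps; for each $i,j$ it is monoidal with the constraints of $\overline{\mathcal H}^{i,j}$, action $(u\otimes v)\cdot a=u\cdot\alpha_A^{-i-2}(a_1)\otimes v\cdot\alpha_A^{-j-2}(a_2)$, coaction $u\otimes v\mapsto(u_{(0)}\otimes v_{(0)})\otimes\alpha_H^i(u_{(1)})\alpha_H^j(v_{(1)})$, and unit object $\Bbbk$ with $\lambda\cdot a=\varepsilon_A(a)\lambda$, $\rho(\lambda)=\lambda\otimes1_H$. Let $\ddot\varphi(n)$ be the natural transformation from $(\_\otimes A^{*cop})\otimes H$ to $(\_\otimes H)\otimes A^{*cop}$, $$(x\otimes f)\otimes h\mapsto\sum(x\otimes\alpha_H(h)^\varphi)\otimes\alpha^n\bigl(\alpha^{-n-1}(f)^\varphi\bigr),\qquad\alpha=\alpha_{A^{*cop}}.$$ **Corollary.** Let $(H,A,\Phi)$ be a Hom-monoidal entwining datum. Then $A^{*cop}\otimes H$ is a Hom-bialgebra with $$\widehat\Delta(f\otimes h)=\sum(f_{(1)}\otimes h_1{}^\varphi)\otimes(f_{(2)}{}^\varphi\otimes h_2),\quad\widehat\varepsilon(f\otimes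 h)=\varepsilon_H(h)f(1_A),\quad\alpha=\alpha_{A^{*cop}}\otimes\alpha_H,$$ $$(f\otimes x)(f'\otimes y)=(f*f')\otimes xy,\qquad 1=\varepsilon_A\otimes1_H,$$ where $f_{(1)}\otimes f_{(2)}=\overline\Delta(f)$. Further, for all $i,j,n\in\mathbb Z$: 1. $\mathcal M(\Phi)^H_A(n)$ is monoidally isomorphic to $Corep^{i,j}(A^{*cop}\otimes H)$; 2. $\ddot\varphi(n):\ddot H\,\ddot A^{*cop}\to\ddot A^{*cop}\ddot H$ is a monoidal comonad distributive law, and $\mathcal M(\Phi)^H_A(n)$ is monoidally isomorphic to the category of $\ddot\varphi(n)$-bicomodules in $\overline{\mathcal H}^{i,j}$. These are the objects $U$ with an $\ddot H$-coaction $\theta$ and an $\ddot A^{*cop}$-coaction $\rho$ such that $\ddot\varphi(n)_U\circ\ddot H(\rho)\circ\theta=\ddot A^{*cop}(\theta)\circ\rho$; the tensor product carries the coactions $(\text{coaction}\otimes\text{coaction})$ followed by $\ddot H_2$, respectively $\ddot A^{*cop}_2$, the unit is $\Bbbk$ with coactions $\ddot H_0$, $\ddot A^{*cop}_0$, and the constraints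 are those of $\overline{\mathcal H}^{i,j}$. Here "monoidally isomorphic" means that there is an isomorphism of categories that is a strong monoidal functor. -/

import Mathlib

open CategoryTheory MonoidalCategory
open scoped TensorProduct

set_option linter.unusedVariables false
set_option linter.unusedSectionVars false

universe u

namespace HomEntwining

/-- Pairs `(X, α_X)` of a finite-dimensional space and an automorphism. The integers `i`, `j` only
enter the associativity and unit constraints of the monoidal category of these pairs. -/
structure HomVec (k : Type u) [Field k] (i j : ℤ) where
  carrier : Type u
  [addCommGroup : AddCommGroup carrier]
  [module : Module k carrier]
  [finite : FiniteDimensional k carrier]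
  α : carrier ≃ₗ[k] carrier

attribute [instance] HomVec.addCommGroup HomVec.module HomVec.finite

section zpow

variable {k : Type u} [Field k] {V W : Type u} [AddCommGroup V] [Module k V]
  [AddCommGroup W] [Module k W]

theorem zpow_zpow_apply (α : V ≃ₗ[k] V) (m n : ℤ) (x : V) :
    (α ^ m) ((α ^ n) x) = (α ^ (m + n)) x := by
  rw [zpow_add]; rfl

theorem zpow_apply_one (α : V ≃ₗ[k] V) (n : ℤ) (x : V) :
    (α ^ n) (α x) = (α ^ (n + 1)) x := by
  rw [zpow_add, zpow_one]; rfl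

theorem apply_zpow (α : V ≃ₗ[k] V) (n : ℤ) (x : V) :
    α ((α ^ n) x) = (α ^ (n + 1)) x := by
  rw [add_comm, zpow_add, zpow_one]; rfl

theorem zpow_zero_apply (α : V ≃ₗ[k] V) (x : V) : (α ^ (0 : ℤ)) x = x := by
  rw [zpow_zero]; rfl

theorem zpow_comm_apply {α : V ≃ₗ[k] V} {β : W ≃ₗ[k] W} (f : V →ₗ[k] W)
    (h : ∀ x, f (α x) = β (f x)) (n : ℤ) (x : V) : f ((α ^ n) x) = (β ^ n) (f x) := by
  have hpos : ∀ (n : ℕ) (x : V), f ((α ^ (n : ℤ)) x) = (β ^ (n : ℤ)) (f x) := by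
    intro n
    induction n with
    | zero => intro x; simp
    | succ m ih =>
      intro x
      push_cast
      rw [← zpow_apply_one, ih, h, zpow_apply_one]
  rcases Int.eq_nat_or_neg n with ⟨m, rfl | rfl⟩
  · exact hpos m x
  · have := hpos m ((α ^ (-(m : ℤ))) x)
    rw [zpow_zpow_apply, add_neg_cancel, zpow_zero_apply] at this
    rw [this, zpow_zpow_apply, neg_add_cancel, zpow_zero_apply]

theorem congr_zpow_tmul (α : V ≃ₗ[k] V) (β : W ≃ₗ[k] W) (n : ℤ) (x : V) (y : W) :
    ((TensorProduct.congr α β) ^ n) (x ⊗ₜ[k] y) = (α ^ n) x ⊗ₜ[k] (β ^ n) y := by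
  rw [TensorProduct.congr_zpow]; rfl

theorem refl_zpow (n : ℤ) (x : V) : ((LinearEquiv.refl k V) ^ n) x = x := by
  change ((1 : V ≃ₗ[k] V) ^ n) x = x
  rw [one_zpow]; rfl

end zpow

namespace HomVec

variable {k : Type u} [Field k] {i j : ℤ}

@[ext]
structure Hom (X Y : HomVec k i j) where
  toLin : X.carrier →ₗ[k] Y.carrier
  comm : ∀ x, toLin (X.α x) = Y.α (toLin x)

instance : Category (HomVec k i j) where
  Hom X Y := Hom X Y
  id X := ⟨LinearMap.id, fun _ => rfl⟩
  comp f g := ⟨g.toLin ∘ₗ f.toLin, fun x => by simp [f.comm, g.comm]⟩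

theorem hom_ext {X Y : HomVec k i j} {f g : X ⟶ Y} (h : Hom.toLin f = Hom.toLin g) : f = g :=
  Hom.ext h

@[simp] theorem id_toLin (X : HomVec k i j) : Hom.toLin (𝟙 X) = LinearMap.id := rfl

@[simp] theorem comp_toLin {X Y Z : HomVec k i j} (f : X ⟶ Y) (g : Y ⟶ Z) :
    Hom.toLin (f ≫ g) = Hom.toLin g ∘ₗ Hom.toLin f := rfl

/-- A linear isomorphism that commutes with the structure maps, as an isomorphism. -/
def mkIso {X Y : HomVec k i j} (e : X.carrier ≃ₗ[k] Y.carrier)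
    (h : ∀ x, e (X.α x) = Y.α (e x)) : X ≅ Y where
  hom := ⟨e.toLinearMap, h⟩
  inv := ⟨e.symm.toLinearMap, fun y => by
    apply e.injective
    simp [h]⟩
  hom_inv_id := hom_ext (by ext x; simp)
  inv_hom_id := hom_ext (by ext x; simp)

/-- `(X, α_X) ⊗ (Y, α_Y) = (X ⊗ Y, α_X ⊗ α_Y)`. -/
abbrev tensor (X Y : HomVec k i j) : HomVec k i j where
  carrier := X.carrier ⊗[k] Y.carrier
  α := TensorProduct.congr X.α Y.α

/-- The unit object `(k, id)`. -/
abbrev unit : HomVec k i j where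
  carrier := k
  α := LinearEquiv.refl k k

def tensorMap {X Y X' Y' : HomVec k i j} (f : X ⟶ Y) (g : X' ⟶ Y') :
    tensor X X' ⟶ tensor Y Y' where
  toLin := TensorProduct.map (Hom.toLin f) (Hom.toLin g)
  comm z := LinearMap.congr_fun (f := TensorProduct.map (Hom.toLin f) (Hom.toLin g) ∘ₗ
      (TensorProduct.congr X.α X'.α).toLinearMap)
    (g := (TensorProduct.congr Y.α Y'.α).toLinearMap ∘ₗ
      TensorProduct.map (Hom.toLin f) (Hom.toLin g))
    (TensorProduct.ext' fun x y => by simp [Hom.comm]) z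

/-- `(x ⊗ y) ⊗ z ↦ α_X^{i+1}(x) ⊗ (y ⊗ α_Z^{-j-1}(z))`. -/
def assocEquiv (X Y Z : HomVec k i j) :
    (X.carrier ⊗[k] Y.carrier) ⊗[k] Z.carrier ≃ₗ[k] X.carrier ⊗[k] (Y.carrier ⊗[k] Z.carrier) :=
  TensorProduct.assoc k X.carrier Y.carrier Z.carrier ≪≫ₗ
    TensorProduct.congr (X.α ^ (i + 1))
      (TensorProduct.congr (LinearEquiv.refl k Y.carrier) (Z.α ^ (-j - 1)))

/-- `λ ⊗ x ↦ λ α_X^{j+1}(x)`. -/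
def leftUnitEquiv (X : HomVec k i j) : k ⊗[k] X.carrier ≃ₗ[k] X.carrier :=
  TensorProduct.lid k X.carrier ≪≫ₗ (X.α ^ (j + 1) : X.carrier ≃ₗ[k] X.carrier)

/-- `x ⊗ λ ↦ λ α_X^{i+1}(x)`. -/
def rightUnitEquiv (X : HomVec k i j) : X.carrier ⊗[k] k ≃ₗ[k] X.carrier :=
  TensorProduct.rid k X.carrier ≪≫ₗ (X.α ^ (i + 1) : X.carrier ≃ₗ[k] X.carrier)

instance : MonoidalCategoryStruct (HomVec k i j) where
  tensorObj := tensor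
  tensorUnit := unit
  tensorHom f g := tensorMap f g
  whiskerLeft X _ _ f := tensorMap (𝟙 X) f
  whiskerRight f Y := tensorMap f (𝟙 Y)
  associator X Y Z := mkIso (assocEquiv X Y Z) (fun z => LinearMap.congr_fun
    (f := (assocEquiv X Y Z).toLinearMap ∘ₗ
      (TensorProduct.congr (TensorProduct.congr X.α Y.α) Z.α).toLinearMap)
    (g := (TensorProduct.congr X.α (TensorProduct.congr Y.α Z.α)).toLinearMap ∘ₗ
      (assocEquiv X Y Z).toLinearMap)
    (TensorProduct.ext_threefold fun x y z => by
      simp [assocEquiv, zpow_apply_one, apply_zpow]) z)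
  leftUnitor X := mkIso (leftUnitEquiv X) (fun z => LinearMap.congr_fun
    (f := (leftUnitEquiv X).toLinearMap ∘ₗ
      (TensorProduct.congr (LinearEquiv.refl k k) X.α).toLinearMap)
    (g := X.α.toLinearMap ∘ₗ (leftUnitEquiv X).toLinearMap)
    (TensorProduct.ext' fun c x => by
      simp [leftUnitEquiv, zpow_apply_one, apply_zpow]) z)
  rightUnitor X := mkIso (rightUnitEquiv X) (fun z => LinearMap.congr_fun
    (f := (rightUnitEquiv X).toLinearMap ∘ₗ
      (TensorProduct.congr X.α (LinearEquiv.refl k k)).toLinearMap)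
    (g := X.α.toLinearMap ∘ₗ (rightUnitEquiv X).toLinearMap)
    (TensorProduct.ext' fun c x => by
      simp [rightUnitEquiv, zpow_apply_one, apply_zpow]) z)

/-- The elementary tensor `x ⊗ y`, as an element of the object `X ⊗ Y`. -/
def tm {X Y : HomVec k i j} (x : X.carrier) (y : Y.carrier) : (X ⊗ Y).carrier := x ⊗ₜ[k] y

/-- A scalar, as an element of the unit object. -/
def sc (c : k) : (𝟙_ (HomVec k i j)).carrier := c

theorem tensorHom_tm {X Y X' Y' : HomVec k i j} (f : X ⟶ Y) (g : X' ⟶ Y')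
    (x : X.carrier) (y : X'.carrier) :
    Hom.toLin (f ⊗ₘ g) (tm x y) = tm (Hom.toLin f x) (Hom.toLin g y) := rfl

theorem whiskerLeft_tm (X : HomVec k i j) {X' Y' : HomVec k i j} (g : X' ⟶ Y')
    (x : X.carrier) (y : X'.carrier) :
    Hom.toLin (X ◁ g) (tm x y) = tm x (Hom.toLin g y) := rfl

theorem whiskerRight_tm {X Y : HomVec k i j} (f : X ⟶ Y) (X' : HomVec k i j)
    (x : X.carrier) (y : X'.carrier) :
    Hom.toLin (f ▷ X') (tm x y) = tm (Hom.toLin f x) y := rfl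

theorem associator_tm (X Y Z : HomVec k i j) (x : X.carrier) (y : Y.carrier) (z : Z.carrier) :
    Hom.toLin (α_ X Y Z).hom (tm (tm x y) z) =
      tm ((X.α ^ (i + 1)) x) (tm y ((Z.α ^ (-j - 1)) z)) := rfl

theorem leftUnitor_tm (X : HomVec k i j) (c : k) (x : X.carrier) :
    Hom.toLin (λ_ X).hom (tm (sc c) x) = c • (X.α ^ (j + 1)) x := by
  change (X.α ^ (j + 1) : X.carrier ≃ₗ[k] X.carrier)
    (TensorProduct.lid k X.carrier (c ⊗ₜ[k] x)) = _
  simp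

theorem rightUnitor_tm (X : HomVec k i j) (c : k) (x : X.carrier) :
    Hom.toLin (ρ_ X).hom (tm x (sc c)) = c • (X.α ^ (i + 1)) x := by
  change (X.α ^ (i + 1) : X.carrier ≃ₗ[k] X.carrier)
    (TensorProduct.rid k X.carrier (x ⊗ₜ[k] c)) = _
  simp

theorem comp_apply {X Y Z : HomVec k i j} (f : X ⟶ Y) (g : Y ⟶ Z) (x : X.carrier) :
    Hom.toLin (f ≫ g) x = Hom.toLin g (Hom.toLin f x) := rfl

theorem id_apply (X : HomVec k i j) (x : X.carrier) : Hom.toLin (𝟙 X) x = x := rfl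

theorem hom_α {X Y : HomVec k i j} (f : X ⟶ Y) (x : X.carrier) :
    Hom.toLin f (X.α x) = Y.α (Hom.toLin f x) := f.comm x

theorem hom_zpow {X Y : HomVec k i j} (f : X ⟶ Y) (n : ℤ) (x : X.carrier) :
    Hom.toLin f ((X.α ^ n) x) = (Y.α ^ n) (Hom.toLin f x) :=
  zpow_comm_apply f.toLin f.comm n x

theorem tensor_α_zpow_tm (X Y : HomVec k i j) (n : ℤ) (x : X.carrier) (y : Y.carrier) :
    ((X ⊗ Y).α ^ n) (tm x y) = tm ((X.α ^ n) x) ((Y.α ^ n) y) :=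
  congr_zpow_tmul _ _ _ _ _

theorem tensor_α_tm (X Y : HomVec k i j) (x : X.carrier) (y : Y.carrier) :
    (X ⊗ Y).α (tm x y) = tm (X.α x) (Y.α y) := rfl

theorem unit_α_zpow (n : ℤ) (c : k) :
    ((𝟙_ (HomVec k i j)).α ^ n) (sc c) = sc c := refl_zpow n c

theorem smul_tm {X Y : HomVec k i j} (c : k) (x : X.carrier) (y : Y.carrier) :
    tm (c • x) y = c • tm x y := TensorProduct.smul_tmul' c x y

theorem tm_smul {X Y : HomVec k i j} (c : k) (x : X.carrier) (y : Y.carrier) :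
    tm x (c • y) = c • tm x y := TensorProduct.tmul_smul c x y

theorem lin_ext₂ {X Y : HomVec k i j} {M : Type*} [AddCommGroup M] [Module k M]
    {f g : (X ⊗ Y).carrier →ₗ[k] M} (h : ∀ x y, f (tm x y) = g (tm x y)) : f = g :=
  TensorProduct.ext' h

theorem hom_ext₂ {X Y Z : HomVec k i j} {f g : X ⊗ Y ⟶ Z}
    (h : ∀ x y, Hom.toLin f (tm x y) = Hom.toLin g (tm x y)) : f = g :=
  hom_ext (lin_ext₂ h)

theorem hom_ext₃ {X Y Z W : HomVec k i j} {f g : (X ⊗ Y) ⊗ Z ⟶ W}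
    (h : ∀ x y z, Hom.toLin f (tm (tm x y) z) = Hom.toLin g (tm (tm x y) z)) :
    f = g :=
  hom_ext (TensorProduct.ext_threefold h)

theorem hom_ext₄ {X Y Z W V : HomVec k i j} {f g : ((X ⊗ Y) ⊗ Z) ⊗ W ⟶ V}
    (h : ∀ x y z w, Hom.toLin f (tm (tm (tm x y) z) w) =
      Hom.toLin g (tm (tm (tm x y) z) w)) :
    f = g :=
  hom_ext (TensorProduct.ext_fourfold h)

instance : MonoidalCategory (HomVec k i j) where
  tensorHom_def f g := hom_ext₂ fun x y => rfl
  id_tensorHom_id X Y := hom_ext₂ fun x y => rfl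
  tensorHom_comp_tensorHom f₁ f₂ g₁ g₂ := hom_ext₂ fun x y => rfl
  whiskerLeft_id X Y := hom_ext₂ fun x y => rfl
  id_whiskerRight X Y := hom_ext₂ fun x y => rfl
  associator_naturality f₁ f₂ f₃ := hom_ext₃ fun x y z => by
    simp only [comp_apply, tensorHom_tm, associator_tm, hom_zpow]
  leftUnitor_naturality {X Y} f := hom_ext₂ fun c x => by
    obtain ⟨c, rfl⟩ : ∃ d, sc d = c := ⟨c, rfl⟩
    simp only [comp_apply, leftUnitor_tm, hom_zpow, map_smul, whiskerLeft_tm]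
  rightUnitor_naturality {X Y} f := hom_ext₂ fun x c => by
    obtain ⟨c, rfl⟩ : ∃ d, sc d = c := ⟨c, rfl⟩
    simp only [comp_apply, rightUnitor_tm, hom_zpow, map_smul, whiskerRight_tm]
  pentagon W X Y Z := hom_ext₄ fun w x y z => by
    simp only [comp_apply, whiskerRight_tm, whiskerLeft_tm, associator_tm,
      tensor_α_zpow_tm, zpow_zpow_apply]
  triangle X Y := hom_ext₃ fun x c y => by
    obtain ⟨c, rfl⟩ : ∃ d, sc d = c := ⟨c, rfl⟩
    simp only [comp_apply, whiskerRight_tm, whiskerLeft_tm, rightUnitor_tm, associator_tm,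
      leftUnitor_tm, zpow_zpow_apply, show j + 1 + (-j - 1) = 0 by ring, zpow_zero_apply,
      smul_tm, tm_smul]

end HomVec

section abstract_part

universe v w

variable {C : Type w} [Category.{v} C]

/-- The category of `φ`-bicomodules of two comonads `F`, `G` and a transformation `φ : FG ⟶ GF`. -/
structure Bicomodule {F G : Comonad C}
    (φ : G.toFunctor ⋙ F.toFunctor ⟶ F.toFunctor ⋙ G.toFunctor) where
  obj : C
  θ : obj ⟶ F.obj obj
  θ_counit : θ ≫ F.ε.app obj = 𝟙 obj
  θ_coassoc : θ ≫ F.δ.app obj = θ ≫ F.map θ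
  ρ : obj ⟶ G.obj obj
  ρ_counit : ρ ≫ G.ε.app obj = 𝟙 obj
  ρ_coassoc : ρ ≫ G.δ.app obj = ρ ≫ G.map ρ
  compat : θ ≫ F.map ρ ≫ φ.app obj = ρ ≫ G.map θ

namespace Bicomodule

variable {F G : Comonad C} {φ : G.toFunctor ⋙ F.toFunctor ⟶ F.toFunctor ⋙ G.toFunctor}

/-- Morphisms that are both `F`-colinear and `G`-colinear. -/
@[ext]
structure Hom (M N : Bicomodule φ) where
  hom : M.obj ⟶ N.obj
  comm_θ : M.θ ≫ F.map hom = hom ≫ N.θ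
  comm_ρ : M.ρ ≫ G.map hom = hom ≫ N.ρ

instance : Category (Bicomodule φ) where
  Hom M N := Hom M N
  id M := ⟨𝟙 _, by simp, by simp⟩
  comp f g := ⟨f.hom ≫ g.hom,
    by rw [Functor.map_comp, reassoc_of% f.comm_θ, g.comm_θ, Category.assoc],
    by rw [Functor.map_comp, reassoc_of% f.comm_ρ, g.comm_ρ, Category.assoc]⟩
  id_comp f := Hom.ext (Category.id_comp _)
  comp_id f := Hom.ext (Category.comp_id _)
  assoc f g h := Hom.ext (Category.assoc _ _ _)

variable (φ) in
def forget : Bicomodule φ ⥤ C where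
  obj M := M.obj
  map f := Hom.hom f

instance : (forget φ).Faithful where
  map_injective h := Hom.ext h

def mkIso {M N : Bicomodule φ} (e : M.obj ≅ N.obj)
    (hθ : M.θ ≫ F.map e.hom = e.hom ≫ N.θ) (hρ : M.ρ ≫ G.map e.hom = e.hom ≫ N.ρ) :
    M ≅ N where
  hom := ⟨e.hom, hθ, hρ⟩
  inv := ⟨e.inv, by
      rw [← cancel_epi e.hom, ← reassoc_of% hθ, ← F.map_comp]; simp, by
      rw [← cancel_epi e.hom, ← reassoc_of% hρ, ← G.map_comp]; simp⟩
  hom_inv_id := Hom.ext e.hom_inv_id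
  inv_hom_id := Hom.ext e.inv_hom_id

end Bicomodule

variable [MonoidalCategory C]

/-- A bicomonad: a comonad whose underlying functor is (lax) monoidal, such that the
comultiplication and the counit are monoidal transformations. -/
structure Bicomonad (C : Type w) [Category.{v} C] [MonoidalCategory C] extends Comonad C where
  [lax : toFunctor.LaxMonoidal]
  [δ_monoidal : NatTrans.IsMonoidal δ]
  [ε_monoidal : NatTrans.IsMonoidal ε]

attribute [instance] Bicomonad.lax Bicomonad.δ_monoidal Bicomonad.ε_monoidal

/-- A monoidal comonad distributive law `φ : FG ⟶ GF`. -/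
structure MonoidalDistLaw (F G : Bicomonad C) where
  φ : G.toFunctor ⋙ F.toFunctor ⟶ F.toFunctor ⋙ G.toFunctor
  law₁ : ∀ X, F.map (G.δ.app X) ≫ φ.app (G.obj X) ≫ G.map (φ.app X) =
    φ.app X ≫ G.δ.app (F.obj X)
  law₂ : ∀ X, F.δ.app (G.obj X) ≫ F.map (φ.app X) ≫ φ.app (F.obj X) =
    φ.app X ≫ G.map (F.δ.app X)
  law₃ : ∀ X, φ.app X ≫ G.map (F.ε.app X) = F.ε.app (G.obj X)
  law₄ : ∀ X, φ.app X ≫ G.ε.app (F.obj X) = F.map (G.ε.app X)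
  [monoidal : NatTrans.IsMonoidal φ]

attribute [instance] MonoidalDistLaw.monoidal

namespace Bicomodule

open Functor.LaxMonoidal

section coaction

variable (F : Bicomonad C)

theorem tensor_counit {M N : C} (a : M ⟶ F.obj M) (b : N ⟶ F.obj N)
    (ha : a ≫ F.ε.app M = 𝟙 M) (hb : b ≫ F.ε.app N = 𝟙 N) :
    ((a ⊗ₘ b) ≫ μ F.toFunctor M N) ≫ F.ε.app (M ⊗ N) = 𝟙 (M ⊗ N) := by
  have h := NatTrans.IsMonoidal.tensor (τ := F.ε) M N
  simp only [Functor.LaxMonoidal.id_μ, Category.comp_id] at h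
  rw [Category.assoc, h]
  simp [ha, hb]

theorem tensor_coassoc {M N : C} (a : M ⟶ F.obj M) (b : N ⟶ F.obj N)
    (ha : a ≫ F.δ.app M = a ≫ F.map a) (hb : b ≫ F.δ.app N = b ≫ F.map b) :
    ((a ⊗ₘ b) ≫ μ F.toFunctor M N) ≫ F.δ.app (M ⊗ N) =
      ((a ⊗ₘ b) ≫ μ F.toFunctor M N) ≫ F.map ((a ⊗ₘ b) ≫ μ F.toFunctor M N) := by
  have h := NatTrans.IsMonoidal.tensor (τ := F.δ) M N
  simp only [Functor.LaxMonoidal.comp_μ] at h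
  rw [Category.assoc, h, F.map_comp, Category.assoc,
    ← Functor.LaxMonoidal.μ_natural_assoc, ← Category.assoc, ← Category.assoc,
    MonoidalCategory.tensorHom_comp_tensorHom, ha, hb,
    ← MonoidalCategory.tensorHom_comp_tensorHom, Category.assoc, Category.assoc]

theorem unit_counit : ε F.toFunctor ≫ F.ε.app (𝟙_ C) = 𝟙 _ := by
  simp

theorem unit_coassoc : ε F.toFunctor ≫ F.δ.app (𝟙_ C) = ε F.toFunctor ≫ F.map (ε F.toFunctor) := by
  simp

theorem tensor_colinear {M N M' N' : C} {a : M ⟶ F.obj M} {b : N ⟶ F.obj N}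
    {a' : M' ⟶ F.obj M'} {b' : N' ⟶ F.obj N'} (f : M ⟶ M') (g : N ⟶ N')
    (hf : a ≫ F.map f = f ≫ a') (hg : b ≫ F.map g = g ≫ b') :
    ((a ⊗ₘ b) ≫ μ F.toFunctor M N) ≫ F.map (f ⊗ₘ g) =
      (f ⊗ₘ g) ≫ (a' ⊗ₘ b') ≫ μ F.toFunctor M' N' := by
  rw [Category.assoc, ← Functor.LaxMonoidal.μ_natural, ← Category.assoc, ← Category.assoc,
    MonoidalCategory.tensorHom_comp_tensorHom, MonoidalCategory.tensorHom_comp_tensorHom, hf, hg]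

theorem assoc_colinear {M N P : C} (a : M ⟶ F.obj M) (b : N ⟶ F.obj N) (c : P ⟶ F.obj P) :
    (((((a ⊗ₘ b) ≫ μ F.toFunctor M N) ⊗ₘ c) ≫ μ F.toFunctor (M ⊗ N) P)) ≫
        F.map (α_ M N P).hom =
      (α_ M N P).hom ≫ (a ⊗ₘ ((b ⊗ₘ c) ≫ μ F.toFunctor N P)) ≫ μ F.toFunctor M (N ⊗ P) := by
  have h := Functor.LaxMonoidal.associativity F.toFunctor M N P
  have h1 : (((a ⊗ₘ b) ≫ μ F.toFunctor M N) ⊗ₘ c) =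
      ((a ⊗ₘ b) ⊗ₘ c) ≫ μ F.toFunctor M N ▷ F.obj P := by
    rw [← MonoidalCategory.tensorHom_id, MonoidalCategory.tensorHom_comp_tensorHom,
      Category.comp_id]
  have h2 : (a ⊗ₘ ((b ⊗ₘ c) ≫ μ F.toFunctor N P)) =
      (a ⊗ₘ (b ⊗ₘ c)) ≫ F.obj M ◁ μ F.toFunctor N P := by
    rw [← MonoidalCategory.id_tensorHom, MonoidalCategory.tensorHom_comp_tensorHom,
      Category.comp_id]
  rw [h1, h2]
  simp only [Category.assoc]
  rw [h, MonoidalCategory.associator_naturality_assoc]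

theorem left_colinear {M : C} (a : M ⟶ F.obj M) :
    ((ε F.toFunctor ⊗ₘ a) ≫ μ F.toFunctor (𝟙_ C) M) ≫ F.map (λ_ M).hom = (λ_ M).hom ≫ a := by
  have h := Functor.LaxMonoidal.left_unitality F.toFunctor M
  have h1 : (ε F.toFunctor ⊗ₘ a) = 𝟙_ C ◁ a ≫ ε F.toFunctor ▷ F.obj M := by
    rw [MonoidalCategory.tensorHom_def']
  rw [h1]
  simp only [Category.assoc]
  rw [← h, MonoidalCategory.leftUnitor_naturality]

theorem right_colinear {M : C} (a : M ⟶ F.obj M) :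
    ((a ⊗ₘ ε F.toFunctor) ≫ μ F.toFunctor M (𝟙_ C)) ≫ F.map (ρ_ M).hom = (ρ_ M).hom ≫ a := by
  have h := Functor.LaxMonoidal.right_unitality F.toFunctor M
  have h1 : (a ⊗ₘ ε F.toFunctor) = a ▷ 𝟙_ C ≫ F.obj M ◁ ε F.toFunctor := by
    rw [MonoidalCategory.tensorHom_def]
  rw [h1]
  simp only [Category.assoc]
  rw [← h, MonoidalCategory.rightUnitor_naturality]

end coaction

variable {F G : Bicomonad C} {L : MonoidalDistLaw F G}

/-- The tensor product of two bicomodules: both coactions are `(coaction ⊗ coaction) ≫ μ`. -/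
@[simps]
def tensor (M N : Bicomodule L.φ) : Bicomodule L.φ where
  obj := M.obj ⊗ N.obj
  θ := (M.θ ⊗ₘ N.θ) ≫ μ F.toFunctor M.obj N.obj
  θ_counit := tensor_counit F _ _ M.θ_counit N.θ_counit
  θ_coassoc := tensor_coassoc F _ _ M.θ_coassoc N.θ_coassoc
  ρ := (M.ρ ⊗ₘ N.ρ) ≫ μ G.toFunctor M.obj N.obj
  ρ_counit := tensor_counit G _ _ M.ρ_counit N.ρ_counit
  ρ_coassoc := tensor_coassoc G _ _ M.ρ_coassoc N.ρ_coassoc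
  compat := by
    have h := NatTrans.IsMonoidal.tensor (τ := L.φ) M.obj N.obj
    simp only [Functor.LaxMonoidal.comp_μ, Category.assoc, Functor.comp_obj] at h
    simp only [Category.assoc, Functor.map_comp]
    rw [← Functor.LaxMonoidal.μ_natural_assoc, h, ← Functor.LaxMonoidal.μ_natural_assoc]
    simp only [← Category.assoc, MonoidalCategory.tensorHom_comp_tensorHom]
    simp only [Category.assoc, M.compat, N.compat]

/-- The unit bicomodule. -/
@[simps]
def unit : Bicomodule L.φ where
  obj := 𝟙_ C
  θ := ε F.toFunctor
  θ_counit := unit_counit F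
  θ_coassoc := unit_coassoc F
  ρ := ε G.toFunctor
  ρ_counit := unit_counit G
  ρ_coassoc := unit_coassoc G
  compat := by
    have h := NatTrans.IsMonoidal.unit (τ := L.φ)
    simp only [Functor.LaxMonoidal.comp_ε, Category.assoc] at h
    exact h

instance : MonoidalCategoryStruct (Bicomodule L.φ) where
  tensorObj := tensor
  tensorUnit := unit
  tensorHom f g := ⟨Hom.hom f ⊗ₘ Hom.hom g, tensor_colinear F _ _ f.comm_θ g.comm_θ,
    tensor_colinear G _ _ f.comm_ρ g.comm_ρ⟩
  whiskerLeft M _ _ f := ⟨M.obj ◁ Hom.hom f, by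
      rw [← MonoidalCategory.id_tensorHom]
      exact tensor_colinear F _ _ (𝟙 M : M ⟶ M).comm_θ f.comm_θ, by
      rw [← MonoidalCategory.id_tensorHom]
      exact tensor_colinear G _ _ (𝟙 M : M ⟶ M).comm_ρ f.comm_ρ⟩
  whiskerRight f N := ⟨Hom.hom f ▷ N.obj, by
      rw [← MonoidalCategory.tensorHom_id]
      exact tensor_colinear F _ _ f.comm_θ (𝟙 N : N ⟶ N).comm_θ, by
      rw [← MonoidalCategory.tensorHom_id]
      exact tensor_colinear G _ _ f.comm_ρ (𝟙 N : N ⟶ N).comm_ρ⟩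
  associator M N P := mkIso (α_ M.obj N.obj P.obj) (assoc_colinear F _ _ _)
    (assoc_colinear G _ _ _)
  leftUnitor M := mkIso (λ_ M.obj) (left_colinear F _) (left_colinear G _)
  rightUnitor M := mkIso (ρ_ M.obj) (right_colinear F _) (right_colinear G _)

/-- The monoidal category of bicomodules, with the constraints of `C`. -/
instance : MonoidalCategory (Bicomodule L.φ) where
  tensorHom_def f g := Hom.ext (MonoidalCategory.tensorHom_def _ _)
  id_tensorHom_id M N := Hom.ext (MonoidalCategory.id_tensorHom_id _ _)
  tensorHom_comp_tensorHom f₁ f₂ g₁ g₂ :=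
    Hom.ext (MonoidalCategory.tensorHom_comp_tensorHom _ _ _ _)
  whiskerLeft_id M N := Hom.ext (MonoidalCategory.whiskerLeft_id _ _)
  id_whiskerRight M N := Hom.ext (MonoidalCategory.id_whiskerRight _ _)
  associator_naturality f₁ f₂ f₃ := Hom.ext (MonoidalCategory.associator_naturality _ _ _)
  leftUnitor_naturality f := Hom.ext (MonoidalCategory.leftUnitor_naturality _)
  rightUnitor_naturality f := Hom.ext (MonoidalCategory.rightUnitor_naturality _)
  pentagon M N P Q := Hom.ext (MonoidalCategory.pentagon _ _ _ _)
  triangle M N := Hom.ext (MonoidalCategory.triangle _ _)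

end Bicomodule

end abstract_part

section structures

variable (k : Type u) [Field k] (V : Type u) [AddCommGroup V] [Module k V]

/-- A vector space with a bijective structure map. -/
structure HomSpace where
  α : V ≃ₗ[k] V

/-- A unital Hom-algebra with bijective structure map. -/
structure HomAlgebra extends HomSpace k V where
  mul : V ⊗[k] V →ₗ[k] V
  one : V
  hom_assoc : ∀ a b c, mul (α a ⊗ₜ mul (b ⊗ₜ c)) = mul (mul (a ⊗ₜ b) ⊗ₜ α c)
  α_one : α one = one
  one_mul : ∀ a, mul (one ⊗ₜ a) = α a
  mul_one : ∀ a, mul (a ⊗ₜ one) = α a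

/-- A counital Hom-coalgebra with bijective structure map. -/
structure HomCoalgebra extends HomSpace k V where
  comul : V →ₗ[k] V ⊗[k] V
  counit : V →ₗ[k] k
  counit_α : ∀ c, counit (α c) = counit c
  hom_coassoc : ∀ c, TensorProduct.map α.toLinearMap comul (comul c) =
    TensorProduct.assoc k V V V (TensorProduct.map comul α.toLinearMap (comul c))
  counit_comul : ∀ c, TensorProduct.lid k V (counit.rTensor V (comul c)) = α c
  comul_counit : ∀ c, TensorProduct.rid k V (counit.lTensor V (comul c)) = α c

/-- A Hom-bialgebra with bijective structure map. -/
structure HomBialgebra extends HomAlgebra k V, HomCoalgebra k V where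
  comul_mul : ∀ a b, comul (mul (a ⊗ₜ b)) =
    TensorProduct.map mul mul
      (TensorProduct.tensorTensorTensorComm k V V V V (comul a ⊗ₜ comul b))
  comul_one : comul one = one ⊗ₜ one
  counit_mul : ∀ a b, counit (mul (a ⊗ₜ b)) = counit a * counit b
  counit_one : counit one = 1

end structures

section basic

variable {k : Type u} [Field k] {V W : Type u} [AddCommGroup V] [Module k V]
  [AddCommGroup W] [Module k W]

theorem exists_rep (t : V ⊗[k] W) :
    ∃ (n : ℕ) (a : Fin n → V) (b : Fin n → W), t = ∑ i, a i ⊗ₜ[k] b i := by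
  induction t using TensorProduct.induction_on with
  | zero => exact ⟨0, Fin.elim0, Fin.elim0, by simp⟩
  | tmul x y => exact ⟨1, fun _ => x, fun _ => y, by simp⟩
  | add s t hs ht =>
    obtain ⟨n, a, b, rfl⟩ := hs
    obtain ⟨m, c, d, rfl⟩ := ht
    exact ⟨n + m, Fin.append a c, Fin.append b d, by simp [Fin.sum_univ_add]⟩

namespace HomAlgebra

variable (S : HomAlgebra k V)

theorem α_mul (a b : V) : S.α (S.mul (a ⊗ₜ b)) = S.mul (S.α a ⊗ₜ S.α b) := by
  have h := S.hom_assoc a b S.one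
  rw [S.mul_one, S.α_one, S.mul_one] at h
  exact h.symm

theorem zpow_mul (n : ℤ) (a b : V) :
    (S.α ^ n) (S.mul (a ⊗ₜ b)) = S.mul ((S.α ^ n) a ⊗ₜ (S.α ^ n) b) := by
  have h := zpow_comm_apply (α := TensorProduct.congr S.α S.α) (β := S.α) S.mul
    (LinearMap.congr_fun (f := S.mul ∘ₗ (TensorProduct.congr S.α S.α).toLinearMap)
      (g := S.α.toLinearMap ∘ₗ S.mul) (TensorProduct.ext' fun a b => by simp [S.α_mul])) n
      (a ⊗ₜ b)
  rw [congr_zpow_tmul] at h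
  exact h.symm

theorem zpow_one (n : ℤ) : (S.α ^ n) S.one = S.one := by
  have h := zpow_comm_apply (α := LinearEquiv.refl k k) (β := S.α)
    (LinearMap.toSpanSingleton k V S.one) (fun x => by simp [S.α_one]) n 1
  rw [refl_zpow] at h
  simpa using h.symm

end HomAlgebra

namespace HomCoalgebra

variable (S : HomCoalgebra k V)

theorem comul_α (c : V) :
    S.comul (S.α c) = TensorProduct.map S.α.toLinearMap S.α.toLinearMap (S.comul c) := by
  have h := congrArg (LinearMap.lTensor V
    ((TensorProduct.rid k V).toLinearMap ∘ₗ S.counit.lTensor V)) (S.hom_coassoc c)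
  have e1 := S.comul_counit
  have e2 := S.comul_counit c
  obtain ⟨n, a, b, hc⟩ := exists_rep (S.comul c)
  choose m p q hp using fun i => exists_rep (S.comul (a i))
  simp only [hc, map_sum, TensorProduct.map_tmul, LinearMap.lTensor_tmul, LinearMap.comp_apply,
    LinearEquiv.coe_coe, e1, hp, TensorProduct.sum_tmul, TensorProduct.assoc_tmul,
    TensorProduct.rid_tmul, S.counit_α] at h e2 ⊢
  rw [h, ← e2, map_sum]
  refine Finset.sum_congr rfl fun i _ => ?_
  rw [map_smul, hp, Finset.smul_sum]
  simp

theorem zpow_comul (n : ℤ) (c : V) :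
    S.comul ((S.α ^ n) c) =
      TensorProduct.map (S.α ^ n).toLinearMap (S.α ^ n).toLinearMap (S.comul c) := by
  rw [zpow_comm_apply (β := TensorProduct.congr S.α S.α) S.comul S.comul_α n c,
    TensorProduct.congr_zpow]
  rfl

theorem zpow_counit (n : ℤ) (c : V) : S.counit ((S.α ^ n) c) = S.counit c := by
  rw [zpow_comm_apply (β := LinearEquiv.refl k k) S.counit S.counit_α n c, refl_zpow]

end HomCoalgebra

end basic

section tensor_functor

variable {k : Type u} [Field k] {V : Type u} [AddCommGroup V] [Module k V]
  [FiniteDimensional k V]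

/-- The object `(V, α)` of the category of pairs. -/
abbrev HomSpace.toObj (S : HomSpace k V) (i j : ℤ) : HomVec k i j where
  carrier := V
  α := S.α

open HomVec

namespace HomCoalgebra

variable (S : HomCoalgebra k V) (i j : ℤ)

/-- `x ⊗ h ↦ (α_X(x) ⊗ h₁) ⊗ α_H⁻¹(h₂)`. -/
def deltaApp (X : HomVec k i j) :
    X ⊗ S.toObj i j ⟶ (X ⊗ S.toObj i j) ⊗ S.toObj i j where
  toLin := (TensorProduct.assoc k X.carrier V V).symm.toLinearMap ∘ₗ
    TensorProduct.map X.α.toLinearMap (LinearMap.lTensor V S.α.symm.toLinearMap ∘ₗ S.comul)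
  comm z := LinearMap.congr_fun
    (f := ((TensorProduct.assoc k X.carrier V V).symm.toLinearMap ∘ₗ
      TensorProduct.map X.α.toLinearMap (LinearMap.lTensor V S.α.symm.toLinearMap ∘ₗ S.comul)) ∘ₗ
      (TensorProduct.congr X.α S.α).toLinearMap)
    (g := (TensorProduct.congr (TensorProduct.congr X.α S.α) S.α).toLinearMap ∘ₗ
      ((TensorProduct.assoc k X.carrier V V).symm.toLinearMap ∘ₗ
      TensorProduct.map X.α.toLinearMap (LinearMap.lTensor V S.α.symm.toLinearMap ∘ₗ S.comul)))
    (TensorProduct.ext' fun x h => by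
      obtain ⟨n, a, b, hc⟩ := exists_rep (S.comul h)
      simp [S.comul_α, hc, TensorProduct.tmul_sum]) z

/-- `x ⊗ h ↦ ε(h) α_X⁻¹(x)`. -/
def epsilonApp (X : HomVec k i j) : X ⊗ S.toObj i j ⟶ X where
  toLin := (TensorProduct.rid k X.carrier).toLinearMap ∘ₗ
    TensorProduct.map X.α.symm.toLinearMap S.counit
  comm z := LinearMap.congr_fun
    (f := ((TensorProduct.rid k X.carrier).toLinearMap ∘ₗ
      TensorProduct.map X.α.symm.toLinearMap S.counit) ∘ₗ
      (TensorProduct.congr X.α S.α).toLinearMap)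
    (g := X.α.toLinearMap ∘ₗ ((TensorProduct.rid k X.carrier).toLinearMap ∘ₗ
      TensorProduct.map X.α.symm.toLinearMap S.counit))
    (TensorProduct.ext' fun x h => by simp [S.counit_α]) z

variable {i j}

theorem deltaApp_tm (X : HomVec k i j) (x : X.carrier) (h : V) {n : ℕ} {a b : Fin n → V}
    (hc : S.comul h = ∑ r, a r ⊗ₜ[k] b r) :
    Hom.toLin (S.deltaApp i j X) (tm x (Y := S.toObj i j) h) =
      ∑ r, tm (tm (X.α x) (Y := S.toObj i j) (a r)) (Y := S.toObj i j)
        ((S.α ^ (-1 : ℤ)) (b r)) := by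
  change (TensorProduct.assoc k X.carrier V V).symm (TensorProduct.map X.α.toLinearMap
    (LinearMap.lTensor V S.α.symm.toLinearMap ∘ₗ S.comul) (x ⊗ₜ h)) = _
  simp only [TensorProduct.map_tmul, LinearMap.comp_apply, hc, map_sum, TensorProduct.tmul_sum,
    LinearMap.lTensor_tmul, TensorProduct.assoc_symm_tmul]
  rw [zpow_neg_one]
  rfl

theorem epsilonApp_tm (X : HomVec k i j) (x : X.carrier) (h : V) :
    Hom.toLin (S.epsilonApp i j X) (tm x (Y := S.toObj i j) h) =
      S.counit h • (X.α ^ (-1 : ℤ)) x := by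
  change TensorProduct.rid k X.carrier
    (TensorProduct.map X.α.symm.toLinearMap S.counit (x ⊗ₜ h)) = _
  rw [zpow_neg_one]
  simp

theorem tm_sum {X Y : HomVec k i j} {n : ℕ} (x : X.carrier) (f : Fin n → Y.carrier) :
    tm x (∑ r, f r) = ∑ r, tm x (f r) := TensorProduct.tmul_sum _ _ _

theorem sum_tm {X Y : HomVec k i j} {n : ℕ} (f : Fin n → X.carrier) (y : Y.carrier) :
    tm (∑ r, f r) y = ∑ r, tm (f r) y := TensorProduct.sum_tmul _ _ _

variable (i j)

/-- The comonad on the category of pairs given by tensoring on the right with `(V, α)`. -/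
def comonad : Comonad (HomVec k i j) where
  toFunctor := MonoidalCategory.tensorRight (S.toObj i j)
  δ := { app := fun X => S.deltaApp i j X
         naturality := fun X Y f => hom_ext₂ fun x h => by
          obtain ⟨n, a, b, hc⟩ := exists_rep (S.comul h)
          change Hom.toLin (f ▷ S.toObj i j ≫ S.deltaApp i j Y) _ =
            Hom.toLin (S.deltaApp i j X ≫ (f ▷ S.toObj i j) ▷ S.toObj i j) _
          simp only [HomVec.comp_apply, whiskerRight_tm, S.deltaApp_tm _ _ _ hc, map_sum,
            hom_α] }
  ε := { app := fun X => S.epsilonApp i j X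
         naturality := fun X Y f => hom_ext₂ fun x h => by
          change Hom.toLin (f ▷ S.toObj i j ≫ S.epsilonApp i j Y) _ =
            Hom.toLin (S.epsilonApp i j X ≫ f) _
          simp only [HomVec.comp_apply, whiskerRight_tm, S.epsilonApp_tm, map_smul, hom_zpow] }
  coassoc X := hom_ext₂ fun x h => by
    change Hom.toLin (S.deltaApp i j X ≫ S.deltaApp i j X ▷ S.toObj i j) _ =
      Hom.toLin (S.deltaApp i j X ≫ S.deltaApp i j (X ⊗ S.toObj i j)) _
    let L : V ⊗[k] (V ⊗[k] V) →ₗ[k]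
        (((X ⊗ S.toObj i j) ⊗ S.toObj i j) ⊗ S.toObj i j).carrier :=
      (TensorProduct.assoc k (X.carrier ⊗[k] V) V V).symm.toLinearMap ∘ₗ
        (TensorProduct.assoc k X.carrier V (V ⊗[k] V)).symm.toLinearMap ∘ₗ
          (TensorProduct.mk k X.carrier (V ⊗[k] (V ⊗[k] V)) (X.α (X.α x))) ∘ₗ
        LinearMap.lTensor V (TensorProduct.map (S.α ^ (-1 : ℤ)).toLinearMap
          (S.α ^ (-2 : ℤ)).toLinearMap)
    have hL : ∀ a b c, L (a ⊗ₜ (b ⊗ₜ c)) =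
      tm (Y := S.toObj i j) (tm (Y := S.toObj i j) (tm (Y := S.toObj i j) (X.α (X.α x)) a)
        ((S.α ^ (-1 : ℤ)) b)) ((S.α ^ (-2 : ℤ)) c) := fun a b c => rfl
    have key := congrArg L (S.hom_coassoc h)
    obtain ⟨n, a, b, hc⟩ := exists_rep (S.comul h)
    choose m p q hp using fun r => exists_rep (S.comul (a r))
    choose m' p' q' hq using fun r => exists_rep (S.comul (b r))
    have hq' : ∀ r, S.comul ((S.α ^ (-1 : ℤ)) (b r)) =
        ∑ t, (S.α ^ (-1 : ℤ)) (p' r t) ⊗ₜ[k] (S.α ^ (-1 : ℤ)) (q' r t) := fun r => by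
      simp only [S.zpow_comul, hq, map_sum, TensorProduct.map_tmul, LinearEquiv.coe_coe]
    simp only [hc, map_sum, TensorProduct.map_tmul, LinearEquiv.coe_coe, hp, hq,
      TensorProduct.tmul_sum, TensorProduct.sum_tmul, TensorProduct.assoc_tmul, hL,
      zpow_apply_one, show (-2 : ℤ) + 1 = -1 by norm_num] at key
    simp only [HomVec.comp_apply, S.deltaApp_tm _ _ _ hc, map_sum, whiskerRight_tm,
      S.deltaApp_tm _ _ _ (hp _), S.deltaApp_tm _ _ _ (hq' _), tensor_α_tm, sum_tm,
      zpow_zpow_apply, show (-1 : ℤ) + -1 = -2 by norm_num]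
    exact key.symm
  left_counit X := hom_ext₂ fun x h => by
    obtain ⟨n, a, b, hc⟩ := exists_rep (S.comul h)
    have e := S.comul_counit h
    change Hom.toLin (S.deltaApp i j X ≫ S.epsilonApp i j (X ⊗ S.toObj i j)) _ = tm x h
    simp only [hc, map_sum, LinearMap.lTensor_tmul, TensorProduct.rid_tmul] at e
    simp only [HomVec.comp_apply, S.deltaApp_tm _ _ _ hc, map_sum, S.epsilonApp_tm,
      S.zpow_counit, tensor_α_zpow_tm, ← tm_smul, ← tm_sum]
    have e' := congrArg (S.α ^ (-1 : ℤ)) e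
    simp only [map_sum, map_smul, zpow_apply_one] at e'
    rw [zpow_apply_one]
    simp only [neg_add_cancel, zpow_zero_apply] at e' ⊢
    rw [e']
  right_counit X := hom_ext₂ fun x h => by
    obtain ⟨n, a, b, hc⟩ := exists_rep (S.comul h)
    have e := S.counit_comul h
    change Hom.toLin (S.deltaApp i j X ≫ S.epsilonApp i j X ▷ S.toObj i j) _ = tm x h
    simp only [hc, map_sum, LinearMap.rTensor_tmul, TensorProduct.lid_tmul] at e
    simp only [HomVec.comp_apply, S.deltaApp_tm _ _ _ hc, map_sum, whiskerRight_tm,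
      S.epsilonApp_tm, smul_tm, ← tm_smul, ← tm_sum]
    have e' := congrArg (S.α ^ (-1 : ℤ)) e
    simp only [map_sum, map_smul, zpow_apply_one] at e'
    rw [zpow_apply_one]
    simp only [neg_add_cancel, zpow_zero_apply] at e' ⊢
    rw [e']

end HomCoalgebra

end tensor_functor

section bicomonad

variable {k : Type u} [Field k] {V : Type u} [AddCommGroup V] [Module k V]
  [FiniteDimensional k V]

open HomVec

namespace HomAlgebra

variable (S : HomAlgebra k V) (i j : ℤ)

/-- `(x ⊗ a) ⊗ (y ⊗ b) ↦ (x ⊗ y) ⊗ α^i(a) α^j(b)`. -/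
def muLin (M N : Type u) [AddCommGroup M] [Module k M] [AddCommGroup N] [Module k N] :
    (M ⊗[k] V) ⊗[k] (N ⊗[k] V) →ₗ[k] (M ⊗[k] N) ⊗[k] V :=
  LinearMap.lTensor (M ⊗[k] N)
      (S.mul ∘ₗ TensorProduct.map (S.α ^ i).toLinearMap (S.α ^ j).toLinearMap) ∘ₗ
    (TensorProduct.tensorTensorTensorComm k M V N V).toLinearMap

theorem muLin_tmul (M N : Type u) [AddCommGroup M] [Module k M] [AddCommGroup N] [Module k N]
    (x : M) (y : N) (a b : V) :
    S.muLin i j M N ((x ⊗ₜ a) ⊗ₜ (y ⊗ₜ b)) =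
      (x ⊗ₜ y) ⊗ₜ S.mul ((S.α ^ i) a ⊗ₜ (S.α ^ j) b) := rfl

def muApp (X Y : HomVec k i j) :
    (X ⊗ S.toObj i j) ⊗ (Y ⊗ S.toObj i j) ⟶ (X ⊗ Y) ⊗ S.toObj i j where
  toLin := S.muLin i j X.carrier Y.carrier
  comm z := LinearMap.congr_fun
    (f := S.muLin i j X.carrier Y.carrier ∘ₗ (TensorProduct.congr (TensorProduct.congr X.α S.α)
      (TensorProduct.congr Y.α S.α)).toLinearMap)
    (g := (TensorProduct.congr (TensorProduct.congr X.α Y.α) S.α).toLinearMap ∘ₗ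
      S.muLin i j X.carrier Y.carrier)
    (TensorProduct.ext_fourfold' fun x a y b => by
      simp only [LinearMap.comp_apply, LinearEquiv.coe_coe, TensorProduct.congr_tmul, muLin_tmul,
        α_mul, zpow_apply_one, apply_zpow]) z

/-- `c ↦ c ⊗ 1`. -/
def epsApp : 𝟙_ (HomVec k i j) ⟶ 𝟙_ (HomVec k i j) ⊗ S.toObj i j where
  toLin := (TensorProduct.mk k k V).flip S.one
  comm c := by
    change c ⊗ₜ[k] S.one = c ⊗ₜ[k] S.α S.one
    rw [S.α_one]

theorem muApp_tm (X Y : HomVec k i j) (x : X.carrier) (y : Y.carrier) (a b : V) :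
    Hom.toLin (S.muApp i j X Y)
      (tm (tm x (Y := S.toObj i j) a) (tm y (Y := S.toObj i j) b)) =
      tm (tm x y) (Y := S.toObj i j) (S.mul ((S.α ^ i) a ⊗ₜ (S.α ^ j) b)) := rfl

theorem epsApp_sc (c : k) :
    Hom.toLin (S.epsApp i j) (sc c) = tm (sc c) (Y := S.toObj i j) S.one := rfl

theorem ext₆ {M N P Q : Type u} [AddCommGroup M] [Module k M] [AddCommGroup N] [Module k N]
    [AddCommGroup P] [Module k P] [AddCommGroup Q] [Module k Q]
    {f g : ((M ⊗[k] V) ⊗[k] (N ⊗[k] V)) ⊗[k] (P ⊗[k] V) →ₗ[k] Q}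
    (h : ∀ x a y b z c, f (((x ⊗ₜ a) ⊗ₜ (y ⊗ₜ b)) ⊗ₜ (z ⊗ₜ c)) =
      g (((x ⊗ₜ a) ⊗ₜ (y ⊗ₜ b)) ⊗ₜ (z ⊗ₜ c))) : f = g := by
  ext x a y b z c
  exact h x a y b z c

theorem hom_ext₃' {X Y Z W : HomVec k i j} {f g : X ⊗ (Y ⊗ Z) ⟶ W}
    (h : ∀ x y z, Hom.toLin f (tm x (tm y z)) = Hom.toLin g (tm x (tm y z))) :
    f = g :=
  hom_ext₂ fun x z => LinearMap.congr_fun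
    (f := Hom.toLin f ∘ₗ TensorProduct.mk k X.carrier (Y.carrier ⊗[k] Z.carrier) x)
    (g := Hom.toLin g ∘ₗ TensorProduct.mk k X.carrier (Y.carrier ⊗[k] Z.carrier) x)
    (TensorProduct.ext' (h x)) z

/-- The (lax) monoidal structure of the functor `_ ⊗ V`. -/
instance tensorRightLax :
    (MonoidalCategory.tensorRight (S.toObj i j)).LaxMonoidal where
  ε := S.epsApp i j
  μ X Y := S.muApp i j X Y
  μ_natural_left {X Y} f X' := hom_ext (TensorProduct.ext_fourfold' fun x a y b => rfl)
  μ_natural_right {X Y} X' f := hom_ext (TensorProduct.ext_fourfold' fun x a y b => rfl)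
  associativity X Y Z := hom_ext (ext₆ fun x a y b z c => by
    change Hom.toLin (S.muApp i j X Y ▷ (Z ⊗ S.toObj i j) ≫ S.muApp i j (X ⊗ Y) Z ≫
        (α_ X Y Z).hom ▷ S.toObj i j)
        (tm (tm (tm x (Y := S.toObj i j) a) (tm y (Y := S.toObj i j) b))
          (tm z (Y := S.toObj i j) c)) =
      Hom.toLin ((α_ (X ⊗ S.toObj i j) (Y ⊗ S.toObj i j) (Z ⊗ S.toObj i j)).hom ≫
        (X ⊗ S.toObj i j) ◁ S.muApp i j Y Z ≫ S.muApp i j X (Y ⊗ Z))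
        (tm (tm (tm x (Y := S.toObj i j) a) (tm y (Y := S.toObj i j) b))
          (tm z (Y := S.toObj i j) c))
    simp only [HomVec.comp_apply, whiskerRight_tm, whiskerLeft_tm, associator_tm, muApp_tm,
      tensor_α_zpow_tm, zpow_mul, zpow_zpow_apply]
    have h := S.hom_assoc ((S.α ^ (i + i)) a) ((S.α ^ (i + j)) b) ((S.α ^ (j - 1)) c)
    simp only [apply_zpow, sub_add_cancel] at h
    rw [← h, show i + (i + 1) = i + i + 1 by ring, show j + i = i + j by ring,
      show j + (j + (-j - 1)) = j - 1 by ring])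
  left_unitality X := hom_ext₃' i j fun c x a => by
    obtain ⟨c, rfl⟩ : ∃ d, sc d = c := ⟨c, rfl⟩
    change Hom.toLin (λ_ (X ⊗ S.toObj i j)).hom (tm (sc c) (tm x (Y := S.toObj i j) a)) =
      Hom.toLin (S.epsApp i j ▷ (X ⊗ S.toObj i j) ≫ S.muApp i j (𝟙_ _) X ≫
        (λ_ X).hom ▷ S.toObj i j) (tm (sc c) (tm x (Y := S.toObj i j) a))
    simp only [HomVec.comp_apply, whiskerRight_tm, leftUnitor_tm, muApp_tm, epsApp_sc,
      tensor_α_zpow_tm, S.zpow_one, S.one_mul, apply_zpow, smul_tm]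
  right_unitality X := hom_ext₃ fun x a c => by
    obtain ⟨c, rfl⟩ : ∃ d, sc d = c := ⟨c, rfl⟩
    change Hom.toLin (ρ_ (X ⊗ S.toObj i j)).hom (tm (tm x (Y := S.toObj i j) a) (sc c)) =
      Hom.toLin ((X ⊗ S.toObj i j) ◁ S.epsApp i j ≫ S.muApp i j X (𝟙_ _) ≫
        (ρ_ X).hom ▷ S.toObj i j) (tm (tm x (Y := S.toObj i j) a) (sc c))
    simp only [HomVec.comp_apply, whiskerRight_tm, whiskerLeft_tm, rightUnitor_tm, muApp_tm,
      epsApp_sc, tensor_α_zpow_tm, S.zpow_one, S.mul_one, apply_zpow, smul_tm]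

end HomAlgebra

namespace HomBialgebra

variable (S : HomBialgebra k V) (i j : ℤ)

instance : (S.comonad i j).toFunctor.LaxMonoidal :=
  inferInstanceAs (MonoidalCategory.tensorRight (S.toHomAlgebra.toObj i j)).LaxMonoidal

/-- The bicomonad `_ ⊗ V` of a Hom-bialgebra. -/
def bicomonad : Bicomonad (HomVec k i j) where
  toComonad := S.comonad i j
  δ_monoidal :=
    { unit := hom_ext (LinearMap.ext fun c => by
        obtain ⟨c, rfl⟩ : ∃ d, sc d = c := ⟨c, rfl⟩
        change Hom.toLin (S.epsApp i j ≫ S.deltaApp i j (𝟙_ _)) (sc c) =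
          Hom.toLin (S.epsApp i j ≫ S.epsApp i j ▷ S.toObj i j) (sc c)
        have h : S.comul S.one = ∑ r : Fin 1, S.one ⊗ₜ[k] S.one := by simp [S.comul_one]
        simp only [HomVec.comp_apply, S.epsApp_sc]
        rw [S.deltaApp_tm _ _ _ h, Fin.sum_univ_one, S.zpow_one, whiskerRight_tm, S.epsApp_sc]
        rfl)
      tensor := fun X Y => hom_ext (TensorProduct.ext_fourfold' fun x a y b => by
        change Hom.toLin (S.muApp i j X Y ≫ S.deltaApp i j (X ⊗ Y))
            (tm (tm x (Y := S.toObj i j) a) (tm y (Y := S.toObj i j) b)) =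
          Hom.toLin ((S.deltaApp i j X ⊗ₘ S.deltaApp i j Y) ≫
            S.muApp i j (X ⊗ S.toObj i j) (Y ⊗ S.toObj i j) ≫
              S.muApp i j X Y ▷ S.toObj i j)
            (tm (tm x (Y := S.toObj i j) a) (tm y (Y := S.toObj i j) b))
        obtain ⟨m, p, q, hp⟩ := exists_rep (S.comul a)
        obtain ⟨n, s, t, hs⟩ := exists_rep (S.comul b)
        have h : ∀ (Z : HomVec k i j) (z : Z.carrier) (c : V),
            Hom.toLin (S.deltaApp i j Z) (tm z (Y := S.toObj i j) c) =
              (TensorProduct.assoc k Z.carrier V V).symm (Z.α z ⊗ₜ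
                LinearMap.lTensor V (S.α ^ (-1 : ℤ)).toLinearMap (S.comul c)) := fun Z z c => by
          rw [zpow_neg_one]; rfl
        have h' : ∀ (Z : HomVec k i j) (z : Z.carrier) (c d : V),
            (TensorProduct.assoc k Z.carrier V V).symm (z ⊗ₜ (c ⊗ₜ d)) =
              tm (tm z (Y := S.toObj i j) c) (Y := S.toObj i j) d := fun Z z c d => rfl
        simp only [HomVec.comp_apply, S.muApp_tm, tensorHom_tm, h (X ⊗ Y), S.comul_mul,
          S.zpow_comul, S.deltaApp_tm _ _ _ hp, S.deltaApp_tm _ _ _ hs, hp, hs, map_sum,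
          TensorProduct.sum_tmul, TensorProduct.tmul_sum, TensorProduct.map_tmul,
          LinearEquiv.coe_coe, TensorProduct.tensorTensorTensorComm_tmul,
          LinearMap.lTensor_tmul, S.zpow_mul, h' (X ⊗ Y),
          HomCoalgebra.sum_tm, HomCoalgebra.tm_sum, whiskerRight_tm,
          tensor_α_tm, zpow_zpow_apply, add_comm (-1) i, add_comm (-1) j]) }
  ε_monoidal :=
    { unit := hom_ext (LinearMap.ext fun c => by
        obtain ⟨c, rfl⟩ : ∃ d, sc d = c := ⟨c, rfl⟩
        change Hom.toLin (S.epsApp i j ≫ S.epsilonApp i j (𝟙_ _)) (sc c) = sc c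
        simp only [HomVec.comp_apply, S.epsApp_sc, S.epsilonApp_tm, S.counit_one, unit_α_zpow,
          one_smul])
      tensor := fun X Y => hom_ext (TensorProduct.ext_fourfold' fun x a y b => by
        change Hom.toLin (S.muApp i j X Y ≫ S.epsilonApp i j (X ⊗ Y))
            (tm (tm x (Y := S.toObj i j) a) (tm y (Y := S.toObj i j) b)) =
          Hom.toLin (S.epsilonApp i j X ⊗ₘ S.epsilonApp i j Y)
            (tm (tm x (Y := S.toObj i j) a) (tm y (Y := S.toObj i j) b))
        simp only [HomVec.comp_apply, S.muApp_tm, tensorHom_tm, S.epsilonApp_tm, S.counit_mul,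
          S.zpow_counit, tensor_α_zpow_tm, smul_tm, tm_smul, smul_smul,
          mul_comm (S.counit b)]) }

end HomBialgebra

variable {W : Type u} [AddCommGroup W] [Module k W] [FiniteDimensional k W]

/-- `(x ⊗ b) ⊗ h ↦ ∑ (x ⊗ α_H(h)^φ) ⊗ α_B^n(α_B^{-n-1}(b)^φ)`, as a linear map. -/
def phiLin (B : HomSpace k W) (H : HomSpace k V) (φ : W ⊗[k] V →ₗ[k] V ⊗[k] W) (n : ℤ)
    (M : Type u) [AddCommGroup M] [Module k M] :
    (M ⊗[k] W) ⊗[k] V →ₗ[k] (M ⊗[k] V) ⊗[k] W :=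
  (TensorProduct.assoc k M V W).symm.toLinearMap ∘ₗ
    LinearMap.lTensor M (LinearMap.lTensor V (B.α ^ n).toLinearMap ∘ₗ φ ∘ₗ
      TensorProduct.map (B.α ^ (-n - 1)).toLinearMap H.α.toLinearMap) ∘ₗ
    (TensorProduct.assoc k M W V).toLinearMap

/-- The natural transformation `φ̈(n)` from `(_ ⊗ B) ⊗ H` to `(_ ⊗ H) ⊗ B` given by
`(x ⊗ b) ⊗ h ↦ ∑ (x ⊗ α_H(h)^φ) ⊗ α_B^n(α_B^{-n-1}(b)^φ)`, where `φ(b ⊗ h) = ∑ h^φ ⊗ b^φ`. -/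
def phiTrans (B : HomCoalgebra k W) (H : HomCoalgebra k V) (φ : W ⊗[k] V →ₗ[k] V ⊗[k] W)
    (hφ : ∀ z, φ (TensorProduct.map B.α.toLinearMap H.α.toLinearMap z) =
      TensorProduct.map H.α.toLinearMap B.α.toLinearMap (φ z)) (i j n : ℤ) :
    (B.comonad i j).toFunctor ⋙ (H.comonad i j).toFunctor ⟶
      (H.comonad i j).toFunctor ⋙ (B.comonad i j).toFunctor where
  app X :=
    { toLin := phiLin B.toHomSpace H.toHomSpace φ n X.carrier
      comm := fun z => LinearMap.congr_fun
        (f := phiLin B.toHomSpace H.toHomSpace φ n X.carrier ∘ₗ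
          (TensorProduct.congr (TensorProduct.congr X.α B.α) H.α).toLinearMap)
        (g := (TensorProduct.congr (TensorProduct.congr X.α H.α) B.α).toLinearMap ∘ₗ
          phiLin B.toHomSpace H.toHomSpace φ n X.carrier)
        (TensorProduct.ext_threefold fun x b h => by
          have h1 := hφ ((B.α ^ (-n - 1)) b ⊗ₜ H.α h)
          simp only [TensorProduct.map_tmul, LinearEquiv.coe_coe, apply_zpow] at h1
          obtain ⟨m, p, q, hp⟩ := exists_rep (φ ((B.α ^ (-n - 1)) b ⊗ₜ H.α h))
          simp only [phiLin, LinearMap.comp_apply, LinearEquiv.coe_coe,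
            TensorProduct.congr_tmul, TensorProduct.assoc_tmul, LinearMap.lTensor_tmul,
            TensorProduct.map_tmul, zpow_apply_one, h1, hp, map_sum, TensorProduct.tmul_sum,
            TensorProduct.assoc_symm_tmul, apply_zpow]) z }
  naturality X Y f := hom_ext (TensorProduct.ext_threefold fun x b h => by
    obtain ⟨m, p, q, hp⟩ := exists_rep (φ ((B.α ^ (-n - 1)) b ⊗ₜ H.α h))
    change phiLin B.toHomSpace H.toHomSpace φ n Y.carrier ((Hom.toLin f x ⊗ₜ b) ⊗ₜ h) =
      LinearMap.rTensor W (LinearMap.rTensor V (Hom.toLin f))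
        (phiLin B.toHomSpace H.toHomSpace φ n X.carrier ((x ⊗ₜ b) ⊗ₜ h))
    simp only [phiLin, LinearMap.comp_apply, LinearEquiv.coe_coe, TensorProduct.assoc_tmul,
      LinearMap.lTensor_tmul, TensorProduct.map_tmul, hp, map_sum, TensorProduct.tmul_sum,
      TensorProduct.assoc_symm_tmul, LinearMap.rTensor_tmul])

end bicomonad

section dual

variable {k : Type u} [Field k] {A : Type u} [AddCommGroup A] [Module k A]
  [FiniteDimensional k A]

open Module

theorem dualDistrib_ext {s t : Dual k A ⊗[k] Dual k A}
    (h : ∀ x y, TensorProduct.dualDistrib k A A s (x ⊗ₜ y) =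
      TensorProduct.dualDistrib k A A t (x ⊗ₜ y)) : s = t :=
  (TensorProduct.dualDistribEquiv k A A).injective (TensorProduct.ext' h)

theorem dualDistrib_ext₃ {s t : Dual k A ⊗[k] (Dual k A ⊗[k] Dual k A)}
    (h : ∀ x y z, TensorProduct.dualDistrib k A (A ⊗[k] A)
      (LinearMap.lTensor _ (TensorProduct.dualDistrib k A A) s) (x ⊗ₜ (y ⊗ₜ z)) =
      TensorProduct.dualDistrib k A (A ⊗[k] A)
      (LinearMap.lTensor _ (TensorProduct.dualDistrib k A A) t) (x ⊗ₜ (y ⊗ₜ z))) : s = t := by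
  have h1 : Function.Injective (LinearMap.lTensor (Dual k A)
      (TensorProduct.dualDistribEquiv k A A).toLinearMap) :=
    (TensorProduct.congr (LinearEquiv.refl k (Dual k A))
      (TensorProduct.dualDistribEquiv k A A)).injective
  refine h1 ((TensorProduct.dualDistribEquiv k A (A ⊗[k] A)).injective ?_)
  ext x y z
  exact h x y z

namespace HomAlgebra

variable (S : HomAlgebra k A)

/-- The comultiplication of `A^{*cop}`: `Δ(f)(x ⊗ y) = f(α⁻²(yx))`. -/
noncomputable def dualComul : Dual k A →ₗ[k] Dual k A ⊗[k] Dual k A :=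
  (TensorProduct.dualDistribEquiv k A A).symm.toLinearMap ∘ₗ
    ((S.α ^ (-2 : ℤ)).toLinearMap ∘ₗ S.mul ∘ₗ (TensorProduct.comm k A A).toLinearMap).dualMap

theorem dualComul_apply (f : Dual k A) (x y : A) :
    TensorProduct.dualDistrib k A A (S.dualComul f) (x ⊗ₜ y) =
      f ((S.α ^ (-2 : ℤ)) (S.mul (y ⊗ₜ x))) := by
  change (TensorProduct.dualDistribEquiv k A A) ((TensorProduct.dualDistribEquiv k A A).symm _)
    (x ⊗ₜ y) = _
  rw [LinearEquiv.apply_symm_apply]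
  rfl

theorem dualComul_rep (f : Dual k A) {n : ℕ} {p q : Fin n → Dual k A}
    (h : S.dualComul f = ∑ r, p r ⊗ₜ[k] q r) (x y : A) :
    ∑ r, p r x * q r y = f ((S.α ^ (-2 : ℤ)) (S.mul (y ⊗ₜ x))) := by
  rw [← dualComul_apply, h]
  simp [LinearMap.sum_apply]

/-- `f ↦ f ∘ α⁻¹`. -/
def dualα : Dual k A ≃ₗ[k] Dual k A := S.α.symm.dualMap

theorem dualα_apply (f : Dual k A) (x : A) : S.dualα f x = f ((S.α ^ (-1 : ℤ)) x) := by
  rw [zpow_neg_one]; rfl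

/-- The Hom-coalgebra `A^{*cop}` of a finite-dimensional Hom-algebra `A`. -/
noncomputable def dualCop : HomCoalgebra k (Dual k A) where
  α := S.dualα
  comul := S.dualComul
  counit := LinearMap.applyₗ S.one
  counit_α f := by
    change S.dualα f S.one = f S.one
    rw [dualα_apply, S.zpow_one]
  hom_coassoc f := by
    obtain ⟨n, p, q, h⟩ := exists_rep (S.dualComul f)
    have hf := S.dualComul_rep f h
    refine dualDistrib_ext₃ fun x y z => ?_
    choose m s t hs using fun r => exists_rep (S.dualComul (p r))
    have hs' := fun r => S.dualComul_rep (p r) (hs r)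
    simp only [h, map_sum, TensorProduct.map_tmul, LinearEquiv.coe_coe, LinearMap.lTensor_tmul,
      LinearMap.sum_apply, TensorProduct.dualDistrib_apply, dualα_apply, dualComul_apply, hf, hs,
      TensorProduct.sum_tmul, TensorProduct.assoc_tmul, ← mul_assoc, ← Finset.sum_mul, hs']
    rw [S.zpow_mul, S.zpow_mul, S.zpow_mul, S.zpow_mul]
    have e := S.hom_assoc ((S.α ^ (-4 : ℤ)) z) ((S.α ^ (-4 : ℤ)) y) ((S.α ^ (-4 : ℤ)) x)
    simp only [apply_zpow] at e
    simp only [zpow_zpow_apply, S.zpow_mul]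
    norm_num at e ⊢
    rw [e]
  counit_comul f := by
    obtain ⟨n, p, q, h⟩ := exists_rep (S.dualComul f)
    have hf := S.dualComul_rep f h
    ext y
    simp only [h, map_sum, LinearMap.rTensor_tmul, TensorProduct.lid_tmul, LinearMap.sum_apply,
      LinearMap.smul_apply, smul_eq_mul, LinearMap.applyₗ_apply_apply]
    rw [hf, S.mul_one, zpow_apply_one, dualα_apply]
    norm_num
  comul_counit f := by
    obtain ⟨n, p, q, h⟩ := exists_rep (S.dualComul f)
    have hf := S.dualComul_rep f h
    ext x
    simp only [h, map_sum, LinearMap.lTensor_tmul, TensorProduct.rid_tmul, LinearMap.sum_apply,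
      LinearMap.smul_apply, smul_eq_mul, LinearMap.applyₗ_apply_apply]
    simp only [mul_comm (q _ _)]
    rw [hf, S.one_mul, zpow_apply_one, dualα_apply]
    norm_num

end HomAlgebra

theorem sum_rearrange {n m l o : ℕ} (P : Fin n → Fin l → k) (Q : Fin n → Fin o → k)
    (S : Fin m → Fin l → k) (T : Fin m → Fin o → k) :
    ∑ r, ∑ s, (∑ c, P r c * S s c) * (∑ d, Q r d * T s d) =
      ∑ c, ∑ d, (∑ r, P r c * Q r d) * (∑ s, S s c * T s d) := by
  have A : ∀ {a b c : ℕ} (g : Fin a → Fin b → Fin c → k),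
      ∑ s, ∑ c, ∑ d, g s c d = ∑ c, ∑ d, ∑ s, g s c d := fun g => by
    rw [Finset.sum_comm]
    exact Finset.sum_congr rfl fun _ _ => Finset.sum_comm
  simp only [Finset.sum_mul_sum]
  refine ((Finset.sum_congr rfl fun r _ => A _).trans (A _)).trans ?_
  refine Finset.sum_congr rfl fun _ _ => Finset.sum_congr rfl fun _ _ =>
    Finset.sum_congr rfl fun _ _ => Finset.sum_congr rfl fun _ _ => ?_
  ring

namespace HomBialgebra

variable (S : HomBialgebra k A)

/-- The multiplication of `A^{*cop}`: `(f * g)(y) = f(α⁻²(y₁)) g(α⁻²(y₂))`. -/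
def dualMul : Dual k A ⊗[k] Dual k A →ₗ[k] Dual k A :=
  (TensorProduct.map (S.α ^ (-2 : ℤ)).toLinearMap (S.α ^ (-2 : ℤ)).toLinearMap ∘ₗ
    S.comul).dualMap ∘ₗ TensorProduct.dualDistrib k A A

theorem dualMul_rep (f g : Dual k A) {n : ℕ} {p q : Fin n → A} {y : A}
    (h : S.comul y = ∑ r, p r ⊗ₜ[k] q r) :
    S.dualMul (f ⊗ₜ g) y = ∑ r, f ((S.α ^ (-2 : ℤ)) (p r)) * g ((S.α ^ (-2 : ℤ)) (q r)) := by
  change TensorProduct.dualDistrib k A A (f ⊗ₜ g) (TensorProduct.map (S.α ^ (-2 : ℤ)).toLinearMap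
    (S.α ^ (-2 : ℤ)).toLinearMap (S.comul y)) = _
  simp [h]

/-- The Hom-bialgebra `A^{*cop}` of a finite-dimensional Hom-bialgebra `A`. -/
noncomputable def dualCop : HomBialgebra k (Dual k A) where
  toHomSpace := S.toHomAlgebra.dualCop.toHomSpace
  comul := S.toHomAlgebra.dualCop.comul
  counit := S.toHomAlgebra.dualCop.counit
  counit_α := S.toHomAlgebra.dualCop.counit_α
  hom_coassoc := S.toHomAlgebra.dualCop.hom_coassoc
  counit_comul := S.toHomAlgebra.dualCop.counit_comul
  comul_counit := S.toHomAlgebra.dualCop.comul_counit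
  mul := S.dualMul
  one := S.counit
  hom_assoc f g l := by
    ext y
    obtain ⟨n, p, q, h⟩ := exists_rep (S.comul y)
    choose m s t hs using fun r => exists_rep (S.comul (p r))
    choose m' s' t' hs' using fun r => exists_rep (S.comul (q r))
    have key := congrArg (TensorProduct.dualDistrib k A (A ⊗[k] A)
      ((f ∘ₗ (S.α ^ (-4 : ℤ)).toLinearMap) ⊗ₜ (TensorProduct.dualDistrib k A A
        ((g ∘ₗ (S.α ^ (-4 : ℤ)).toLinearMap) ⊗ₜ (l ∘ₗ (S.α ^ (-4 : ℤ)).toLinearMap)))))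
      (S.hom_coassoc y)
    have hz : ∀ (z : A) {n : ℕ} {p q : Fin n → A}, S.comul z = ∑ r, p r ⊗ₜ[k] q r →
        S.comul ((S.α ^ (-2 : ℤ)) z) =
          ∑ r, (S.α ^ (-2 : ℤ)) (p r) ⊗ₜ[k] (S.α ^ (-2 : ℤ)) (q r) := fun z n p q h => by
      simp only [S.zpow_comul, h, map_sum, TensorProduct.map_tmul, LinearEquiv.coe_coe]
    rw [S.dualMul_rep _ _ h, S.dualMul_rep _ _ h]
    simp only [S.dualMul_rep _ _ (hz _ (hs _)), S.dualMul_rep _ _ (hz _ (hs' _))]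
    change ∑ r, S.toHomAlgebra.dualα f _ * _ = ∑ r, _ * S.toHomAlgebra.dualα l _
    simp only [h, hs, hs', map_sum, TensorProduct.map_tmul, TensorProduct.sum_tmul,
      TensorProduct.tmul_sum, TensorProduct.assoc_tmul, TensorProduct.dualDistrib_apply,
      LinearEquiv.coe_coe, LinearMap.comp_apply, zpow_apply_one] at key
    simp only [HomAlgebra.dualα_apply, zpow_zpow_apply, Finset.mul_sum, Finset.sum_mul]
    norm_num at key ⊢
    simpa only [mul_assoc] using key
  α_one := by
    ext y
    change S.toHomAlgebra.dualα S.counit y = _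
    rw [HomAlgebra.dualα_apply, S.zpow_counit]
  one_mul f := by
    ext y
    obtain ⟨n, p, q, h⟩ := exists_rep (S.comul y)
    change _ = S.toHomAlgebra.dualα f y
    have e := congrArg (S.α ^ (-2 : ℤ)) (S.counit_comul y)
    simp only [h, map_sum, LinearMap.rTensor_tmul, TensorProduct.lid_tmul, map_smul,
      zpow_apply_one, show (-2 : ℤ) + 1 = -1 by norm_num] at e
    have e' := congrArg f e
    simp only [map_sum, map_smul, smul_eq_mul] at e'
    rw [S.dualMul_rep _ _ h, HomAlgebra.dualα_apply]
    simpa only [S.zpow_counit] using e'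
  mul_one f := by
    ext y
    obtain ⟨n, p, q, h⟩ := exists_rep (S.comul y)
    change _ = S.toHomAlgebra.dualα f y
    have e := congrArg (S.α ^ (-2 : ℤ)) (S.comul_counit y)
    simp only [h, map_sum, LinearMap.lTensor_tmul, TensorProduct.rid_tmul, map_smul,
      zpow_apply_one, show (-2 : ℤ) + 1 = -1 by norm_num] at e
    have e' := congrArg f e
    simp only [map_sum, map_smul, smul_eq_mul] at e'
    rw [S.dualMul_rep _ _ h, HomAlgebra.dualα_apply]
    simpa only [S.zpow_counit, mul_comm] using e'
  comul_mul f g := by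
    obtain ⟨n, p, q, hp⟩ := exists_rep (S.toHomAlgebra.dualComul f)
    obtain ⟨m, s, t, hs⟩ := exists_rep (S.toHomAlgebra.dualComul g)
    have hf := S.toHomAlgebra.dualComul_rep f hp
    have hg := S.toHomAlgebra.dualComul_rep g hs
    refine dualDistrib_ext fun x y => ?_
    change TensorProduct.dualDistrib k A A (S.toHomAlgebra.dualComul _) _ =
      TensorProduct.dualDistrib k A A (TensorProduct.map S.dualMul S.dualMul
        (TensorProduct.tensorTensorTensorComm k _ _ _ _
          (S.toHomAlgebra.dualComul f ⊗ₜ S.toHomAlgebra.dualComul g))) _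
    obtain ⟨l, a, b, hx⟩ := exists_rep (S.comul x)
    obtain ⟨o, c, d, hy⟩ := exists_rep (S.comul y)
    have hm : ∀ z, S.dualMul (f ⊗ₜ g) z = TensorProduct.dualDistrib k A A (f ⊗ₜ g)
      (TensorProduct.map (S.α ^ (-2 : ℤ)).toLinearMap (S.α ^ (-2 : ℤ)).toLinearMap
        (S.comul z)) := fun z => rfl
    rw [HomAlgebra.dualComul_apply, hm]
    simp only [hp, hs, TensorProduct.sum_tmul, TensorProduct.tmul_sum, map_sum,
      TensorProduct.tensorTensorTensorComm_tmul, TensorProduct.map_tmul, LinearMap.sum_apply,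
      TensorProduct.dualDistrib_apply, S.dualMul_rep _ _ hx, S.dualMul_rep _ _ hy,
      S.zpow_comul, S.comul_mul, hx, hy, LinearEquiv.coe_coe]
    have R := sum_rearrange (fun r c => p r ((S.α ^ (-2 : ℤ)) (a c)))
      (fun r e => q r ((S.α ^ (-2 : ℤ)) (c e))) (fun r c => s r ((S.α ^ (-2 : ℤ)) (b c)))
      (fun r e => t r ((S.α ^ (-2 : ℤ)) (d e)))
    simp only [hf, hg] at R
    rw [Finset.sum_comm, eq_comm, Finset.sum_comm, R]
    simp only [S.zpow_mul]
    exact Finset.sum_comm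
  comul_one := by
    refine dualDistrib_ext fun x y => ?_
    change TensorProduct.dualDistrib k A A (S.toHomAlgebra.dualComul _) _ = _
    rw [HomAlgebra.dualComul_apply, S.zpow_counit, S.counit_mul, mul_comm]
    rfl
  counit_mul f g := by
    have h : S.comul S.one = ∑ r : Fin 1, S.one ⊗ₜ[k] S.one := by simp [S.comul_one]
    change S.dualMul (f ⊗ₜ g) S.one = f S.one * g S.one
    rw [S.dualMul_rep _ _ h, Fin.sum_univ_one, S.zpow_one]
  counit_one := S.counit_one

end HomBialgebra

end dual

section comodules

variable {k : Type u} [Field k] {V : Type u} [AddCommGroup V] [Module k V]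
  [FiniteDimensional k V]

open HomVec

/-- A right Hom-comodule over a Hom-coalgebra, with bijective structure map. -/
structure HomComodule (S : HomCoalgebra k V) (i j : ℤ) where
  obj : HomVec k i j
  coact : obj.carrier →ₗ[k] obj.carrier ⊗[k] V
  coassoc : ∀ u, TensorProduct.map obj.α.toLinearMap S.comul (coact u) =
    TensorProduct.assoc k obj.carrier V V (TensorProduct.map coact S.α.toLinearMap (coact u))
  counit : ∀ u, TensorProduct.rid k obj.carrier (S.counit.lTensor obj.carrier (coact u)) = obj.α u

namespace HomComodule

variable {S : HomCoalgebra k V} {i j : ℤ}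

/-- Colinear maps. -/
@[ext]
structure Hom (M N : HomComodule S i j) where
  toLin : M.obj.carrier →ₗ[k] N.obj.carrier
  comm_coact : ∀ u, N.coact (toLin u) = toLin.rTensor V (M.coact u)

instance : Category (HomComodule S i j) where
  Hom M N := Hom M N
  id M := ⟨LinearMap.id, fun u => by simp⟩
  comp f g := ⟨g.toLin ∘ₗ f.toLin, fun u => by
    rw [LinearMap.comp_apply, g.comm_coact, f.comm_coact, LinearMap.rTensor_comp]; rfl⟩

theorem coact_α (M : HomComodule S i j) (u : M.obj.carrier) :
    M.coact (M.obj.α u) = TensorProduct.map M.obj.α.toLinearMap S.α.toLinearMap (M.coact u) := by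
  have h := congrArg (LinearMap.lTensor M.obj.carrier
    ((TensorProduct.rid k V).toLinearMap ∘ₗ S.counit.lTensor V)) (M.coassoc u)
  have e1 := S.comul_counit
  have e2 := M.counit u
  obtain ⟨n, a, b, hc⟩ := exists_rep (M.coact u)
  choose m p q hp using fun i => exists_rep (M.coact (a i))
  simp only [hc, map_sum, TensorProduct.map_tmul, LinearMap.lTensor_tmul, LinearMap.comp_apply,
    LinearEquiv.coe_coe, e1, hp, TensorProduct.sum_tmul, TensorProduct.assoc_tmul,
    TensorProduct.rid_tmul, S.counit_α] at h e2 ⊢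
  rw [h, ← e2, map_sum]
  refine Finset.sum_congr rfl fun i _ => ?_
  rw [map_smul, hp, Finset.smul_sum]
  simp

theorem Hom.comm_α {M N : HomComodule S i j} (f : M ⟶ N) (u : M.obj.carrier) :
    Hom.toLin f (M.obj.α u) = N.obj.α (Hom.toLin f u) := by
  rw [← M.counit u, ← N.counit, f.comm_coact]
  obtain ⟨n, a, b, hc⟩ := exists_rep (M.coact u)
  simp [hc]

/-- The coaction as a morphism of the category of pairs. -/
def hom (M : HomComodule S i j) : M.obj ⟶ (S.comonad i j).obj M.obj where
  toLin := M.coact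
  comm := M.coact_α

theorem hom_counit (M : HomComodule S i j) :
    M.hom ≫ (S.comonad i j).ε.app M.obj = 𝟙 M.obj := hom_ext (LinearMap.ext fun u => by
  have e := M.counit u
  obtain ⟨n, a, b, hc⟩ := exists_rep (M.coact u)
  change TensorProduct.rid k M.obj.carrier (TensorProduct.map M.obj.α.symm.toLinearMap S.counit
    (M.coact u)) = u
  apply M.obj.α.injective
  rw [← e, hc]
  simp)

theorem hom_coassoc (M : HomComodule S i j) :
    M.hom ≫ (S.comonad i j).δ.app M.obj = M.hom ≫ (S.comonad i j).map M.hom :=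
  hom_ext (LinearMap.ext fun u => by
    have e := M.coassoc u
    obtain ⟨n, a, b, hc⟩ := exists_rep (M.coact u)
    change (TensorProduct.assoc k M.obj.carrier V V).symm (TensorProduct.map M.obj.α.toLinearMap
      (LinearMap.lTensor V S.α.symm.toLinearMap ∘ₗ S.comul) (M.coact u)) =
        LinearMap.rTensor V M.coact (M.coact u)
    rw [LinearEquiv.symm_apply_eq]
    apply (TensorProduct.congr (LinearEquiv.refl k M.obj.carrier)
      (TensorProduct.congr (LinearEquiv.refl k V) S.α)).injective
    choose m p q hp using fun r => exists_rep (M.coact (a r))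
    choose m' p' q' hq using fun r => exists_rep (S.comul (b r))
    simp only [hc, hp, hq, map_sum, TensorProduct.map_tmul, TensorProduct.sum_tmul,
      TensorProduct.tmul_sum, TensorProduct.assoc_tmul, LinearEquiv.coe_coe,
      LinearMap.comp_apply, LinearMap.lTensor_tmul, LinearMap.rTensor_tmul,
      TensorProduct.congr_tmul, LinearEquiv.refl_apply, LinearEquiv.apply_symm_apply] at e ⊢
    exact e)

/-- Construct a Hom-comodule from a coalgebra of the comonad. -/
theorem of_coalgebra {M : HomVec k i j} (a : M ⟶ (S.comonad i j).obj M)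
    (h1 : a ≫ (S.comonad i j).ε.app M = 𝟙 M)
    (h2 : a ≫ (S.comonad i j).δ.app M = a ≫ (S.comonad i j).map a)
    (ρ : M.carrier →ₗ[k] M.carrier ⊗[k] V) (hρ : HomVec.Hom.toLin a = ρ) :
    (∀ u, TensorProduct.map M.α.toLinearMap S.comul (ρ u) =
      TensorProduct.assoc k M.carrier V V (TensorProduct.map ρ S.α.toLinearMap (ρ u))) ∧
    (∀ u, TensorProduct.rid k M.carrier (S.counit.lTensor M.carrier (ρ u)) = M.α u) := by
  refine ⟨fun u => ?_, fun u => ?_⟩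
  · have e : TensorProduct.map M.α.toLinearMap
        (LinearMap.lTensor V S.α.symm.toLinearMap ∘ₗ S.comul) (ρ u) =
          TensorProduct.assoc k M.carrier V V (LinearMap.rTensor V ρ (ρ u)) := by
      rw [← LinearEquiv.symm_apply_eq]
      cases hρ
      exact LinearMap.congr_fun (congrArg HomVec.Hom.toLin h2) u
    have e' := congrArg (TensorProduct.congr (LinearEquiv.refl k M.carrier)
      (TensorProduct.congr (LinearEquiv.refl k V) S.α)) e
    obtain ⟨n, a, b, hc⟩ := exists_rep (ρ u)
    choose m p q hp using fun r => exists_rep (ρ (a r))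
    choose m' p' q' hq using fun r => exists_rep (S.comul (b r))
    simp only [hc, hp, hq, map_sum, TensorProduct.map_tmul, TensorProduct.sum_tmul,
      TensorProduct.tmul_sum, TensorProduct.assoc_tmul, LinearEquiv.coe_coe,
      LinearMap.comp_apply, LinearMap.lTensor_tmul, LinearMap.rTensor_tmul,
      TensorProduct.congr_tmul, LinearEquiv.refl_apply, LinearEquiv.apply_symm_apply] at e' ⊢
    exact e'
  · have e : TensorProduct.rid k M.carrier (TensorProduct.map M.α.symm.toLinearMap S.counit
        (ρ u)) = u := by
      cases hρ
      exact LinearMap.congr_fun (congrArg HomVec.Hom.toLin h1) u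
    have e' := congrArg M.α e
    obtain ⟨n, a, b, hc⟩ := exists_rep (ρ u)
    rw [← e', hc]
    simp

/-- A linear isomorphism that is colinear, as an isomorphism of comodules. -/
def mkIso {M N : HomComodule S i j} (e : M.obj ≅ N.obj)
    (h : ∀ u, N.coact (HomVec.Hom.toLin e.hom u) =
      (HomVec.Hom.toLin e.hom).rTensor V (M.coact u)) : M ≅ N where
  hom := ⟨HomVec.Hom.toLin e.hom, h⟩
  inv := ⟨HomVec.Hom.toLin e.inv, fun u => by
    have h1 : ∀ v, HomVec.Hom.toLin e.hom (HomVec.Hom.toLin e.inv v) = v := fun v =>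
      LinearMap.congr_fun (congrArg HomVec.Hom.toLin e.inv_hom_id) v
    have h2 : HomVec.Hom.toLin e.inv ∘ₗ HomVec.Hom.toLin e.hom = LinearMap.id :=
      congrArg HomVec.Hom.toLin e.hom_inv_id
    have h3 := congrArg ((HomVec.Hom.toLin e.inv).rTensor V) (h (HomVec.Hom.toLin e.inv u))
    rw [h1, ← LinearMap.rTensor_comp_apply, h2, LinearMap.rTensor_id] at h3
    exact h3.symm⟩
  hom_inv_id := Hom.ext (congrArg HomVec.Hom.toLin e.hom_inv_id)
  inv_hom_id := Hom.ext (congrArg HomVec.Hom.toLin e.inv_hom_id)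

end HomComodule

namespace HomComodule

variable {S : HomBialgebra k V} {i j : ℤ}

/-- The tensor product of Hom-comodules, with coaction
`u ⊗ v ↦ (u₍₀₎ ⊗ v₍₀₎) ⊗ α^i(u₍₁₎) α^j(v₍₁₎)`. -/
def tensor (M N : HomComodule S.toHomCoalgebra i j) : HomComodule S.toHomCoalgebra i j where
  obj := M.obj ⊗ N.obj
  coact := S.muLin i j M.obj.carrier N.obj.carrier ∘ₗ TensorProduct.map M.coact N.coact
  coassoc := (of_coalgebra ((M.hom ⊗ₘ N.hom) ≫
      Functor.LaxMonoidal.μ (S.bicomonad i j).toFunctor M.obj N.obj)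
    (Bicomodule.tensor_counit (S.bicomonad i j) _ _ M.hom_counit N.hom_counit)
    (Bicomodule.tensor_coassoc (S.bicomonad i j) _ _ M.hom_coassoc N.hom_coassoc) _ rfl).1
  counit := (of_coalgebra ((M.hom ⊗ₘ N.hom) ≫
      Functor.LaxMonoidal.μ (S.bicomonad i j).toFunctor M.obj N.obj)
    (Bicomodule.tensor_counit (S.bicomonad i j) _ _ M.hom_counit N.hom_counit)
    (Bicomodule.tensor_coassoc (S.bicomonad i j) _ _ M.hom_coassoc N.hom_coassoc) _ rfl).2

/-- The unit comodule `k`, with coaction `c ↦ c ⊗ 1`. -/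
def unit : HomComodule S.toHomCoalgebra i j where
  obj := 𝟙_ (HomVec k i j)
  coact := (TensorProduct.mk k k V).flip S.one
  coassoc := (of_coalgebra (Functor.LaxMonoidal.ε (S.bicomonad i j).toFunctor)
    (Bicomodule.unit_counit (S.bicomonad i j)) (Bicomodule.unit_coassoc (S.bicomonad i j)) _ rfl).1
  counit := (of_coalgebra (Functor.LaxMonoidal.ε (S.bicomonad i j).toFunctor)
    (Bicomodule.unit_counit (S.bicomonad i j)) (Bicomodule.unit_coassoc (S.bicomonad i j)) _ rfl).2

theorem tensor_colinear {M N M' N' : HomComodule S.toHomCoalgebra i j} (f : M ⟶ M') (g : N ⟶ N')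
    (u : M.obj.carrier ⊗[k] N.obj.carrier) :
    (tensor M' N').coact (TensorProduct.map (Hom.toLin f) (Hom.toLin g) u) =
      (TensorProduct.map (Hom.toLin f) (Hom.toLin g)).rTensor V ((tensor M N).coact u) := by
  refine LinearMap.congr_fun (f := (S.muLin i j _ _ ∘ₗ TensorProduct.map M'.coact N'.coact) ∘ₗ
    TensorProduct.map (Hom.toLin f) (Hom.toLin g))
    (g := (TensorProduct.map (Hom.toLin f) (Hom.toLin g)).rTensor V ∘ₗ
      S.muLin i j _ _ ∘ₗ TensorProduct.map M.coact N.coact)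
    (TensorProduct.ext' fun a b => ?_) u
  simp only [LinearMap.comp_apply, TensorProduct.map_tmul, f.comm_coact, g.comm_coact]
  obtain ⟨n, p, q, hp⟩ := exists_rep (M.coact a)
  obtain ⟨m, s, t, hs⟩ := exists_rep (N.coact b)
  simp only [hp, hs, map_sum, TensorProduct.map_tmul, TensorProduct.sum_tmul,
    TensorProduct.tmul_sum, LinearMap.rTensor_tmul, HomAlgebra.muLin_tmul]

theorem assoc_colinear (M N P : HomComodule S.toHomCoalgebra i j)
    (u : ((M.obj ⊗ N.obj) ⊗ P.obj).carrier) :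
    (tensor M (tensor N P)).coact (HomVec.Hom.toLin (α_ M.obj N.obj P.obj).hom u) =
      (HomVec.Hom.toLin (α_ M.obj N.obj P.obj).hom).rTensor V
        ((tensor (tensor M N) P).coact u) :=
  LinearMap.congr_fun (congrArg HomVec.Hom.toLin
    (Bicomodule.assoc_colinear (S.bicomonad i j) M.hom N.hom P.hom)).symm u

theorem left_colinear (M : HomComodule S.toHomCoalgebra i j) (u : (𝟙_ _ ⊗ M.obj).carrier) :
    M.coact (HomVec.Hom.toLin (λ_ M.obj).hom u) =
      (HomVec.Hom.toLin (λ_ M.obj).hom).rTensor V ((tensor unit M).coact u) :=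
  LinearMap.congr_fun (congrArg HomVec.Hom.toLin
    (Bicomodule.left_colinear (S.bicomonad i j) M.hom)).symm u

theorem right_colinear (M : HomComodule S.toHomCoalgebra i j) (u : (M.obj ⊗ 𝟙_ _).carrier) :
    M.coact (HomVec.Hom.toLin (ρ_ M.obj).hom u) =
      (HomVec.Hom.toLin (ρ_ M.obj).hom).rTensor V ((tensor M unit).coact u) :=
  LinearMap.congr_fun (congrArg HomVec.Hom.toLin
    (Bicomodule.right_colinear (S.bicomonad i j) M.hom)).symm u

instance : MonoidalCategoryStruct (HomComodule S.toHomCoalgebra i j) where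
  tensorObj := tensor
  tensorUnit := unit
  tensorHom f g := ⟨TensorProduct.map (Hom.toLin f) (Hom.toLin g), tensor_colinear f g⟩
  whiskerLeft M _ _ f := ⟨TensorProduct.map LinearMap.id (Hom.toLin f), tensor_colinear (𝟙 M) f⟩
  whiskerRight f N := ⟨TensorProduct.map (Hom.toLin f) LinearMap.id, tensor_colinear f (𝟙 N)⟩
  associator M N P := mkIso (α_ M.obj N.obj P.obj) (assoc_colinear M N P)
  leftUnitor M := mkIso (λ_ M.obj) (left_colinear M)
  rightUnitor M := mkIso (ρ_ M.obj) (right_colinear M)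

/-- A colinear map, as a morphism of the category of pairs. -/
def Hom.toHom {C : HomCoalgebra k V} {M N : HomComodule C i j} (f : M ⟶ N) : M.obj ⟶ N.obj :=
  ⟨Hom.toLin f, Hom.comm_α f⟩

/-- The monoidal category `Corep^{i,j}(S)` of Hom-comodules over a Hom-bialgebra. -/
instance : MonoidalCategory (HomComodule S.toHomCoalgebra i j) where
  tensorHom_def f g := Hom.ext (congrArg HomVec.Hom.toLin
    (MonoidalCategory.tensorHom_def (Hom.toHom f) (Hom.toHom g)))
  id_tensorHom_id M N := Hom.ext (congrArg HomVec.Hom.toLin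
    (MonoidalCategory.id_tensorHom_id M.obj N.obj))
  tensorHom_comp_tensorHom f₁ f₂ g₁ g₂ := Hom.ext (congrArg HomVec.Hom.toLin
    (MonoidalCategory.tensorHom_comp_tensorHom (Hom.toHom f₁) (Hom.toHom f₂) (Hom.toHom g₁)
      (Hom.toHom g₂)))
  whiskerLeft_id M N := Hom.ext (congrArg HomVec.Hom.toLin
    (MonoidalCategory.whiskerLeft_id M.obj N.obj))
  id_whiskerRight M N := Hom.ext (congrArg HomVec.Hom.toLin
    (MonoidalCategory.id_whiskerRight M.obj N.obj))
  associator_naturality f₁ f₂ f₃ := Hom.ext (congrArg HomVec.Hom.toLin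
    (MonoidalCategory.associator_naturality (Hom.toHom f₁) (Hom.toHom f₂) (Hom.toHom f₃)))
  leftUnitor_naturality f := Hom.ext (congrArg HomVec.Hom.toLin
    (MonoidalCategory.leftUnitor_naturality (Hom.toHom f)))
  rightUnitor_naturality f := Hom.ext (congrArg HomVec.Hom.toLin
    (MonoidalCategory.rightUnitor_naturality (Hom.toHom f)))
  pentagon M N P Q := Hom.ext (congrArg HomVec.Hom.toLin
    (MonoidalCategory.pentagon M.obj N.obj P.obj Q.obj))
  triangle M N := Hom.ext (congrArg HomVec.Hom.toLin
    (MonoidalCategory.triangle M.obj N.obj))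

end HomComodule

end comodules

section entwining

variable {k : Type u} [Field k] {V W : Type u} [AddCommGroup V] [Module k V]
  [FiniteDimensional k V] [AddCommGroup W] [Module k W] [FiniteDimensional k W]

open HomVec

/-- A right-right Hom-entwining structure `(H, A, Φ)`; below `Φ(h ⊗ a) = ∑ a_Φ ⊗ h^Φ`. -/
structure EntwiningStructure (H : HomCoalgebra k V) (A : HomAlgebra k W) where
  Φ : V ⊗[k] W →ₗ[k] W ⊗[k] V
  equivariant : ∀ z, TensorProduct.map A.α.toLinearMap H.α.toLinearMap (Φ z) =
    Φ (TensorProduct.map H.α.toLinearMap A.α.toLinearMap z)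
  /-- `∑ a_Φ b_Ψ ⊗ α(h^{ΦΨ}) = ∑ (ab)_Φ ⊗ α(h)^Φ` -/
  E1 : ∀ h a b, TensorProduct.map A.mul H.α.toLinearMap
      ((TensorProduct.assoc k W W V).symm
        (Φ.lTensor W (TensorProduct.assoc k W V W (Φ (h ⊗ₜ a) ⊗ₜ b)))) =
    Φ (H.α h ⊗ₜ A.mul (a ⊗ₜ b))
  /-- `∑ α(a)_{ΨΦ} ⊗ h₁^Φ ⊗ h₂^Ψ = ∑ α(a_Φ) ⊗ (h^Φ)₁ ⊗ (h^Φ)₂` -/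
  E2 : ∀ h a, TensorProduct.assoc k W V V (Φ.rTensor V ((TensorProduct.assoc k V W V).symm
      (Φ.lTensor V (TensorProduct.assoc k V V W (H.comul h ⊗ₜ A.α a))))) =
    TensorProduct.map A.α.toLinearMap H.comul (Φ (h ⊗ₜ a))
  /-- `∑ ε(h^Φ) a_Φ = ε(h) a` -/
  E3 : ∀ h a, TensorProduct.rid k W (H.counit.lTensor W (Φ (h ⊗ₜ a))) = H.counit h • a
  /-- `∑ 1_Φ ⊗ h^Φ = 1 ⊗ h` -/
  E4 : ∀ h, Φ (h ⊗ₜ A.one) = A.one ⊗ₜ h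

/-- A Hom-monoidal entwining datum `(H, A, Φ)`. -/
structure MonoidalEntwiningDatum (H : HomBialgebra k V) (A : HomBialgebra k W) extends
    EntwiningStructure H.toHomCoalgebra A.toHomAlgebra where
  /-- `∑ (a₁)_Φ ⊗ (a₂)_Ψ ⊗ α²(h)^Φ α²(g)^Ψ = ∑ (a_Φ)₁ ⊗ (a_Φ)₂ ⊗ α²((hg)^Φ)` -/
  E5 : ∀ h g a, H.mul.lTensor (W ⊗[k] W) (TensorProduct.tensorTensorTensorComm k W V W V
      (TensorProduct.map Φ Φ (TensorProduct.tensorTensorTensorComm k V V W W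
        ((H.α (H.α h) ⊗ₜ H.α (H.α g)) ⊗ₜ A.comul a)))) =
    TensorProduct.map A.comul (H.α.toLinearMap ∘ₗ H.α.toLinearMap) (Φ (H.mul (h ⊗ₜ g) ⊗ₜ a))
  /-- `∑ ε(a_Φ) 1^Φ = ε(a) 1` -/
  E6 : ∀ a, TensorProduct.lid k V (A.counit.rTensor V (Φ (H.one ⊗ₜ a))) = A.counit a • H.one

/-- For `Φ : H ⊗ A → A ⊗ H`, the map `φ : A* ⊗ H → H ⊗ A*`,
`φ(f ⊗ h) = ∑ f((e_i)_Φ) h^Φ ⊗ e^i`, where `e_i` and `e^i` are dual bases. -/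
noncomputable def inducedPhi (Φ : V ⊗[k] W →ₗ[k] W ⊗[k] V) :
    Module.Dual k W ⊗[k] V →ₗ[k] V ⊗[k] Module.Dual k W :=
  TensorProduct.lift (LinearMap.mk₂ k
    (fun f h => ∑ r, (TensorProduct.lid k V (f.rTensor V (Φ (h ⊗ₜ Module.finBasis k W r)))) ⊗ₜ[k]
      (Module.finBasis k W).coord r)
    (fun f g h => by
      simp only [LinearMap.rTensor_add, LinearMap.add_apply, map_add, TensorProduct.add_tmul,
        Finset.sum_add_distrib])
    (fun c f h => by
      simp only [LinearMap.rTensor_smul, LinearMap.smul_apply, map_smul,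
        ← TensorProduct.smul_tmul', Finset.smul_sum])
    (fun f h h' => by simp only [TensorProduct.add_tmul, map_add, Finset.sum_add_distrib])
    (fun c f h => by
      simp only [← TensorProduct.smul_tmul', map_smul, Finset.smul_sum]))

/-- Evaluation of the second factor of `H ⊗ A*` at an element of `A`. -/
def evalSnd (a : W) : V ⊗[k] Module.Dual k W →ₗ[k] V :=
  (TensorProduct.rid k V).toLinearMap ∘ₗ LinearMap.lTensor V (LinearMap.applyₗ a)

theorem evalSnd_tmul (a : W) (h : V) (f : Module.Dual k W) :
    evalSnd a (h ⊗ₜ f) = f a • h := by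
  simp [evalSnd]

theorem evalSnd_ext {s t : V ⊗[k] Module.Dual k W} (h : ∀ a : W, evalSnd a s = evalSnd a t) :
    s = t := by
  apply (TensorProduct.comm k V (Module.Dual k W)).injective
  apply (dualTensorHomEquiv k W V).injective
  ext a
  have e : ∀ s : V ⊗[k] Module.Dual k W, dualTensorHomEquiv k W V
      (TensorProduct.comm k V (Module.Dual k W) s) a = evalSnd a s := fun s => by
    obtain ⟨n, p, q, rfl⟩ := exists_rep s
    simp [evalSnd_tmul]
  rw [e, e, h]

/-- `∑ f^φ(a) h^φ = ∑ f(a_Φ) h^Φ` -/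
theorem evalSnd_inducedPhi (Φ : V ⊗[k] W →ₗ[k] W ⊗[k] V) (f : Module.Dual k W) (h : V) (a : W) :
    evalSnd a (inducedPhi Φ (f ⊗ₜ h)) = TensorProduct.lid k V (f.rTensor V (Φ (h ⊗ₜ a))) := by
  have e := (Module.finBasis k W).sum_repr a
  conv_rhs => rw [← e]
  simp only [inducedPhi, TensorProduct.lift.tmul, LinearMap.mk₂_apply, map_sum, evalSnd_tmul,
    TensorProduct.tmul_sum, TensorProduct.tmul_smul, map_smul, Module.Basis.coord_apply]

theorem inducedPhi_equivariant {H : HomCoalgebra k V} {A : HomAlgebra k W}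
    (E : EntwiningStructure H A) (z : Module.Dual k W ⊗[k] V) :
    inducedPhi E.Φ (TensorProduct.map A.dualCop.α.toLinearMap H.α.toLinearMap z) =
      TensorProduct.map H.α.toLinearMap A.dualCop.α.toLinearMap (inducedPhi E.Φ z) := by
  refine LinearMap.congr_fun (f := inducedPhi E.Φ ∘ₗ
    TensorProduct.map A.dualCop.α.toLinearMap H.α.toLinearMap)
    (g := TensorProduct.map H.α.toLinearMap A.dualCop.α.toLinearMap ∘ₗ inducedPhi E.Φ)
    (TensorProduct.ext' fun f h => evalSnd_ext fun a => ?_) z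
  have e1 : ∀ t : V ⊗[k] Module.Dual k W,
      evalSnd a (TensorProduct.map H.α.toLinearMap A.dualCop.α.toLinearMap t) =
        H.α (evalSnd (A.α.symm a) t) := fun t => by
    obtain ⟨n, p, q, rfl⟩ := exists_rep t
    simp only [map_sum, TensorProduct.map_tmul, evalSnd_tmul, LinearEquiv.coe_coe, map_smul]
    rfl
  have e2 := E.equivariant (h ⊗ₜ A.α.symm a)
  rw [TensorProduct.map_tmul, LinearEquiv.coe_coe, LinearEquiv.coe_coe,
    LinearEquiv.apply_symm_apply] at e2
  rw [LinearMap.comp_apply, LinearMap.comp_apply, e1, evalSnd_inducedPhi, TensorProduct.map_tmul,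
    evalSnd_inducedPhi, LinearEquiv.coe_coe, LinearEquiv.coe_coe, ← e2]
  obtain ⟨n, p, q, hp⟩ := exists_rep (E.Φ (h ⊗ₜ A.α.symm a))
  simp only [hp, map_sum, TensorProduct.map_tmul, LinearMap.rTensor_tmul, TensorProduct.lid_tmul,
    LinearEquiv.coe_coe, map_smul]
  refine Finset.sum_congr rfl fun r _ => ?_
  congr 1
  change f (A.α.symm (A.α (p r))) = _
  rw [LinearEquiv.symm_apply_apply]

/-- `(u ⊗ h) ⊗ a ↦ ∑ u · α(a_Φ) ⊗ α^{-n}(α^{n+1}(h)^Φ)` -/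
def EntwiningStructure.compatLin {H : HomCoalgebra k V} {A : HomAlgebra k W}
    (E : EntwiningStructure H A) (n : ℤ) {M : Type u} [AddCommGroup M] [Module k M]
    (act : M ⊗[k] W →ₗ[k] M) : (M ⊗[k] V) ⊗[k] W →ₗ[k] M ⊗[k] V :=
  TensorProduct.map act (H.α ^ (-n)).toLinearMap ∘ₗ
    (TensorProduct.assoc k M W V).symm.toLinearMap ∘ₗ
    LinearMap.lTensor M (A.α.toLinearMap.rTensor V ∘ₗ E.Φ ∘ₗ
      (H.α ^ (n + 1)).toLinearMap.rTensor W) ∘ₗ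
    (TensorProduct.assoc k M V W).toLinearMap

/-- The action `(u ⊗ v) · a = u · α^{-i-2}(a₁) ⊗ v · α^{-j-2}(a₂)` on a tensor product. -/
def HomCoalgebra.tensorActLin (A : HomCoalgebra k W) (i j : ℤ) {M N : Type u} [AddCommGroup M]
    [Module k M] [AddCommGroup N] [Module k N] (actM : M ⊗[k] W →ₗ[k] M)
    (actN : N ⊗[k] W →ₗ[k] N) : (M ⊗[k] N) ⊗[k] W →ₗ[k] M ⊗[k] N :=
  TensorProduct.map actM actN ∘ₗ
    (TensorProduct.tensorTensorTensorComm k M N W W).toLinearMap ∘ₗ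
    LinearMap.lTensor (M ⊗[k] N)
      (TensorProduct.map (A.α ^ (-i - 2)).toLinearMap (A.α ^ (-j - 2)).toLinearMap ∘ₗ A.comul)

theorem HomCoalgebra.tensorActLin_rep (A : HomCoalgebra k W) (i j : ℤ) {M N : Type u}
    [AddCommGroup M] [Module k M] [AddCommGroup N] [Module k N] (actM : M ⊗[k] W →ₗ[k] M)
    (actN : N ⊗[k] W →ₗ[k] N) (u : M) (v : N) {a : W} {m : ℕ} {p q : Fin m → W}
    (h : A.comul a = ∑ r, p r ⊗ₜ[k] q r) :
    A.tensorActLin i j actM actN ((u ⊗ₜ v) ⊗ₜ a) =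
      ∑ r, actM (u ⊗ₜ (A.α ^ (-i - 2)) (p r)) ⊗ₜ[k] actN (v ⊗ₜ (A.α ^ (-j - 2)) (q r)) := by
  simp [tensorActLin, h, TensorProduct.tmul_sum]

/-- An `n`-th Hom-entwined module: a right `H`-Hom-comodule that is a right `A`-Hom-module, with
`ρ(u · a) = ∑ u₍₀₎ · α(a_Φ) ⊗ α^{-n}(α^{n+1}(u₍₁₎)^Φ)`. -/
structure EntwinedModule {H : HomCoalgebra k V} {A : HomAlgebra k W} (E : EntwiningStructure H A)
    (i j n : ℤ) extends HomComodule H i j where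
  act : obj.carrier ⊗[k] W →ₗ[k] obj.carrier
  act_assoc : ∀ u a b, act (act (u ⊗ₜ a) ⊗ₜ A.α b) = act (obj.α u ⊗ₜ A.mul (a ⊗ₜ b))
  act_one : ∀ u, act (u ⊗ₜ A.one) = obj.α u
  compat : ∀ u a, coact (act (u ⊗ₜ a)) = E.compatLin n act (coact u ⊗ₜ a)

namespace EntwinedModule

section

variable {H : HomCoalgebra k V} {A : HomAlgebra k W} {E : EntwiningStructure H A} {i j n : ℤ}

/-- `A`-linear `H`-colinear maps. -/
@[ext]
structure Hom (M N : EntwinedModule E i j n) extends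
    HomComodule.Hom M.toHomComodule N.toHomComodule where
  comm_act : ∀ u a, toLin (M.act (u ⊗ₜ a)) = N.act (toLin u ⊗ₜ a)

instance : Category (EntwinedModule E i j n) where
  Hom M N := Hom M N
  id M := ⟨HomComodule.Hom.mk LinearMap.id (fun u => by simp), fun u a => rfl⟩
  comp f g := ⟨HomComodule.Hom.mk (g.toLin ∘ₗ f.toLin) (fun u => by
      rw [LinearMap.comp_apply, g.comm_coact, f.comm_coact, LinearMap.rTensor_comp]; rfl),
    fun u a => by
      change g.toLin (f.toLin _) = _
      rw [f.comm_act, g.comm_act]; rfl⟩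

theorem act_α (M : EntwinedModule E i j n) (u : M.obj.carrier) (a : W) :
    M.obj.α (M.act (u ⊗ₜ a)) = M.act (M.obj.α u ⊗ₜ A.α a) := by
  have h := M.act_assoc u a A.one
  rw [A.α_one, M.act_one, A.mul_one] at h
  exact h

theorem zpow_act (M : EntwinedModule E i j n) (m : ℤ) (u : M.obj.carrier) (a : W) :
    (M.obj.α ^ m) (M.act (u ⊗ₜ a)) = M.act ((M.obj.α ^ m) u ⊗ₜ (A.α ^ m) a) := by
  have h := zpow_comm_apply (α := TensorProduct.congr M.obj.α A.α) (β := M.obj.α) M.act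
    (LinearMap.congr_fun (f := M.act ∘ₗ (TensorProduct.congr M.obj.α A.α).toLinearMap)
      (g := M.obj.α.toLinearMap ∘ₗ M.act)
      (TensorProduct.ext' fun a b => by simp [M.act_α])) m (u ⊗ₜ a)
  rw [congr_zpow_tmul] at h
  exact h.symm

/-- A linear isomorphism that is linear and colinear, as an isomorphism of entwined modules. -/
def mkIso {M N : EntwinedModule E i j n} (e : M.obj ≅ N.obj)
    (h : ∀ u, N.coact (HomVec.Hom.toLin e.hom u) =
      (HomVec.Hom.toLin e.hom).rTensor V (M.coact u))
    (h' : ∀ u a, HomVec.Hom.toLin e.hom (M.act (u ⊗ₜ a)) =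
      N.act (HomVec.Hom.toLin e.hom u ⊗ₜ a)) : M ≅ N where
  hom := ⟨(HomComodule.mkIso e h).hom, h'⟩
  inv := ⟨(HomComodule.mkIso e h).inv, fun u a => by
    have h1 : ∀ v, HomVec.Hom.toLin e.hom (HomVec.Hom.toLin e.inv v) = v := fun v =>
      LinearMap.congr_fun (congrArg HomVec.Hom.toLin e.inv_hom_id) v
    have h2 : ∀ v, HomVec.Hom.toLin e.inv (HomVec.Hom.toLin e.hom v) = v := fun v =>
      LinearMap.congr_fun (congrArg HomVec.Hom.toLin e.hom_inv_id) v
    have h3 := congrArg (HomVec.Hom.toLin e.inv) (h' (HomVec.Hom.toLin e.inv u) a)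
    rw [h1, h2] at h3
    exact h3.symm⟩
  hom_inv_id := Hom.ext (congrArg HomVec.Hom.toLin e.hom_inv_id)
  inv_hom_id := Hom.ext (congrArg HomVec.Hom.toLin e.inv_hom_id)

end

variable {H : HomBialgebra k V} {A : HomBialgebra k W} {D : MonoidalEntwiningDatum H A}
  {i j n : ℤ}

/-- `(u ⊗ v) · a = u · α^{-i-2}(a₁) ⊗ v · α^{-j-2}(a₂)` -/
def tensorAct (M N : EntwinedModule D.toEntwiningStructure i j n) :
    (M.obj.carrier ⊗[k] N.obj.carrier) ⊗[k] W →ₗ[k] M.obj.carrier ⊗[k] N.obj.carrier :=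
  A.tensorActLin i j M.act N.act

theorem tensorAct_rep (M N : EntwinedModule D.toEntwiningStructure i j n) (u : M.obj.carrier)
    (v : N.obj.carrier) {a : W} {m : ℕ} {p q : Fin m → W}
    (h : A.comul a = ∑ r, p r ⊗ₜ[k] q r) :
    tensorAct M N ((u ⊗ₜ v) ⊗ₜ a) =
      ∑ r, M.act (u ⊗ₜ (A.α ^ (-i - 2)) (p r)) ⊗ₜ[k] N.act (v ⊗ₜ (A.α ^ (-j - 2)) (q r)) := by
  exact A.tensorActLin_rep i j M.act N.act u v h

theorem tensorAct_assoc (M N : EntwinedModule D.toEntwiningStructure i j n)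
    (z : M.obj.carrier ⊗[k] N.obj.carrier) (a b : W) :
    tensorAct M N (tensorAct M N (z ⊗ₜ a) ⊗ₜ A.α b) =
      tensorAct M N (TensorProduct.congr M.obj.α N.obj.α z ⊗ₜ A.mul (a ⊗ₜ b)) := by
  obtain ⟨m, u, v, rfl⟩ := exists_rep z
  obtain ⟨l, p, q, hp⟩ := exists_rep (A.comul a)
  obtain ⟨o, s, t, hs⟩ := exists_rep (A.comul b)
  have hs' : A.comul (A.α b) = ∑ r, A.α (s r) ⊗ₜ[k] A.α (t r) := by
    simp [A.comul_α, hs]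
  have hm : ∀ u v, tensorAct M N ((u ⊗ₜ v) ⊗ₜ A.mul (a ⊗ₜ b)) =
      ∑ r, ∑ r', M.act (u ⊗ₜ A.mul ((A.α ^ (-i - 2)) (p r) ⊗ₜ (A.α ^ (-i - 2)) (s r'))) ⊗ₜ[k]
        N.act (v ⊗ₜ A.mul ((A.α ^ (-j - 2)) (q r) ⊗ₜ (A.α ^ (-j - 2)) (t r'))) := fun u v => by
    simp only [tensorAct, HomCoalgebra.tensorActLin, LinearMap.comp_apply, LinearMap.lTensor_tmul, A.comul_mul, hp, hs,
      TensorProduct.sum_tmul, TensorProduct.tmul_sum, map_sum, LinearEquiv.coe_coe,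
      TensorProduct.tensorTensorTensorComm_tmul, TensorProduct.map_tmul, A.zpow_mul]
    rw [Finset.sum_comm]
  simp only [TensorProduct.sum_tmul, map_sum, tensorAct_rep _ _ _ _ hp, tensorAct_rep _ _ _ _ hs',
    TensorProduct.congr_tmul, hm, ← M.act_assoc, ← N.act_assoc, apply_zpow, zpow_apply_one]

theorem tensorAct_one (M N : EntwinedModule D.toEntwiningStructure i j n)
    (z : M.obj.carrier ⊗[k] N.obj.carrier) :
    tensorAct M N (z ⊗ₜ A.one) = TensorProduct.congr M.obj.α N.obj.α z := by
  obtain ⟨m, u, v, rfl⟩ := exists_rep z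
  have h : A.comul A.one = ∑ r : Fin 1, A.one ⊗ₜ[k] A.one := by simp [A.comul_one]
  simp only [TensorProduct.sum_tmul, map_sum, tensorAct_rep _ _ _ _ h, Fin.sum_univ_one,
    A.zpow_one, M.act_one, N.act_one, TensorProduct.congr_tmul]

theorem compatLin_tmul {n : ℤ} {M : Type u} [AddCommGroup M] [Module k M]
    (act : M ⊗[k] W →ₗ[k] M) (x : M) (h : V) (a : W) :
    D.compatLin n act ((x ⊗ₜ h) ⊗ₜ a) =
      TensorProduct.map (act ∘ₗ TensorProduct.mk k M W x ∘ₗ A.α.toLinearMap)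
        (H.α ^ (-n)).toLinearMap (D.Φ ((H.α ^ (n + 1)) h ⊗ₜ a)) := by
  obtain ⟨m, p, q, hp⟩ := exists_rep (D.Φ ((H.α ^ (n + 1)) h ⊗ₜ a))
  simp only [EntwiningStructure.compatLin, LinearMap.comp_apply, LinearEquiv.coe_coe,
    TensorProduct.assoc_tmul, LinearMap.lTensor_tmul, LinearMap.rTensor_tmul, hp, map_sum,
    TensorProduct.tmul_sum, TensorProduct.assoc_symm_tmul, TensorProduct.map_tmul,
    TensorProduct.mk_apply]

theorem zpow_equivariant {H : HomCoalgebra k V} {A : HomAlgebra k W}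
    (E : EntwiningStructure H A) (m : ℤ) (h : V) (a : W) :
    E.Φ ((H.α ^ m) h ⊗ₜ (A.α ^ m) a) =
      TensorProduct.map (A.α ^ m).toLinearMap (H.α ^ m).toLinearMap (E.Φ (h ⊗ₜ a)) := by
  have e := zpow_comm_apply (α := TensorProduct.congr H.α A.α) (β := TensorProduct.congr A.α H.α)
    E.Φ (fun z => (E.equivariant z).symm) m (h ⊗ₜ a)
  rw [congr_zpow_tmul, TensorProduct.congr_zpow] at e
  exact e

theorem tensor_compat_aux (M N : EntwinedModule D.toEntwiningStructure i j n) (a : W) {l : ℕ}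
    {p q : Fin l → W} (hp : A.comul a = ∑ r, p r ⊗ₜ[k] q r) (x : M.obj.carrier)
    (y : N.obj.carrier) (h g : V) :
    ∑ r, H.muLin i j M.obj.carrier N.obj.carrier
        (D.compatLin n M.act ((x ⊗ₜ h) ⊗ₜ (A.α ^ (-i - 2)) (p r)) ⊗ₜ
          D.compatLin n N.act ((y ⊗ₜ g) ⊗ₜ (A.α ^ (-j - 2)) (q r))) =
      D.compatLin n (tensorAct M N)
        (((x ⊗ₜ y) ⊗ₜ H.mul ((H.α ^ i) h ⊗ₜ (H.α ^ j) g)) ⊗ₜ a) := by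
  let K : (W ⊗[k] W) ⊗[k] V →ₗ[k] (M.obj.carrier ⊗[k] N.obj.carrier) ⊗[k] V :=
    TensorProduct.map (TensorProduct.map
      (M.act ∘ₗ TensorProduct.mk k _ W x ∘ₗ (A.α ^ (-i - 1)).toLinearMap)
      (N.act ∘ₗ TensorProduct.mk k _ W y ∘ₗ (A.α ^ (-j - 1)).toLinearMap))
      (H.α ^ (-n - 2)).toLinearMap
  have hK : ∀ w w' v, K ((w ⊗ₜ w') ⊗ₜ v) = (M.act (x ⊗ₜ (A.α ^ (-i - 1)) w) ⊗ₜ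
      N.act (y ⊗ₜ (A.α ^ (-j - 1)) w')) ⊗ₜ (H.α ^ (-n - 2)) v := fun _ _ _ => rfl
  have key := congrArg K (D.E5 ((H.α ^ (n + 1 + i)) h) ((H.α ^ (n + 1 + j)) g) a)
  have hl : ∀ r, H.muLin i j M.obj.carrier N.obj.carrier
        (D.compatLin n M.act ((x ⊗ₜ h) ⊗ₜ (A.α ^ (-i - 2)) (p r)) ⊗ₜ
          D.compatLin n N.act ((y ⊗ₜ g) ⊗ₜ (A.α ^ (-j - 2)) (q r))) =
      K (H.mul.lTensor (W ⊗[k] W) (TensorProduct.tensorTensorTensorComm k W V W V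
        (D.Φ ((H.α ^ (n + 3 + i)) h ⊗ₜ p r) ⊗ₜ D.Φ ((H.α ^ (n + 3 + j)) g ⊗ₜ q r)))) := by
    intro r
    have e1 : D.Φ ((H.α ^ (n + 1)) h ⊗ₜ (A.α ^ (-i - 2)) (p r)) =
        TensorProduct.map (A.α ^ (-i - 2)).toLinearMap (H.α ^ (-i - 2)).toLinearMap
          (D.Φ ((H.α ^ (n + 3 + i)) h ⊗ₜ p r)) := by
      refine Eq.trans ?_ (zpow_equivariant D.toEntwiningStructure (-i - 2) _ _)
      rw [zpow_zpow_apply, show -i - 2 + (n + 3 + i) = n + 1 by ring]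
    have e2 : D.Φ ((H.α ^ (n + 1)) g ⊗ₜ (A.α ^ (-j - 2)) (q r)) =
        TensorProduct.map (A.α ^ (-j - 2)).toLinearMap (H.α ^ (-j - 2)).toLinearMap
          (D.Φ ((H.α ^ (n + 3 + j)) g ⊗ₜ q r)) := by
      refine Eq.trans ?_ (zpow_equivariant D.toEntwiningStructure (-j - 2) _ _)
      rw [zpow_zpow_apply, show -j - 2 + (n + 3 + j) = n + 1 by ring]
    rw [compatLin_tmul, compatLin_tmul, e1, e2]
    obtain ⟨m, s, t, hs⟩ := exists_rep (D.Φ ((H.α ^ (n + 3 + i)) h ⊗ₜ p r))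
    obtain ⟨o, s', t', hs'⟩ := exists_rep (D.Φ ((H.α ^ (n + 3 + j)) g ⊗ₜ q r))
    simp only [hs, hs', map_sum, TensorProduct.sum_tmul, TensorProduct.tmul_sum,
      TensorProduct.map_tmul, HomAlgebra.muLin_tmul, LinearEquiv.coe_coe, LinearMap.comp_apply,
      TensorProduct.mk_apply, TensorProduct.tensorTensorTensorComm_tmul, LinearMap.lTensor_tmul,
      hK, apply_zpow, zpow_zpow_apply, H.zpow_mul]
    simp only [show -i - 2 + 1 = -i - 1 by ring, show -j - 2 + 1 = -j - 1 by ring,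
      show i + (-n + (-i - 2)) = -n - 2 by ring, show j + (-n + (-j - 2)) = -n - 2 by ring]
  simp only [hl]
  simp only [hp, TensorProduct.tmul_sum, map_sum, TensorProduct.tensorTensorTensorComm_tmul,
    TensorProduct.map_tmul, apply_zpow] at key
  simp only [show n + 1 + i + 1 + 1 = n + 3 + i by ring,
    show n + 1 + j + 1 + 1 = n + 3 + j by ring] at key
  rw [key, compatLin_tmul, H.zpow_mul, zpow_zpow_apply, zpow_zpow_apply]
  obtain ⟨m, s, t, hs⟩ := exists_rep
    (D.Φ (H.mul ((H.α ^ (n + 1 + i)) h ⊗ₜ (H.α ^ (n + 1 + j)) g) ⊗ₜ a))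
  simp only [hs, map_sum, TensorProduct.map_tmul, LinearMap.comp_apply, LinearEquiv.coe_coe,
    TensorProduct.mk_apply]
  refine Finset.sum_congr rfl fun r _ => ?_
  obtain ⟨o, b, c, hb⟩ := exists_rep (A.comul (s r))
  have hb' : A.comul (A.α (s r)) = ∑ r, A.α (b r) ⊗ₜ[k] A.α (c r) := by
    simp [A.comul_α, hb]
  rw [hb, tensorAct_rep _ _ _ _ hb']
  simp only [TensorProduct.sum_tmul, map_sum, hK, zpow_apply_one]
  simp only [show -i - 2 + 1 = -i - 1 by ring, show -j - 2 + 1 = -j - 1 by ring,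
    show -n - 2 + 1 + 1 = -n by ring]

theorem tensor_compat (M N : EntwinedModule D.toEntwiningStructure i j n)
    (z : M.obj.carrier ⊗[k] N.obj.carrier) (a : W) :
    (HomComodule.tensor M.toHomComodule N.toHomComodule).coact (tensorAct M N (z ⊗ₜ a)) =
      D.compatLin n (tensorAct M N)
        ((HomComodule.tensor M.toHomComodule N.toHomComodule).coact z ⊗ₜ a) := by
  refine LinearMap.congr_fun (f := (H.muLin i j _ _ ∘ₗ TensorProduct.map M.coact N.coact) ∘ₗ
      tensorAct M N ∘ₗ (TensorProduct.mk k _ W).flip a)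
    (g := D.compatLin n (tensorAct M N) ∘ₗ (TensorProduct.mk k _ W).flip a ∘ₗ
      H.muLin i j _ _ ∘ₗ TensorProduct.map M.coact N.coact) (TensorProduct.ext' fun u v => ?_) z
  obtain ⟨l, p, q, hp⟩ := exists_rep (A.comul a)
  simp only [LinearMap.comp_apply, LinearMap.flip_apply, TensorProduct.mk_apply,
    tensorAct_rep _ _ _ _ hp, map_sum, TensorProduct.map_tmul, M.compat, N.compat]
  obtain ⟨m, u₀, u₁, hu⟩ := exists_rep (M.coact u)
  obtain ⟨o, v₀, v₁, hv⟩ := exists_rep (N.coact v)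
  simp only [hu, hv, TensorProduct.sum_tmul, TensorProduct.tmul_sum, map_sum,
    HomAlgebra.muLin_tmul]
  simp only [← tensor_compat_aux M N a hp]
  rw [Finset.sum_comm]
  refine Finset.sum_congr rfl fun _ _ => ?_
  exact Finset.sum_comm

end EntwinedModule

end entwining

section entwined_monoidal

variable {k : Type u} [Field k] {V W : Type u} [AddCommGroup V] [Module k V]
  [FiniteDimensional k V] [AddCommGroup W] [Module k W] [FiniteDimensional k W]

open HomVec

namespace HomCoalgebra

variable (A : HomCoalgebra k W) (i j : ℤ) {M N P : Type u} [AddCommGroup M] [Module k M]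
  [AddCommGroup N] [Module k N] [AddCommGroup P] [Module k P]

theorem tensorActLin_assoc (αM : M ≃ₗ[k] M) (αP : P ≃ₗ[k] P) (actM : M ⊗[k] W →ₗ[k] M)
    (actN : N ⊗[k] W →ₗ[k] N) (actP : P ⊗[k] W →ₗ[k] P)
    (hM : ∀ (m : ℤ) u a, (αM ^ m) (actM (u ⊗ₜ a)) = actM ((αM ^ m) u ⊗ₜ (A.α ^ m) a))
    (hP : ∀ (m : ℤ) u a, (αP ^ m) (actP (u ⊗ₜ a)) = actP ((αP ^ m) u ⊗ₜ (A.α ^ m) a))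
    (u : M) (v : N) (w : P) (a : W) :
    (TensorProduct.assoc k M N P ≪≫ₗ TensorProduct.congr (αM ^ (i + 1))
      (TensorProduct.congr (LinearEquiv.refl k N) (αP ^ (-j - 1))))
      (A.tensorActLin i j (A.tensorActLin i j actM actN) actP (((u ⊗ₜ v) ⊗ₜ w) ⊗ₜ a)) =
    A.tensorActLin i j actM (A.tensorActLin i j actN actP)
      (((αM ^ (i + 1)) u ⊗ₜ (v ⊗ₜ (αP ^ (-j - 1)) w)) ⊗ₜ a) := by
  let K : W ⊗[k] (W ⊗[k] W) →ₗ[k] M ⊗[k] (N ⊗[k] P) :=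
    TensorProduct.map
      (actM ∘ₗ TensorProduct.mk k _ W ((αM ^ (i + 1)) u) ∘ₗ (A.α ^ (-i - 3)).toLinearMap)
      (TensorProduct.map
        (actN ∘ₗ TensorProduct.mk k _ W v ∘ₗ (A.α ^ (-i - j - 4)).toLinearMap)
        (actP ∘ₗ TensorProduct.mk k _ W ((αP ^ (-j - 1)) w) ∘ₗ
          (A.α ^ (-j - j - 4)).toLinearMap))
  have hK : ∀ x y z, K (x ⊗ₜ (y ⊗ₜ z)) =
      actM ((αM ^ (i + 1)) u ⊗ₜ (A.α ^ (-i - 3)) x) ⊗ₜ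
        (actN (v ⊗ₜ (A.α ^ (-i - j - 4)) y) ⊗ₜ
          actP ((αP ^ (-j - 1)) w ⊗ₜ (A.α ^ (-j - j - 4)) z)) := fun _ _ _ => rfl
  have key := congrArg K (A.hom_coassoc a)
  obtain ⟨l, p, q, hp⟩ := exists_rep (A.comul a)
  choose m s t hs using fun r => exists_rep (A.comul (p r))
  choose m' s' t' hs' using fun r => exists_rep (A.comul (q r))
  have hz : ∀ (e : ℤ) (z : W) {n : ℕ} {p q : Fin n → W}, A.comul z = ∑ r, p r ⊗ₜ[k] q r →
      A.comul ((A.α ^ e) z) = ∑ r, (A.α ^ e) (p r) ⊗ₜ[k] (A.α ^ e) (q r) := fun e z n p q h => by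
    simp only [A.zpow_comul, h, map_sum, TensorProduct.map_tmul, LinearEquiv.coe_coe]
  simp only [hp, hs, hs', map_sum, TensorProduct.map_tmul, TensorProduct.sum_tmul,
    TensorProduct.tmul_sum, TensorProduct.assoc_tmul, LinearEquiv.coe_coe, hK,
    zpow_apply_one] at key
  simp only [A.tensorActLin_rep i j _ _ _ _ hp, A.tensorActLin_rep i j _ _ _ _ (hz _ _ (hs _)),
    A.tensorActLin_rep i j _ _ _ _ (hz _ _ (hs' _)), TensorProduct.sum_tmul,
    TensorProduct.tmul_sum, map_sum, LinearEquiv.trans_apply, TensorProduct.assoc_tmul,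
    TensorProduct.congr_tmul, LinearEquiv.refl_apply, hM, hP, zpow_zpow_apply]
  simp only [show -i - 2 + (-i - 2) = -i - i - 4 by ring,
    show i + 1 + (-i - i - 4) = -i - 3 by ring,
    show -j - 2 + (-i - 2) = -i - j - 4 by ring, show -i - 2 + (-j - 2) = -i - j - 4 by ring,
    show -j - 1 + (-j - 2) = -j - j - 3 by ring, show -j - 2 + (-j - 2) = -j - j - 4 by ring]
  simp only [show -i - 3 + 1 = -i - 2 by ring, show -j - j - 4 + 1 = -j - j - 3 by ring] at key
  exact key.symm

theorem tensorActLin_left (αM : M ≃ₗ[k] M) (actM : M ⊗[k] W →ₗ[k] M)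
    (hM : ∀ (m : ℤ) u a, (αM ^ m) (actM (u ⊗ₜ a)) = actM ((αM ^ m) u ⊗ₜ (A.α ^ m) a))
    (c : k) (u : M) (a : W) :
    (TensorProduct.lid k M ≪≫ₗ (αM ^ (j + 1) : M ≃ₗ[k] M))
      (A.tensorActLin i j ((TensorProduct.rid k k).toLinearMap ∘ₗ A.counit.lTensor k) actM
        ((c ⊗ₜ u) ⊗ₜ a)) =
    actM ((αM ^ (j + 1) : M ≃ₗ[k] M) (TensorProduct.lid k M (c ⊗ₜ u)) ⊗ₜ a) := by
  obtain ⟨l, p, q, hp⟩ := exists_rep (A.comul a)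
  have e := congrArg (fun b => c • actM ((αM ^ (j + 1)) u ⊗ₜ (A.α ^ (-1 : ℤ)) b))
    (A.counit_comul a)
  simp only [hp, map_sum, LinearMap.rTensor_tmul, TensorProduct.lid_tmul, map_smul,
    TensorProduct.tmul_sum, TensorProduct.tmul_smul, Finset.smul_sum, zpow_apply_one,
    neg_add_cancel, zpow_zero_apply] at e
  rw [A.tensorActLin_rep i j _ _ _ _ hp, TensorProduct.lid_tmul, map_smul,
    ← TensorProduct.smul_tmul', map_smul, ← e]
  simp only [map_sum, LinearEquiv.trans_apply, LinearMap.comp_apply, LinearMap.lTensor_tmul,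
    LinearEquiv.coe_coe, TensorProduct.rid_tmul, TensorProduct.lid_tmul, map_smul,
    A.zpow_counit, hM, zpow_zpow_apply, show j + 1 + (-j - 2) = -1 by ring, smul_smul,
    smul_eq_mul, mul_comm]

theorem tensorActLin_right (αM : M ≃ₗ[k] M) (actM : M ⊗[k] W →ₗ[k] M)
    (hM : ∀ (m : ℤ) u a, (αM ^ m) (actM (u ⊗ₜ a)) = actM ((αM ^ m) u ⊗ₜ (A.α ^ m) a))
    (u : M) (c : k) (a : W) :
    (TensorProduct.rid k M ≪≫ₗ (αM ^ (i + 1) : M ≃ₗ[k] M))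
      (A.tensorActLin i j actM ((TensorProduct.rid k k).toLinearMap ∘ₗ A.counit.lTensor k)
        ((u ⊗ₜ c) ⊗ₜ a)) =
    actM ((αM ^ (i + 1) : M ≃ₗ[k] M) (TensorProduct.rid k M (u ⊗ₜ c)) ⊗ₜ a) := by
  obtain ⟨l, p, q, hp⟩ := exists_rep (A.comul a)
  have e := congrArg (fun b => c • actM ((αM ^ (i + 1)) u ⊗ₜ (A.α ^ (-1 : ℤ)) b))
    (A.comul_counit a)
  simp only [hp, map_sum, LinearMap.lTensor_tmul, TensorProduct.rid_tmul, map_smul,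
    TensorProduct.tmul_sum, TensorProduct.tmul_smul, Finset.smul_sum, zpow_apply_one,
    neg_add_cancel, zpow_zero_apply] at e
  rw [A.tensorActLin_rep i j _ _ _ _ hp, TensorProduct.rid_tmul, map_smul,
    ← TensorProduct.smul_tmul', map_smul, ← e]
  simp only [map_sum, LinearEquiv.trans_apply, LinearMap.comp_apply, LinearMap.lTensor_tmul,
    LinearEquiv.coe_coe, TensorProduct.rid_tmul, map_smul,
    A.zpow_counit, hM, zpow_zpow_apply, show i + 1 + (-i - 2) = -1 by ring, smul_smul,
    smul_eq_mul, mul_comm]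

end HomCoalgebra

namespace EntwinedModule

variable {H : HomBialgebra k V} {A : HomBialgebra k W} {D : MonoidalEntwiningDatum H A}
  {i j n : ℤ}

/-- The tensor product of entwined modules. -/
def tensor (M N : EntwinedModule D.toEntwiningStructure i j n) :
    EntwinedModule D.toEntwiningStructure i j n where
  toHomComodule := HomComodule.tensor M.toHomComodule N.toHomComodule
  act := tensorAct M N
  act_assoc := tensorAct_assoc M N
  act_one := tensorAct_one M N
  compat := tensor_compat M N

/-- The unit entwined module `k`, with coaction `c ↦ c ⊗ 1` and action `c · a = ε(a) c`. -/
def unit : EntwinedModule D.toEntwiningStructure i j n where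
  toHomComodule := HomComodule.unit
  act := (TensorProduct.rid k k).toLinearMap ∘ₗ A.counit.lTensor k
  act_assoc u a b := by
    change A.counit (A.α b) • (A.counit a • u) = A.counit (A.mul (a ⊗ₜ b)) • u
    rw [A.counit_α, A.counit_mul, smul_smul, mul_comm]
  act_one u := by
    change A.counit A.one • u = u
    rw [A.counit_one, one_smul]
  compat u a := by
    change (A.counit a • u) ⊗ₜ[k] H.one = D.compatLin n _ ((u ⊗ₜ H.one) ⊗ₜ a)
    rw [compatLin_tmul, H.zpow_one]
    have e := congrArg (fun v => u ⊗ₜ[k] (H.α ^ (-n)) v) (D.E6 a)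
    obtain ⟨m, p, q, hp⟩ := exists_rep (D.Φ (H.one ⊗ₜ a))
    simp only [hp, map_sum, LinearMap.rTensor_tmul, TensorProduct.lid_tmul, map_smul, H.zpow_one,
      TensorProduct.tmul_sum, TensorProduct.tmul_smul] at e
    simp only [hp, map_sum, TensorProduct.map_tmul, LinearMap.comp_apply, LinearEquiv.coe_coe,
      TensorProduct.mk_apply]
    rw [← TensorProduct.smul_tmul', ← e]
    refine Finset.sum_congr rfl fun r _ => ?_
    change _ = (A.counit (A.α (p r)) • u) ⊗ₜ[k] _
    rw [A.counit_α, TensorProduct.smul_tmul']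

theorem tensor_linear {M N M' N' : EntwinedModule D.toEntwiningStructure i j n} (f : M ⟶ M')
    (g : N ⟶ N') (z : M.obj.carrier ⊗[k] N.obj.carrier) (a : W) :
    TensorProduct.map (Hom.toHom f).toLin (Hom.toHom g).toLin (tensorAct M N (z ⊗ₜ a)) =
      tensorAct M' N' (TensorProduct.map (Hom.toHom f).toLin (Hom.toHom g).toLin z ⊗ₜ a) := by
  obtain ⟨m, u, v, rfl⟩ := exists_rep z
  obtain ⟨l, p, q, hp⟩ := exists_rep (A.comul a)
  simp only [TensorProduct.sum_tmul, map_sum, tensorAct_rep _ _ _ _ hp, TensorProduct.map_tmul,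
    f.comm_act, g.comm_act]

theorem assoc_linear (M N P : EntwinedModule D.toEntwiningStructure i j n)
    (z : (M.obj.carrier ⊗[k] N.obj.carrier) ⊗[k] P.obj.carrier) (a : W) :
    assocEquiv M.obj N.obj P.obj (tensorAct (tensor M N) P (z ⊗ₜ a)) =
      tensorAct M (tensor N P) (assocEquiv M.obj N.obj P.obj z ⊗ₜ a) :=
  LinearMap.congr_fun
    (f := (assocEquiv M.obj N.obj P.obj).toLinearMap ∘ₗ tensorAct (tensor M N) P ∘ₗ
      (TensorProduct.mk k _ W).flip a)
    (g := tensorAct M (tensor N P) ∘ₗ (TensorProduct.mk k _ W).flip a ∘ₗ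
      (assocEquiv M.obj N.obj P.obj).toLinearMap)
    (TensorProduct.ext_threefold fun u v w =>
      A.tensorActLin_assoc i j M.obj.α P.obj.α M.act N.act P.act M.zpow_act P.zpow_act u v w a) z

theorem left_linear (M : EntwinedModule D.toEntwiningStructure i j n)
    (z : k ⊗[k] M.obj.carrier) (a : W) :
    leftUnitEquiv M.obj (tensorAct unit M (z ⊗ₜ a)) = M.act (leftUnitEquiv M.obj z ⊗ₜ a) :=
  LinearMap.congr_fun
    (f := (leftUnitEquiv M.obj).toLinearMap ∘ₗ tensorAct unit M ∘ₗ
      (TensorProduct.mk k _ W).flip a)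
    (g := M.act ∘ₗ (TensorProduct.mk k _ W).flip a ∘ₗ (leftUnitEquiv M.obj).toLinearMap)
    (TensorProduct.ext' fun c u => A.tensorActLin_left i j M.obj.α M.act M.zpow_act c u a) z

theorem right_linear (M : EntwinedModule D.toEntwiningStructure i j n)
    (z : M.obj.carrier ⊗[k] k) (a : W) :
    rightUnitEquiv M.obj (tensorAct M unit (z ⊗ₜ a)) = M.act (rightUnitEquiv M.obj z ⊗ₜ a) :=
  LinearMap.congr_fun
    (f := (rightUnitEquiv M.obj).toLinearMap ∘ₗ tensorAct M unit ∘ₗ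
      (TensorProduct.mk k _ W).flip a)
    (g := M.act ∘ₗ (TensorProduct.mk k _ W).flip a ∘ₗ (rightUnitEquiv M.obj).toLinearMap)
    (TensorProduct.ext' fun u c => A.tensorActLin_right i j M.obj.α M.act M.zpow_act u c a) z

/-- The underlying morphism of pairs. -/
def Hom.toPair {M N : EntwinedModule D.toEntwiningStructure i j n} (f : M ⟶ N) :
    M.obj ⟶ N.obj :=
  HomComodule.Hom.toHom (Hom.toHom f : M.toHomComodule ⟶ N.toHomComodule)

theorem hom_ext {M N : EntwinedModule D.toEntwiningStructure i j n} {f g : M ⟶ N}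
    (h : Hom.toPair f = Hom.toPair g) : f = g :=
  Hom.ext (congrArg HomVec.Hom.toLin h)

instance : MonoidalCategoryStruct (EntwinedModule D.toEntwiningStructure i j n) where
  tensorObj := tensor
  tensorUnit := unit
  tensorHom f g := ⟨⟨TensorProduct.map (Hom.toHom f).toLin (Hom.toHom g).toLin,
    HomComodule.tensor_colinear (Hom.toHom f) (Hom.toHom g)⟩, tensor_linear f g⟩
  whiskerLeft M _ _ f := ⟨⟨TensorProduct.map LinearMap.id (Hom.toHom f).toLin,
    HomComodule.tensor_colinear (𝟙 M.toHomComodule) (Hom.toHom f)⟩, tensor_linear (𝟙 M) f⟩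
  whiskerRight f N := ⟨⟨TensorProduct.map (Hom.toHom f).toLin LinearMap.id,
    HomComodule.tensor_colinear (Hom.toHom f) (𝟙 N.toHomComodule)⟩, tensor_linear f (𝟙 N)⟩
  associator M N P := mkIso (α_ M.obj N.obj P.obj)
    (HomComodule.assoc_colinear M.toHomComodule N.toHomComodule P.toHomComodule)
    (assoc_linear M N P)
  leftUnitor M := mkIso (λ_ M.obj) (HomComodule.left_colinear M.toHomComodule) (left_linear M)
  rightUnitor M := mkIso (ρ_ M.obj) (HomComodule.right_colinear M.toHomComodule) (right_linear M)

/-- The monoidal category of `n`-th Hom-entwined modules, with the constraints of the category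
of pairs. -/
instance : MonoidalCategory (EntwinedModule D.toEntwiningStructure i j n) where
  tensorHom_def f g := hom_ext (MonoidalCategory.tensorHom_def (Hom.toPair f) (Hom.toPair g))
  id_tensorHom_id M N := hom_ext (MonoidalCategory.id_tensorHom_id M.obj N.obj)
  tensorHom_comp_tensorHom f₁ f₂ g₁ g₂ := hom_ext
    (MonoidalCategory.tensorHom_comp_tensorHom (Hom.toPair f₁) (Hom.toPair f₂) (Hom.toPair g₁)
      (Hom.toPair g₂))
  whiskerLeft_id M N := hom_ext (MonoidalCategory.whiskerLeft_id M.obj N.obj)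
  id_whiskerRight M N := hom_ext (MonoidalCategory.id_whiskerRight M.obj N.obj)
  associator_naturality f₁ f₂ f₃ := hom_ext
    (MonoidalCategory.associator_naturality (Hom.toPair f₁) (Hom.toPair f₂) (Hom.toPair f₃))
  leftUnitor_naturality f := hom_ext (MonoidalCategory.leftUnitor_naturality (Hom.toPair f))
  rightUnitor_naturality f := hom_ext (MonoidalCategory.rightUnitor_naturality (Hom.toPair f))
  pentagon M N P Q := hom_ext (MonoidalCategory.pentagon M.obj N.obj P.obj Q.obj)
  triangle M N := hom_ext (MonoidalCategory.triangle M.obj N.obj)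

end EntwinedModule

/-- `b ⊗ h ↦ ∑ (b₁ ⊗ h₁^φ) ⊗ (b₂^φ ⊗ h₂)`, where `φ(b ⊗ h) = ∑ h^φ ⊗ b^φ`. -/
def smashComul (B : HomCoalgebra k W) (H : HomCoalgebra k V)
    (φ : W ⊗[k] V →ₗ[k] V ⊗[k] W) : W ⊗[k] V →ₗ[k] (W ⊗[k] V) ⊗[k] (W ⊗[k] V) :=
  (TensorProduct.assoc k W V (W ⊗[k] V)).symm.toLinearMap ∘ₗ
    LinearMap.lTensor W ((TensorProduct.assoc k V W V).toLinearMap ∘ₗ φ.rTensor V ∘ₗ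
      (TensorProduct.assoc k W V V).symm.toLinearMap) ∘ₗ
    (TensorProduct.assoc k W W (V ⊗[k] V)).toLinearMap ∘ₗ
    TensorProduct.map B.comul H.comul

end entwined_monoidal

/-- Two monoidal categories are monoidally isomorphic: there is an isomorphism of categories that
is a (strong) monoidal functor. -/
def MonoidallyIsomorphic (C D : Type*) [Category* C] [Category* D] [MonoidalCategory C]
    [MonoidalCategory D] : Prop :=
  ∃ (F : C ⥤ D) (G : D ⥤ C), F ⋙ G = 𝟭 C ∧ G ⋙ F = 𝟭 D ∧ Nonempty F.Monoidal

end HomEntwining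

/-!
Write `B = A^{*cop}` and `φ(f ⊗ h) = ∑ h^φ ⊗ f^φ` for the map `B ⊗ H → H ⊗ B` induced by `Φ`; it is
characterised by `∑ f^φ(a) h^φ = ∑ f(a_Φ) h^Φ`. Evaluating at elements of `A` translates the axioms
of a Hom-monoidal entwining datum for `Φ` into the statements that `φ` is compatible with the
comultiplications and counits of `B` and `H` and that it preserves products and unit
(`MonoidalEntwiningDatum.cosmash`). These properties of `φ`, collected in the structure `Cosmash` for
arbitrary Hom-bialgebras `B` and `H`, are all that is needed on the coalgebra side. They make `B ⊗ H`
a Hom-bialgebra (`Cosmash.bialgebra`), and they say that `φ̈(n)` is a monoidal distributive law between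
the bicomonads `_ ⊗ H` and `_ ⊗ B` (`Cosmash.distLaw`).

A bicomodule with coactions `θ` and `ρ` has a coaction `θ ≫ F.map ρ` of the composite comonad
`(_ ⊗ B) ⊗ H`, and this comonad is isomorphic to `_ ⊗ (B ⊗ H)` by
`(x ⊗ f) ⊗ h ↦ α⁻¹(x) ⊗ (α^{-n-2}(f) ⊗ h)` (`Cosmash.regroup`). Conversely, a comodule over `B ⊗ H`
yields coactions of `H` and `B` by corestriction along `f ⊗ h ↦ ε(f) h` and
`f ⊗ h ↦ ε(h) α^{n+1}(f)`. The two constructions are mutually inverse and strictly monoidal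
(`Cosmash.monoidallyIsomorphic_corep`).

On the other side, a right `A`-module structure on a finite-dimensional space is the same as a right
`B`-comodule structure, and under this duality the compatibility condition of `n`-th entwined modules
is exactly that of `φ̈(n)`-bicomodules (`evalSnd_phiLin`), while the tensor products correspond to each
other (`evalSnd_muLin`). Hence entwined modules and bicomodules are isomorphic monoidal categories
(`EntwinedModule.monoidallyIsomorphic_bicomodule`), and the isomorphism with comodules over `B ⊗ H`
is the composite of the two.

All functors involved leave the underlying pair `(X, α_X)` and the underlying maps unchanged. So an
equality of functors reduces to an equality of structures on objects (`functor_eq_id`), and the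
coherence of the monoidal structures, whose structure isomorphisms are identities on the underlying
pairs, is inherited from the category of pairs.
-/

namespace HomEntwining

/-! ### The cosmash product of two Hom-bialgebras -/

section smash

variable {k : Type u} [Field k] {V W : Type u} [AddCommGroup V] [Module k V]
  [AddCommGroup W] [Module k W]

/-- `(f ⊗ g) ⊗ h ↦ ∑ h^{φψ} ⊗ (f^ψ ⊗ g^φ)`, for a map `φ(f ⊗ h) = ∑ h^φ ⊗ f^φ`. -/
def swapPair (φ : W ⊗[k] V →ₗ[k] V ⊗[k] W) : (W ⊗[k] W) ⊗[k] V →ₗ[k] V ⊗[k] (W ⊗[k] W) :=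
  (TensorProduct.assoc k V W W).toLinearMap ∘ₗ φ.rTensor W ∘ₗ
    (TensorProduct.assoc k W V W).symm.toLinearMap ∘ₗ φ.lTensor W ∘ₗ
    (TensorProduct.assoc k W W V).toLinearMap

/-- `f ⊗ (h ⊗ g) ↦ ∑ (h^φ ⊗ g^ψ) ⊗ f^{φψ}`, for a map `φ(f ⊗ h) = ∑ h^φ ⊗ f^φ`. -/
def pairSwap (φ : W ⊗[k] V →ₗ[k] V ⊗[k] W) : W ⊗[k] (V ⊗[k] V) →ₗ[k] (V ⊗[k] V) ⊗[k] W :=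
  (TensorProduct.assoc k V V W).symm.toLinearMap ∘ₗ φ.lTensor V ∘ₗ
    (TensorProduct.assoc k V W V).toLinearMap ∘ₗ φ.rTensor V ∘ₗ
    (TensorProduct.assoc k W V V).symm.toLinearMap

/-- The conditions on `φ : B ⊗ H → H ⊗ B`, `φ(f ⊗ h) = ∑ h^φ ⊗ f^φ`, under which `B ⊗ H` with the
comultiplication `smashComul` and the factorwise multiplication is a Hom-bialgebra. -/
structure Cosmash (B : HomBialgebra k W) (H : HomBialgebra k V)
    (φ : W ⊗[k] V →ₗ[k] V ⊗[k] W) : Prop where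
  equivariant : ∀ z, φ (TensorProduct.map B.α.toLinearMap H.α.toLinearMap z) =
    TensorProduct.map H.α.toLinearMap B.α.toLinearMap (φ z)
  /-- `∑ α(h^φ) ⊗ Δ(f^φ) = ∑ α(h)^{φψ} ⊗ (f₁^ψ ⊗ f₂^φ)` -/
  comul_right : ∀ f h, TensorProduct.map H.α.toLinearMap B.comul (φ (f ⊗ₜ h)) =
    swapPair φ (B.comul f ⊗ₜ H.α h)
  /-- `∑ Δ(h^φ) ⊗ α(f^φ) = ∑ (h₁^φ ⊗ h₂^ψ) ⊗ α(f)^{φψ}` -/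
  comul_left : ∀ f h, TensorProduct.map H.comul B.α.toLinearMap (φ (f ⊗ₜ h)) =
    pairSwap φ (B.α f ⊗ₜ H.comul h)
  counit_left : ∀ f h, TensorProduct.lid k W (H.counit.rTensor W (φ (f ⊗ₜ h))) = H.counit h • f
  counit_right : ∀ f h, TensorProduct.rid k V (B.counit.lTensor V (φ (f ⊗ₜ h))) = B.counit f • h
  map_mul : ∀ f g h l, φ (B.mul (f ⊗ₜ g) ⊗ₜ H.mul (h ⊗ₜ l)) =
    TensorProduct.map H.mul B.mul
      (TensorProduct.tensorTensorTensorComm k V W V W (φ (f ⊗ₜ h) ⊗ₜ φ (g ⊗ₜ l)))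
  map_one : φ (B.one ⊗ₜ H.one) = H.one ⊗ₜ B.one

/-- `(f ⊗ g) ⊗ (h ⊗ l) ↦ ∑ (f ⊗ h^φ) ⊗ (g^φ ⊗ l)` -/
def swapMiddle (φ : W ⊗[k] V →ₗ[k] V ⊗[k] W) :
    (W ⊗[k] W) ⊗[k] (V ⊗[k] V) →ₗ[k] (W ⊗[k] V) ⊗[k] (W ⊗[k] V) :=
  (TensorProduct.assoc k W V (W ⊗[k] V)).symm.toLinearMap ∘ₗ
    LinearMap.lTensor W ((TensorProduct.assoc k V W V).toLinearMap ∘ₗ φ.rTensor V ∘ₗ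
      (TensorProduct.assoc k W V V).symm.toLinearMap) ∘ₗ
    (TensorProduct.assoc k W W (V ⊗[k] V)).toLinearMap

theorem swapMiddle_tmul (φ : W ⊗[k] V →ₗ[k] V ⊗[k] W) (f g : W) (h l : V) :
    swapMiddle φ ((f ⊗ₜ g) ⊗ₜ (h ⊗ₜ l)) =
      TensorProduct.map (TensorProduct.mk k W V f) ((TensorProduct.mk k W V).flip l)
        (φ (g ⊗ₜ h)) := by
  simp only [swapMiddle, LinearMap.comp_apply, LinearEquiv.coe_coe, TensorProduct.assoc_tmul,
    LinearMap.lTensor_tmul, TensorProduct.assoc_symm_tmul, LinearMap.rTensor_tmul]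
  induction φ (g ⊗ₜ h) using TensorProduct.induction_on with
  | zero => simp only [map_zero, TensorProduct.zero_tmul, TensorProduct.tmul_zero]
  | tmul x y => rfl
  | add x y hx hy => simp only [map_add, TensorProduct.add_tmul, TensorProduct.tmul_add, hx, hy]

variable [FiniteDimensional k V] [FiniteDimensional k W] in
theorem smashComul_tmul (B : HomCoalgebra k W) (H : HomCoalgebra k V)
    (φ : W ⊗[k] V →ₗ[k] V ⊗[k] W) (f : W) (h : V) :
    smashComul B H φ (f ⊗ₜ h) = swapMiddle φ (B.comul f ⊗ₜ H.comul h) := rfl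

/-- `(f ⊗ G) ⊗ (h ⊗ t) ↦ ∑ (f ⊗ h') ⊗ swapMiddle (G' ⊗ t)`, where `∑ h' ⊗ G' = swapPair (G ⊗ h)`.
Both sides of the Hom-coassociativity of the cosmash product are values of this map. -/
def swapTriple (φ : W ⊗[k] V →ₗ[k] V ⊗[k] W) :
    (W ⊗[k] (W ⊗[k] W)) ⊗[k] (V ⊗[k] (V ⊗[k] V)) →ₗ[k]
      (W ⊗[k] V) ⊗[k] ((W ⊗[k] V) ⊗[k] (W ⊗[k] V)) :=
  (TensorProduct.assoc k W V _).symm.toLinearMap ∘ₗ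
    LinearMap.lTensor W (LinearMap.lTensor V (swapMiddle φ) ∘ₗ
      (TensorProduct.assoc k V (W ⊗[k] W) (V ⊗[k] V)).toLinearMap ∘ₗ
      (swapPair φ).rTensor (V ⊗[k] V) ∘ₗ
      (TensorProduct.assoc k (W ⊗[k] W) V (V ⊗[k] V)).symm.toLinearMap) ∘ₗ
    (TensorProduct.assoc k W (W ⊗[k] W) _).toLinearMap

theorem swapTriple_tmul (φ : W ⊗[k] V →ₗ[k] V ⊗[k] W) (f : W) (G : W ⊗[k] W) (h : V)
    (t : V ⊗[k] V) :
    swapTriple φ ((f ⊗ₜ G) ⊗ₜ (h ⊗ₜ t)) = (TensorProduct.assoc k W V _).symm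
      (f ⊗ₜ LinearMap.lTensor V (swapMiddle φ)
        (TensorProduct.assoc k V (W ⊗[k] W) (V ⊗[k] V) (swapPair φ (G ⊗ₜ h) ⊗ₜ t))) := rfl

/-- Moving `g` past both factors of `t` and then swapping the middle of `G` and the result gives
`swapTriple`, because swaps that act on disjoint pairs of factors commute. -/
theorem swapTriple_tmul_tmul (φ : W ⊗[k] V →ₗ[k] V ⊗[k] W) (g : W) (G : W ⊗[k] W) (l : V)
    (t : V ⊗[k] V) :
    TensorProduct.assoc k _ _ _ ((swapMiddle φ).rTensor (W ⊗[k] V)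
      (TensorProduct.map (TensorProduct.mk k (W ⊗[k] W) (V ⊗[k] V) G)
        ((TensorProduct.mk k W V).flip l) (pairSwap φ (g ⊗ₜ t)))) =
      swapTriple φ (TensorProduct.assoc k _ _ _ (G ⊗ₜ g) ⊗ₜ
        TensorProduct.assoc k _ _ _ (t ⊗ₜ l)) := by
  induction G using TensorProduct.induction_on with
  | zero => simp
  | add x y hx hy =>
    simp only [TensorProduct.add_tmul, map_add, ← hx, ← hy, TensorProduct.map_add_left,
      LinearMap.add_apply]
  | tmul f f' =>
    induction t using TensorProduct.induction_on with
    | zero => simp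
    | add x y hx hy => simp only [TensorProduct.add_tmul, TensorProduct.tmul_add, map_add, hx, hy]
    | tmul h h' =>
      simp only [TensorProduct.assoc_tmul, swapTriple_tmul, pairSwap, swapPair,
        LinearMap.comp_apply, LinearEquiv.coe_coe, TensorProduct.assoc_symm_tmul,
        LinearMap.rTensor_tmul, LinearMap.lTensor_tmul]
      induction φ (g ⊗ₜ h) using TensorProduct.induction_on with
      | zero => simp
      | add x y hx hy => simp only [TensorProduct.add_tmul, TensorProduct.tmul_add, map_add, hx, hy]
      | tmul a b =>
        simp only [TensorProduct.assoc_tmul, TensorProduct.assoc_symm_tmul,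
          LinearMap.rTensor_tmul, LinearMap.lTensor_tmul]
        -- the swaps of `b` past `h'` and of `f'` past `a` do not interact
        obtain ⟨n, p, q, hp⟩ := exists_rep (φ (b ⊗ₜ h'))
        obtain ⟨m, s, t, hs⟩ := exists_rep (φ (f' ⊗ₜ a))
        simp only [hp, hs, map_sum, TensorProduct.sum_tmul, TensorProduct.tmul_sum,
          TensorProduct.map_tmul, TensorProduct.assoc_tmul, TensorProduct.assoc_symm_tmul,
          LinearMap.rTensor_tmul, LinearMap.lTensor_tmul, swapMiddle_tmul, LinearMap.flip_apply,
          TensorProduct.mk_apply]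
        exact Finset.sum_comm

/-- `(α ⊗ Δ) ∘ Δ` for the cosmash product, when `φ` is compatible with the comultiplication `δ`. -/
theorem map_swapMiddle_tmul {φ : W ⊗[k] V →ₗ[k] V ⊗[k] W} (α : W ≃ₗ[k] W) (β : V ≃ₗ[k] V)
    (δ : W →ₗ[k] W ⊗[k] W) (δ' : V →ₗ[k] V ⊗[k] V)
    (h : ∀ f h, TensorProduct.map β.toLinearMap δ (φ (f ⊗ₜ h)) = swapPair φ (δ f ⊗ₜ β h))
    (s : W ⊗[k] W) (t : V ⊗[k] V) :
    TensorProduct.map (TensorProduct.map α.toLinearMap β.toLinearMap)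
        (swapMiddle φ ∘ₗ TensorProduct.map δ δ') (swapMiddle φ (s ⊗ₜ t)) =
      swapTriple φ (TensorProduct.map α.toLinearMap δ s ⊗ₜ
        TensorProduct.map β.toLinearMap δ' t) := by
  induction s using TensorProduct.induction_on with
  | zero => simp
  | add x y hx hy => simp only [TensorProduct.add_tmul, map_add, hx, hy]
  | tmul f f' =>
    induction t using TensorProduct.induction_on with
    | zero => simp
    | add x y hx hy => simp only [TensorProduct.tmul_add, map_add, hx, hy]
    | tmul l l' =>
      simp only [TensorProduct.map_tmul, LinearEquiv.coe_coe, swapTriple_tmul, ← h,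
        swapMiddle_tmul]
      induction φ (f' ⊗ₜ l) using TensorProduct.induction_on with
      | zero => simp
      | add x y hx hy =>
        simp only [TensorProduct.add_tmul, TensorProduct.tmul_add, map_add, hx, hy]
      | tmul a b => rfl

/-- `(Δ ⊗ α) ∘ Δ` for the cosmash product, when `φ` is compatible with the comultiplication `δ'`. -/
theorem swapMiddle_map_tmul {φ : W ⊗[k] V →ₗ[k] V ⊗[k] W} (α : W ≃ₗ[k] W) (β : V ≃ₗ[k] V)
    (δ : W →ₗ[k] W ⊗[k] W) (δ' : V →ₗ[k] V ⊗[k] V)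
    (h : ∀ f h, TensorProduct.map δ' α.toLinearMap (φ (f ⊗ₜ h)) = pairSwap φ (α f ⊗ₜ δ' h))
    (s : W ⊗[k] W) (t : V ⊗[k] V) :
    TensorProduct.assoc k _ _ _ (TensorProduct.map (swapMiddle φ ∘ₗ TensorProduct.map δ δ')
        (TensorProduct.map α.toLinearMap β.toLinearMap) (swapMiddle φ (s ⊗ₜ t))) =
      swapTriple φ (TensorProduct.assoc k _ _ _ (TensorProduct.map δ α.toLinearMap s) ⊗ₜ
        TensorProduct.assoc k _ _ _ (TensorProduct.map δ' β.toLinearMap t)) := by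
  induction s using TensorProduct.induction_on with
  | zero => simp
  | add x y hx hy => simp only [TensorProduct.add_tmul, map_add, hx, hy]
  | tmul f f' =>
    induction t using TensorProduct.induction_on with
    | zero => simp
    | add x y hx hy => simp only [TensorProduct.tmul_add, map_add, hx, hy]
    | tmul l l' =>
      simp only [TensorProduct.map_tmul, LinearEquiv.coe_coe, swapMiddle_tmul]
      rw [← swapTriple_tmul_tmul, ← h f' l]
      refine congrArg (TensorProduct.assoc k _ _ _) ?_
      induction φ (f' ⊗ₜ l) using TensorProduct.induction_on with
      | zero => simp
      | add x y hx hy => simp only [map_add, hx, hy]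
      | tmul a b => rfl

/-- `swapMiddle` is multiplicative for the factorwise multiplications when `φ` is. -/
theorem swapMiddle_mul {φ : W ⊗[k] V →ₗ[k] V ⊗[k] W} (μ : W ⊗[k] W →ₗ[k] W)
    (ν : V ⊗[k] V →ₗ[k] V)
    (h : ∀ f g h l, φ (μ (f ⊗ₜ g) ⊗ₜ ν (h ⊗ₜ l)) = TensorProduct.map ν μ
      (TensorProduct.tensorTensorTensorComm k V W V W (φ (f ⊗ₜ h) ⊗ₜ φ (g ⊗ₜ l))))
    (s s' : W ⊗[k] W) (t t' : V ⊗[k] V) :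
    swapMiddle φ (TensorProduct.map μ μ (TensorProduct.tensorTensorTensorComm k W W W W
        (s ⊗ₜ s')) ⊗ₜ TensorProduct.map ν ν (TensorProduct.tensorTensorTensorComm k V V V V
          (t ⊗ₜ t'))) =
      TensorProduct.map
        (TensorProduct.map μ ν ∘ₗ (TensorProduct.tensorTensorTensorComm k W V W V).toLinearMap)
        (TensorProduct.map μ ν ∘ₗ (TensorProduct.tensorTensorTensorComm k W V W V).toLinearMap)
        (TensorProduct.tensorTensorTensorComm k _ _ _ _
          (swapMiddle φ (s ⊗ₜ t) ⊗ₜ swapMiddle φ (s' ⊗ₜ t'))) := by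
  induction s using TensorProduct.induction_on with
  | zero => simp
  | add x y hx hy => simp only [TensorProduct.add_tmul, map_add, hx, hy]
  | tmul f f' =>
  induction s' using TensorProduct.induction_on with
  | zero => simp
  | add x y hx hy => simp only [TensorProduct.add_tmul, TensorProduct.tmul_add, map_add, hx, hy]
  | tmul g g' =>
  induction t using TensorProduct.induction_on with
  | zero => simp
  | add x y hx hy => simp only [TensorProduct.add_tmul, TensorProduct.tmul_add, map_add, hx, hy]
  | tmul a a' =>
  induction t' using TensorProduct.induction_on with
  | zero => simp
  | add x y hx hy => simp only [TensorProduct.tmul_add, map_add, hx, hy]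
  | tmul b b' =>
  simp only [TensorProduct.tensorTensorTensorComm_tmul, TensorProduct.map_tmul, swapMiddle_tmul, h]
  obtain ⟨n, p, q, hp⟩ := exists_rep (φ (f' ⊗ₜ a))
  obtain ⟨m, s, t, hs⟩ := exists_rep (φ (g' ⊗ₜ b))
  simp only [hp, hs, map_sum, TensorProduct.sum_tmul, TensorProduct.tmul_sum,
    TensorProduct.map_tmul, TensorProduct.tensorTensorTensorComm_tmul, LinearMap.flip_apply,
    TensorProduct.mk_apply, LinearMap.comp_apply, LinearEquiv.coe_coe]

/-- The counit of the cosmash product. -/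
def smashCounit (ε : W →ₗ[k] k) (ε' : V →ₗ[k] k) : W ⊗[k] V →ₗ[k] k :=
  (TensorProduct.lid k k).toLinearMap ∘ₗ TensorProduct.map ε ε'

theorem smashCounit_tmul (ε : W →ₗ[k] k) (ε' : V →ₗ[k] k) (f : W) (h : V) :
    smashCounit ε ε' (f ⊗ₜ h) = ε f * ε' h := rfl

theorem smashCounit_rTensor_swapMiddle {φ : W ⊗[k] V →ₗ[k] V ⊗[k] W} (ε : W →ₗ[k] k)
    (ε' : V →ₗ[k] k)
    (h : ∀ f h, TensorProduct.lid k W (ε'.rTensor W (φ (f ⊗ₜ h))) = ε' h • f)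
    (s : W ⊗[k] W) (t : V ⊗[k] V) :
    TensorProduct.lid k _ ((smashCounit ε ε').rTensor _ (swapMiddle φ (s ⊗ₜ t))) =
      TensorProduct.lid k W (ε.rTensor W s) ⊗ₜ[k] TensorProduct.lid k V (ε'.rTensor V t) := by
  have e : ∀ (f : W) (l : V) (z : V ⊗[k] W), TensorProduct.lid k _
      ((smashCounit ε ε').rTensor _ (TensorProduct.map (TensorProduct.mk k W V f)
        ((TensorProduct.mk k W V).flip l) z)) =
      ε f • (TensorProduct.lid k W (ε'.rTensor W z) ⊗ₜ l) := fun f l z => by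
    induction z using TensorProduct.induction_on with
    | zero => simp
    | add x y hx hy => simp only [map_add, TensorProduct.add_tmul, smul_add, hx, hy]
    | tmul a b => simp [smashCounit_tmul, smul_smul, TensorProduct.smul_tmul']
  induction s using TensorProduct.induction_on with
  | zero => simp
  | add x y hx hy => simp only [TensorProduct.add_tmul, map_add, hx, hy]
  | tmul f f' =>
    induction t using TensorProduct.induction_on with
    | zero => simp
    | add x y hx hy => simp only [TensorProduct.tmul_add, map_add, hx, hy]
    | tmul l l' =>
      simp only [swapMiddle_tmul, e, h, LinearMap.rTensor_tmul, TensorProduct.lid_tmul,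
        TensorProduct.smul_tmul', TensorProduct.tmul_smul]
      rw [smul_comm]

theorem smashCounit_lTensor_swapMiddle {φ : W ⊗[k] V →ₗ[k] V ⊗[k] W} (ε : W →ₗ[k] k)
    (ε' : V →ₗ[k] k)
    (h : ∀ f h, TensorProduct.rid k V (ε.lTensor V (φ (f ⊗ₜ h))) = ε f • h)
    (s : W ⊗[k] W) (t : V ⊗[k] V) :
    TensorProduct.rid k _ ((smashCounit ε ε').lTensor _ (swapMiddle φ (s ⊗ₜ t))) =
      TensorProduct.rid k W (ε.lTensor W s) ⊗ₜ[k] TensorProduct.rid k V (ε'.lTensor V t) := by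
  have e : ∀ (f : W) (l : V) (z : V ⊗[k] W), TensorProduct.rid k _
      ((smashCounit ε ε').lTensor _ (TensorProduct.map (TensorProduct.mk k W V f)
        ((TensorProduct.mk k W V).flip l) z)) =
      ε' l • (f ⊗ₜ TensorProduct.rid k V (ε.lTensor V z)) := fun f l z => by
    induction z using TensorProduct.induction_on with
    | zero => simp
    | add x y hx hy => simp only [map_add, TensorProduct.tmul_add, smul_add, hx, hy]
    | tmul a b => simp [smashCounit_tmul, smul_smul, TensorProduct.tmul_smul, mul_comm]
  induction s using TensorProduct.induction_on with
  | zero => simp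
  | add x y hx hy => simp only [TensorProduct.add_tmul, map_add, hx, hy]
  | tmul f f' =>
    induction t using TensorProduct.induction_on with
    | zero => simp
    | add x y hx hy => simp only [TensorProduct.tmul_add, map_add, hx, hy]
    | tmul l l' =>
      simp only [swapMiddle_tmul, e, h, LinearMap.lTensor_tmul, TensorProduct.rid_tmul,
        TensorProduct.smul_tmul', TensorProduct.tmul_smul]

variable [FiniteDimensional k V] [FiniteDimensional k W] in
/-- The Hom-bialgebra `B ⊗ H` with factorwise multiplication and comultiplication
`f ⊗ h ↦ ∑ (f₁ ⊗ h₁^φ) ⊗ (f₂^φ ⊗ h₂)`. -/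
def Cosmash.bialgebra {B : HomBialgebra k W} {H : HomBialgebra k V}
    {φ : W ⊗[k] V →ₗ[k] V ⊗[k] W} (C : Cosmash B H φ) : HomBialgebra k (W ⊗[k] V) where
  α := TensorProduct.congr B.α H.α
  mul := TensorProduct.map B.mul H.mul ∘ₗ
    (TensorProduct.tensorTensorTensorComm k W V W V).toLinearMap
  one := B.one ⊗ₜ H.one
  comul := smashComul B.toHomCoalgebra H.toHomCoalgebra φ
  counit := smashCounit B.counit H.counit
  hom_assoc a b c := by
    induction a using TensorProduct.induction_on with
    | zero => simp
    | add x y hx hy => simp only [TensorProduct.add_tmul, map_add, hx, hy]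
    | tmul f f' =>
    induction b using TensorProduct.induction_on with
    | zero => simp
    | add x y hx hy => simp only [TensorProduct.add_tmul, TensorProduct.tmul_add, map_add, hx, hy]
    | tmul g g' =>
    induction c using TensorProduct.induction_on with
    | zero => simp
    | add x y hx hy => simp only [TensorProduct.tmul_add, map_add, hx, hy]
    | tmul l l' =>
      simp only [LinearMap.comp_apply, LinearEquiv.coe_coe, TensorProduct.congr_tmul,
        TensorProduct.tensorTensorTensorComm_tmul, TensorProduct.map_tmul, B.hom_assoc,
        H.hom_assoc]
  α_one := by rw [TensorProduct.congr_tmul, B.α_one, H.α_one]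
  one_mul a := by
    induction a using TensorProduct.induction_on with
    | zero => simp
    | add x y hx hy => simp only [TensorProduct.tmul_add, map_add, hx, hy]
    | tmul f f' =>
      simp only [LinearMap.comp_apply, LinearEquiv.coe_coe, TensorProduct.congr_tmul,
        TensorProduct.tensorTensorTensorComm_tmul, TensorProduct.map_tmul, B.one_mul, H.one_mul]
  mul_one a := by
    induction a using TensorProduct.induction_on with
    | zero => simp
    | add x y hx hy => simp only [TensorProduct.add_tmul, map_add, hx, hy]
    | tmul f f' =>
      simp only [LinearMap.comp_apply, LinearEquiv.coe_coe, TensorProduct.congr_tmul,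
        TensorProduct.tensorTensorTensorComm_tmul, TensorProduct.map_tmul, B.mul_one, H.mul_one]
  counit_α c := by
    induction c using TensorProduct.induction_on with
    | zero => simp
    | add x y hx hy => simp only [map_add, hx, hy]
    | tmul f f' => simp only [TensorProduct.congr_tmul, smashCounit_tmul, B.counit_α, H.counit_α]
  hom_coassoc c := by
    induction c using TensorProduct.induction_on with
    | zero => simp
    | add x y hx hy => simp only [map_add, hx, hy]
    | tmul f h =>
      refine (map_swapMiddle_tmul B.α H.α B.comul H.comul C.comul_right _ _).trans
        (Eq.trans ?_ (swapMiddle_map_tmul B.α H.α B.comul H.comul C.comul_left _ _).symm)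
      rw [B.hom_coassoc, H.hom_coassoc]
  counit_comul c := by
    induction c using TensorProduct.induction_on with
    | zero => simp
    | add x y hx hy => simp only [map_add, hx, hy]
    | tmul f h =>
      rw [smashComul_tmul, smashCounit_rTensor_swapMiddle _ _ C.counit_left, B.counit_comul,
        H.counit_comul, TensorProduct.congr_tmul]
  comul_counit c := by
    induction c using TensorProduct.induction_on with
    | zero => simp
    | add x y hx hy => simp only [map_add, hx, hy]
    | tmul f h =>
      rw [smashComul_tmul, smashCounit_lTensor_swapMiddle _ _ C.counit_right, B.comul_counit,
        H.comul_counit, TensorProduct.congr_tmul]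
  comul_mul a b := by
    induction a using TensorProduct.induction_on with
    | zero => simp
    | add x y hx hy => simp only [TensorProduct.add_tmul, map_add, hx, hy]
    | tmul f f' =>
    induction b using TensorProduct.induction_on with
    | zero => simp
    | add x y hx hy => simp only [TensorProduct.tmul_add, map_add, hx, hy]
    | tmul g g' =>
      rw [LinearMap.comp_apply, LinearEquiv.coe_coe, TensorProduct.tensorTensorTensorComm_tmul,
        TensorProduct.map_tmul, smashComul_tmul, B.comul_mul, H.comul_mul,
        swapMiddle_mul _ _ C.map_mul]
      rfl
  comul_one := by
    rw [smashComul_tmul, B.comul_one, H.comul_one, swapMiddle_tmul, C.map_one]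
    rfl
  counit_mul a b := by
    induction a using TensorProduct.induction_on with
    | zero => simp
    | add x y hx hy => simp only [TensorProduct.add_tmul, map_add, hx, hy, add_mul]
    | tmul f f' =>
    induction b using TensorProduct.induction_on with
    | zero => simp
    | add x y hx hy => simp only [TensorProduct.tmul_add, map_add, hx, hy, mul_add]
    | tmul g g' =>
      simp only [LinearMap.comp_apply, LinearEquiv.coe_coe, smashCounit_tmul,
        TensorProduct.tensorTensorTensorComm_tmul, TensorProduct.map_tmul, B.counit_mul,
        H.counit_mul, mul_mul_mul_comm]
  counit_one := by rw [smashCounit_tmul, B.counit_one, H.counit_one, _root_.mul_one]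

end smash

/-! ### The distributive law -/

section law

variable {k : Type u} [Field k] {V W : Type u} [AddCommGroup V] [Module k V]
  [AddCommGroup W] [Module k W]

theorem symm_eq_zpow (α : V ≃ₗ[k] V) : α.symm = α ^ (-1 : ℤ) := by
  rw [zpow_neg_one]; rfl

/-- Linear maps on `((M ⊗ W) ⊗ V) ⊗ ((N ⊗ W) ⊗ V)` agree if they agree on pure tensors. -/
theorem tensor_ext₆ {M N Q : Type u} [AddCommGroup M] [Module k M] [AddCommGroup N] [Module k N]
    [AddCommGroup Q] [Module k Q]
    {f g : ((M ⊗[k] W) ⊗[k] V) ⊗[k] ((N ⊗[k] W) ⊗[k] V) →ₗ[k] Q}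
    (h : ∀ x a b y c d, f (((x ⊗ₜ a) ⊗ₜ b) ⊗ₜ ((y ⊗ₜ c) ⊗ₜ d)) =
      g (((x ⊗ₜ a) ⊗ₜ b) ⊗ₜ ((y ⊗ₜ c) ⊗ₜ d))) : f = g := by
  ext x a b y c d
  exact h x a b y c d

namespace Cosmash

variable {B : HomBialgebra k W} {H : HomBialgebra k V} {φ : W ⊗[k] V →ₗ[k] V ⊗[k] W}
  (C : Cosmash B H φ)

include C

theorem zpow_equivariant (m : ℤ) (f : W) (h : V) :
    φ ((B.α ^ m) f ⊗ₜ (H.α ^ m) h) =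
      TensorProduct.map (H.α ^ m).toLinearMap (B.α ^ m).toLinearMap (φ (f ⊗ₜ h)) := by
  have e := zpow_comm_apply (α := TensorProduct.congr B.α H.α) (β := TensorProduct.congr H.α B.α)
    φ C.equivariant m (f ⊗ₜ h)
  rw [congr_zpow_tmul, TensorProduct.congr_zpow] at e
  exact e

end Cosmash

/-- The map `f ⊗ h ↦ ∑ α(h)^φ ⊗ α^n(α^{-n-1}(f)^φ)` on the coefficients of `phiLin`. -/
def phiCoeff (B : HomSpace k W) (H : HomSpace k V) (φ : W ⊗[k] V →ₗ[k] V ⊗[k] W) (n : ℤ) :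
    W ⊗[k] V →ₗ[k] V ⊗[k] W :=
  LinearMap.lTensor V (B.α ^ n).toLinearMap ∘ₗ φ ∘ₗ
    TensorProduct.map (B.α ^ (-n - 1)).toLinearMap H.α.toLinearMap

theorem phiCoeff_tmul (B : HomSpace k W) (H : HomSpace k V) (φ : W ⊗[k] V →ₗ[k] V ⊗[k] W)
    (n : ℤ) (f : W) (h : V) : phiCoeff B H φ n (f ⊗ₜ h) =
      LinearMap.lTensor V (B.α ^ n).toLinearMap (φ ((B.α ^ (-n - 1)) f ⊗ₜ H.α h)) := rfl

theorem phiLin_tmul (B : HomSpace k W) (H : HomSpace k V) (φ : W ⊗[k] V →ₗ[k] V ⊗[k] W) (n : ℤ)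
    (M : Type u) [AddCommGroup M] [Module k M] (x : M) (f : W) (h : V) :
    phiLin B H φ n M ((x ⊗ₜ f) ⊗ₜ h) =
      (TensorProduct.mk k M V x).rTensor W (phiCoeff B H φ n (f ⊗ₜ h)) := by
  change (TensorProduct.assoc k M V W).symm (x ⊗ₜ phiCoeff B H φ n (f ⊗ₜ h)) = _
  induction phiCoeff B H φ n (f ⊗ₜ h) using TensorProduct.induction_on with
  | zero => simp
  | tmul x y => rfl
  | add x y hx hy => simp only [map_add, TensorProduct.tmul_add, hx, hy]

variable [FiniteDimensional k V] [FiniteDimensional k W]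

namespace Cosmash

variable {B : HomBialgebra k W} {H : HomBialgebra k V} {φ : W ⊗[k] V →ₗ[k] V ⊗[k] W}
  (C : Cosmash B H φ)

/-- `φ̈(n)` is compatible with the comultiplication of the comonad `_ ⊗ B`, by `comul_right`. -/
theorem phiTrans_law₁ (i j n : ℤ) (X : HomVec k i j) :
    (H.comonad i j).map ((B.comonad i j).δ.app X) ≫
      (phiTrans B.toHomCoalgebra H.toHomCoalgebra φ C.equivariant i j n).app
        ((B.comonad i j).obj X) ≫
      (B.comonad i j).map
        ((phiTrans B.toHomCoalgebra H.toHomCoalgebra φ C.equivariant i j n).app X) =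
    (phiTrans B.toHomCoalgebra H.toHomCoalgebra φ C.equivariant i j n).app X ≫
      (B.comonad i j).δ.app ((H.comonad i j).obj X) := by
  refine HomVec.hom_ext (TensorProduct.ext_threefold fun x f h => ?_)
  change LinearMap.rTensor W (phiLin B.toHomSpace H.toHomSpace φ n X.carrier)
    (phiLin B.toHomSpace H.toHomSpace φ n (X.carrier ⊗[k] W)
      (((TensorProduct.assoc k X.carrier W W).symm
        (X.α x ⊗ₜ LinearMap.lTensor W B.α.symm.toLinearMap (B.comul f))) ⊗ₜ h)) =
    (TensorProduct.assoc k (X.carrier ⊗[k] V) W W).symm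
      (TensorProduct.map (TensorProduct.congr X.α H.α).toLinearMap
        (LinearMap.lTensor W B.α.symm.toLinearMap ∘ₗ B.comul)
        (phiLin B.toHomSpace H.toHomSpace φ n X.carrier ((x ⊗ₜ f) ⊗ₜ h)))
  -- `K` turns the identity `comul_right` for `φ` into the one for `φ̈(n)`.
  let K : V ⊗[k] (W ⊗[k] W) →ₗ[k] ((X.carrier ⊗[k] V) ⊗[k] W) ⊗[k] W :=
    (TensorProduct.assoc k (X.carrier ⊗[k] V) W W).symm.toLinearMap ∘ₗ
      TensorProduct.map (TensorProduct.mk k X.carrier V (X.α x))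
        (TensorProduct.map (B.α ^ n).toLinearMap (B.α ^ (-1 + n)).toLinearMap)
  have hK : ∀ z : V ⊗[k] W, (TensorProduct.assoc k (X.carrier ⊗[k] V) W W).symm
      (TensorProduct.map (TensorProduct.congr X.α H.α).toLinearMap
        (LinearMap.lTensor W B.α.symm.toLinearMap ∘ₗ B.comul)
        ((TensorProduct.mk k X.carrier V x).rTensor W
          (LinearMap.lTensor V (B.α ^ n).toLinearMap z))) =
      K (TensorProduct.map H.α.toLinearMap B.comul z) := fun z => by
    induction z using TensorProduct.induction_on with
    | zero => simp
    | add y z hy hz => simp only [map_add, hy, hz]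
    | tmul h f =>
      simp only [LinearMap.lTensor_tmul, LinearMap.rTensor_tmul, TensorProduct.map_tmul,
        LinearMap.comp_apply, LinearEquiv.coe_coe, B.zpow_comul]
      induction B.comul f using TensorProduct.induction_on with
      | zero => simp
      | add y z hy hz => simp only [map_add, TensorProduct.tmul_add, hy, hz]
      | tmul f g =>
        rw [symm_eq_zpow]
        simp only [K, LinearMap.lTensor_tmul, TensorProduct.map_tmul, TensorProduct.mk_apply,
          LinearMap.comp_apply, LinearEquiv.coe_coe, TensorProduct.congr_tmul,
          TensorProduct.assoc_symm_tmul, zpow_zpow_apply]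
  rw [phiLin_tmul, phiCoeff_tmul, hK, C.comul_right, B.zpow_comul]
  rw [symm_eq_zpow]
  induction B.comul f using TensorProduct.induction_on with
  | zero => simp
  | add y z hy hz => simp only [map_add, TensorProduct.tmul_add, TensorProduct.add_tmul, hy, hz]
  | tmul f g =>
    have e : φ ((B.α ^ (-n - 1)) ((B.α ^ (-1 : ℤ)) g) ⊗ₜ H.α h) =
        TensorProduct.map (H.α ^ (-1 : ℤ)).toLinearMap (B.α ^ (-1 : ℤ)).toLinearMap
          (φ ((B.α ^ (-n - 1)) g ⊗ₜ H.α (H.α h))) := by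
      rw [← C.zpow_equivariant, zpow_apply_one, neg_add_cancel, zpow_zero_apply, zpow_zpow_apply,
        zpow_zpow_apply, add_comm]
    simp only [LinearMap.lTensor_tmul, TensorProduct.assoc_symm_tmul, LinearEquiv.coe_coe,
      phiLin_tmul, phiCoeff_tmul, e, swapPair, LinearMap.comp_apply, TensorProduct.map_tmul,
      TensorProduct.assoc_tmul]
    induction φ ((B.α ^ (-n - 1)) g ⊗ₜ H.α (H.α h)) using TensorProduct.induction_on with
    | zero => simp
    | add y z hy hz => simp only [map_add, TensorProduct.tmul_add, hy, hz]
    | tmul h g =>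
      simp only [LinearMap.lTensor_tmul, LinearMap.rTensor_tmul, TensorProduct.assoc_symm_tmul,
        LinearEquiv.coe_coe, phiLin_tmul, phiCoeff_tmul, TensorProduct.map_tmul,
        TensorProduct.mk_apply, apply_zpow, neg_add_cancel, zpow_zero_apply]
      induction φ ((B.α ^ (-n - 1)) f ⊗ₜ h) using TensorProduct.induction_on with
      | zero => simp
      | add y z hy hz => simp only [map_add, TensorProduct.add_tmul, hy, hz]
      | tmul h f =>
        simp only [K, LinearMap.lTensor_tmul, LinearMap.rTensor_tmul, TensorProduct.map_tmul,
          TensorProduct.mk_apply, LinearMap.comp_apply, LinearEquiv.coe_coe,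
          TensorProduct.assoc_tmul, TensorProduct.assoc_symm_tmul, zpow_zpow_apply, add_comm n]

/-- `φ̈(n)` is compatible with the comultiplication of the comonad `_ ⊗ H`, by `comul_left`. -/
theorem phiTrans_law₂ (i j n : ℤ) (X : HomVec k i j) :
    (H.comonad i j).δ.app ((B.comonad i j).obj X) ≫
      (H.comonad i j).map
        ((phiTrans B.toHomCoalgebra H.toHomCoalgebra φ C.equivariant i j n).app X) ≫
      (phiTrans B.toHomCoalgebra H.toHomCoalgebra φ C.equivariant i j n).app
        ((H.comonad i j).obj X) =
    (phiTrans B.toHomCoalgebra H.toHomCoalgebra φ C.equivariant i j n).app X ≫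
      (B.comonad i j).map ((H.comonad i j).δ.app X) := by
  refine HomVec.hom_ext (TensorProduct.ext_threefold fun x f h => ?_)
  change phiLin B.toHomSpace H.toHomSpace φ n (X.carrier ⊗[k] V) (LinearMap.rTensor V
    (phiLin B.toHomSpace H.toHomSpace φ n X.carrier)
      ((TensorProduct.assoc k (X.carrier ⊗[k] W) V V).symm
        ((X.α x ⊗ₜ B.α f) ⊗ₜ LinearMap.lTensor V H.α.symm.toLinearMap (H.comul h)))) =
    LinearMap.rTensor W ((TensorProduct.assoc k X.carrier V V).symm.toLinearMap ∘ₗ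
      TensorProduct.map X.α.toLinearMap (LinearMap.lTensor V H.α.symm.toLinearMap ∘ₗ H.comul))
        (phiLin B.toHomSpace H.toHomSpace φ n X.carrier ((x ⊗ₜ f) ⊗ₜ h))
  -- `K` turns the identity `comul_left` for `φ` into the one for `φ̈(n)`.
  let K : (V ⊗[k] V) ⊗[k] W →ₗ[k] ((X.carrier ⊗[k] V) ⊗[k] V) ⊗[k] W :=
    TensorProduct.map ((TensorProduct.assoc k X.carrier V V).symm.toLinearMap ∘ₗ
      TensorProduct.mk k X.carrier (V ⊗[k] V) (X.α x) ∘ₗ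
        LinearMap.lTensor V (H.α ^ (-1 : ℤ)).toLinearMap) (B.α ^ (-1 + n)).toLinearMap
  have hK : ∀ z : V ⊗[k] W, LinearMap.rTensor W
      ((TensorProduct.assoc k X.carrier V V).symm.toLinearMap ∘ₗ TensorProduct.map X.α.toLinearMap
        (LinearMap.lTensor V H.α.symm.toLinearMap ∘ₗ H.comul))
        ((TensorProduct.mk k X.carrier V x).rTensor W
          (LinearMap.lTensor V (B.α ^ n).toLinearMap z)) =
      K (TensorProduct.map H.comul B.α.toLinearMap z) := fun z => by
    induction z using TensorProduct.induction_on with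
    | zero => simp
    | add y z hy hz => simp only [map_add, hy, hz]
    | tmul h f =>
      rw [symm_eq_zpow]
      simp only [K, LinearMap.lTensor_tmul, LinearMap.rTensor_tmul, TensorProduct.map_tmul,
        TensorProduct.mk_apply, LinearMap.comp_apply, LinearEquiv.coe_coe, zpow_apply_one,
        neg_add_cancel_comm]
  rw [phiLin_tmul, phiCoeff_tmul, hK, C.comul_left, H.comul_α]
  rw [symm_eq_zpow]
  induction H.comul h using TensorProduct.induction_on with
  | zero => simp
  | add y z hy hz => simp only [map_add, TensorProduct.tmul_add, hy, hz]
  | tmul h l =>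
    simp only [LinearMap.lTensor_tmul, TensorProduct.assoc_symm_tmul, LinearEquiv.coe_coe,
      LinearMap.rTensor_tmul, phiLin_tmul, phiCoeff_tmul, pairSwap, LinearMap.comp_apply,
      TensorProduct.map_tmul, apply_zpow, zpow_apply_one]
    induction φ ((B.α ^ (-n - 1 + 1)) f ⊗ₜ H.α h) using TensorProduct.induction_on with
    | zero => simp
    | add y z hy hz => simp only [map_add, TensorProduct.add_tmul, hy, hz]
    | tmul h f =>
      have e : φ ((B.α ^ (-n - 1)) ((B.α ^ n) f) ⊗ₜ l) =
          TensorProduct.map (H.α ^ (-1 : ℤ)).toLinearMap (B.α ^ (-1 : ℤ)).toLinearMap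
            (φ (f ⊗ₜ H.α l)) := by
        rw [← C.zpow_equivariant]
        simp only [zpow_zpow_apply, zpow_apply_one, neg_add_cancel, zpow_zero_apply]
        rw [show -n - 1 + n = -1 by ring]
      simp only [LinearMap.lTensor_tmul, LinearMap.rTensor_tmul, TensorProduct.assoc_tmul,
        LinearEquiv.coe_coe, phiLin_tmul, phiCoeff_tmul, TensorProduct.mk_apply,
        apply_zpow, neg_add_cancel, zpow_zero_apply, e]
      induction φ (f ⊗ₜ H.α l) using TensorProduct.induction_on with
      | zero => simp
      | add y z hy hz => simp only [map_add, TensorProduct.tmul_add, hy, hz]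
      | tmul l f =>
        simp only [K, LinearMap.lTensor_tmul, LinearMap.rTensor_tmul, TensorProduct.map_tmul,
          TensorProduct.mk_apply, LinearMap.comp_apply, LinearEquiv.coe_coe,
          TensorProduct.assoc_symm_tmul, zpow_zpow_apply, add_comm n]

/-- `φ̈(n)` is compatible with the counit of the comonad `_ ⊗ H`, by `counit_left`. -/
theorem phiTrans_law₃ (i j n : ℤ) (X : HomVec k i j) :
    (phiTrans B.toHomCoalgebra H.toHomCoalgebra φ C.equivariant i j n).app X ≫
      (B.comonad i j).map ((H.comonad i j).ε.app X) =
    (H.comonad i j).ε.app ((B.comonad i j).obj X) := by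
  refine HomVec.hom_ext (TensorProduct.ext_threefold fun x f h => ?_)
  change LinearMap.rTensor W ((TensorProduct.rid k X.carrier).toLinearMap ∘ₗ
      TensorProduct.map X.α.symm.toLinearMap H.counit)
      (phiLin B.toHomSpace H.toHomSpace φ n X.carrier ((x ⊗ₜ f) ⊗ₜ h)) =
    TensorProduct.rid k (X.carrier ⊗[k] W)
      ((X.α.symm x ⊗ₜ B.α.symm f) ⊗ₜ H.counit h)
  have hK : ∀ z : V ⊗[k] W, LinearMap.rTensor W ((TensorProduct.rid k X.carrier).toLinearMap ∘ₗ
      TensorProduct.map X.α.symm.toLinearMap H.counit)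
        ((TensorProduct.mk k X.carrier V x).rTensor W
          (LinearMap.lTensor V (B.α ^ n).toLinearMap z)) =
      X.α.symm x ⊗ₜ (B.α ^ n) (TensorProduct.lid k W (H.counit.rTensor W z)) := fun z => by
    induction z using TensorProduct.induction_on with
    | zero => simp
    | add y z hy hz => simp only [map_add, TensorProduct.tmul_add, hy, hz]
    | tmul h f => simp [TensorProduct.smul_tmul']
  rw [phiLin_tmul, phiCoeff_tmul, hK, C.counit_left, H.counit_α, map_smul, zpow_zpow_apply,
    show n + (-n - 1) = -1 by ring, zpow_neg_one]
  simp

/-- `φ̈(n)` is compatible with the counit of the comonad `_ ⊗ B`, by `counit_right`. -/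
theorem phiTrans_law₄ (i j n : ℤ) (X : HomVec k i j) :
    (phiTrans B.toHomCoalgebra H.toHomCoalgebra φ C.equivariant i j n).app X ≫
      (B.comonad i j).ε.app ((H.comonad i j).obj X) =
    (H.comonad i j).map ((B.comonad i j).ε.app X) := by
  refine HomVec.hom_ext (TensorProduct.ext_threefold fun x f h => ?_)
  change TensorProduct.rid k (X.carrier ⊗[k] V)
      (TensorProduct.map (TensorProduct.congr X.α H.α).symm.toLinearMap B.counit
      (phiLin B.toHomSpace H.toHomSpace φ n X.carrier ((x ⊗ₜ f) ⊗ₜ h))) =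
    TensorProduct.rid k X.carrier (X.α.symm x ⊗ₜ B.counit f) ⊗ₜ h
  have hK : ∀ z : V ⊗[k] W, TensorProduct.rid k (X.carrier ⊗[k] V)
      (TensorProduct.map (TensorProduct.congr X.α H.α).symm.toLinearMap B.counit
        ((TensorProduct.mk k X.carrier V x).rTensor W
          (LinearMap.lTensor V (B.α ^ n).toLinearMap z))) =
      X.α.symm x ⊗ₜ H.α.symm (TensorProduct.rid k V (B.counit.lTensor V z)) := fun z => by
    induction z using TensorProduct.induction_on with
    | zero => simp
    | add y z hy hz => simp only [map_add, TensorProduct.tmul_add, hy, hz]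
    | tmul h f => simp [B.zpow_counit]
  rw [phiLin_tmul, phiCoeff_tmul, hK, C.counit_right, B.zpow_counit]
  simp [TensorProduct.smul_tmul']

/-- `φ̈(n)` is monoidal because `φ` preserves multiplication and unit. -/
theorem phiTrans_monoidal (i j n : ℤ) : NatTrans.IsMonoidal
    (F₁ := (B.bicomonad i j).toFunctor ⋙ (H.bicomonad i j).toFunctor)
    (F₂ := (H.bicomonad i j).toFunctor ⋙ (B.bicomonad i j).toFunctor)
    (phiTrans B.toHomCoalgebra H.toHomCoalgebra φ C.equivariant i j n) where
  unit := by
    refine HomVec.hom_ext (LinearMap.ext fun c => ?_)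
    change phiLin B.toHomSpace H.toHomSpace φ n k ((c ⊗ₜ B.one) ⊗ₜ H.one) =
      (c ⊗ₜ[k] H.one) ⊗ₜ[k] B.one
    rw [phiLin_tmul, phiCoeff_tmul, B.zpow_one, H.α_one, C.map_one]
    simp [B.zpow_one]
  tensor X Y := by
    have hφ : ∀ (i : ℤ) (f : W) (h : V),
        φ ((B.α ^ (-n - 1)) ((B.α ^ i) f) ⊗ₜ H.α ((H.α ^ i) h)) =
          TensorProduct.map (H.α ^ i).toLinearMap (B.α ^ i).toLinearMap
            (φ ((B.α ^ (-n - 1)) f ⊗ₜ H.α h)) := fun i f h => by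
      rw [← C.zpow_equivariant]
      simp only [zpow_zpow_apply, zpow_apply_one, apply_zpow, add_comm]
    refine HomVec.hom_ext (tensor_ext₆ fun x f h y g l => ?_)
    change phiLin B.toHomSpace H.toHomSpace φ n (X.carrier ⊗[k] Y.carrier)
      (((x ⊗ₜ y) ⊗ₜ B.mul ((B.α ^ i) f ⊗ₜ (B.α ^ j) g)) ⊗ₜ H.mul ((H.α ^ i) h ⊗ₜ (H.α ^ j) l)) =
      LinearMap.rTensor W (H.muLin i j X.carrier Y.carrier)
        (B.muLin i j (X.carrier ⊗[k] V) (Y.carrier ⊗[k] V)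
          (phiLin B.toHomSpace H.toHomSpace φ n X.carrier ((x ⊗ₜ f) ⊗ₜ h) ⊗ₜ
            phiLin B.toHomSpace H.toHomSpace φ n Y.carrier ((y ⊗ₜ g) ⊗ₜ l)))
    simp only [phiLin_tmul, phiCoeff_tmul]
    rw [B.zpow_mul, H.α_mul, C.map_mul, hφ, hφ]
    obtain ⟨m, p, q, hp⟩ := exists_rep (φ ((B.α ^ (-n - 1)) f ⊗ₜ H.α h))
    obtain ⟨o, s, t, hs⟩ := exists_rep (φ ((B.α ^ (-n - 1)) g ⊗ₜ H.α l))
    simp only [hp, hs, map_sum, TensorProduct.sum_tmul, TensorProduct.tmul_sum,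
      TensorProduct.map_tmul, TensorProduct.tensorTensorTensorComm_tmul, LinearEquiv.coe_coe,
      LinearMap.lTensor_tmul, LinearMap.rTensor_tmul, TensorProduct.mk_apply,
      HomAlgebra.muLin_tmul, B.zpow_mul, zpow_zpow_apply, add_comm n]

/-- The monoidal comonad distributive law `φ̈(n)`. -/
def distLaw (i j n : ℤ) : MonoidalDistLaw (H.bicomonad i j) (B.bicomonad i j) where
  φ := phiTrans B.toHomCoalgebra H.toHomCoalgebra φ C.equivariant i j n
  law₁ := C.phiTrans_law₁ i j n
  law₂ := C.phiTrans_law₂ i j n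
  law₃ := C.phiTrans_law₃ i j n
  law₄ := C.phiTrans_law₄ i j n
  monoidal := C.phiTrans_monoidal i j n

end Cosmash

end law
/-! ### Isomorphisms of monoidal categories -/

section isomorphism

universe v₁ v₂ w₁ w₂

variable {C : Type w₁} [Category.{v₁} C] {E : Type w₂} [Category.{v₂} E]

/-- An endofunctor over a faithful functor is the identity as soon as it fixes all objects. -/
theorem functor_eq_id (U : C ⥤ E) [U.Faithful] (T : C ⥤ C) (h : T ⋙ U = U)
    (hobj : ∀ X, T.obj X = X) : T = 𝟭 C :=
  CategoryTheory.Functor.ext hobj fun X Y f => U.map_injective (by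
    have e := Functor.congr_hom h f
    rw [Functor.comp_map] at e
    rw [e, U.map_comp, U.map_comp, eqToHom_map, eqToHom_map]
    rfl)

theorem comp_map_id {C : Type*} [Category* C] (F : C ⥤ C) {X : C} {a b : X ⟶ F.obj X}
    (h : a = b) : a ≫ F.map (𝟙 X) = 𝟙 X ≫ b := by
  rw [F.map_id, Category.comp_id, Category.id_comp, h]

theorem MonoidallyIsomorphic.trans {C D E : Type*} [Category* C] [Category* D] [Category* E]
    [MonoidalCategory C] [MonoidalCategory D] [MonoidalCategory E]
    (h : MonoidallyIsomorphic C D) (h' : MonoidallyIsomorphic D E) : MonoidallyIsomorphic C E := by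
  obtain ⟨F, G, h1, h2, ⟨hF⟩⟩ := h
  obtain ⟨F', G', h1', h2', ⟨hF'⟩⟩ := h'
  refine ⟨F ⋙ F', G' ⋙ G, ?_, ?_, ⟨inferInstance⟩⟩
  · rw [Functor.assoc, ← Functor.assoc F', h1', Functor.id_comp, h1]
  · rw [Functor.assoc, ← Functor.assoc G, h2, Functor.id_comp, h2']

end isomorphism

/-! ### The composite coaction of a bicomodule -/

section composite

universe v w

variable {C : Type w} [Category.{v} C] {F G : Comonad C}
  {φ : G.toFunctor ⋙ F.toFunctor ⟶ F.toFunctor ⋙ G.toFunctor}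

namespace Bicomodule

/-- The coaction of the composite comonad `FG` on a bicomodule. -/
def total (M : Bicomodule φ) : M.obj ⟶ F.obj (G.obj M.obj) := M.θ ≫ F.map M.ρ

theorem total_counit_right (M : Bicomodule φ) : M.total ≫ F.map (G.ε.app M.obj) = M.θ := by
  rw [total, Category.assoc, ← F.map_comp, M.ρ_counit, F.map_id, Category.comp_id]

theorem total_counit_left (M : Bicomodule φ) : M.total ≫ F.ε.app (G.obj M.obj) = M.ρ := by
  have h := F.ε.naturality M.ρ
  rw [Functor.id_map] at h
  rw [total, Category.assoc, h, ← Category.assoc, M.θ_counit, Category.id_comp]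

/-- The distributive law makes the composite `FG` a comonad, with comultiplication
`FG ⟶ FGG ⟶ FFGG ⟶ FGFG`; `total` is coassociative for it. -/
theorem total_coassoc (M : Bicomodule φ) :
    M.total ≫ F.map (G.δ.app M.obj) ≫ F.δ.app (G.obj (G.obj M.obj)) ≫
        F.map (φ.app (G.obj M.obj)) =
      M.total ≫ F.map (G.map M.total) := by
  have h1 : F.map (M.ρ ≫ G.δ.app M.obj) ≫ F.δ.app (G.obj (G.obj M.obj)) =
      F.δ.app M.obj ≫ F.map (F.map (M.ρ ≫ G.δ.app M.obj)) := F.δ.naturality _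
  have h2 : F.map (M.ρ ≫ G.map M.ρ) ≫ φ.app (G.obj M.obj) =
      F.map M.ρ ≫ φ.app M.obj ≫ G.map (F.map M.ρ) := by
    rw [F.map_comp, Category.assoc]
    exact congrArg (F.map M.ρ ≫ ·) (φ.naturality M.ρ)
  calc M.total ≫ F.map (G.δ.app M.obj) ≫ F.δ.app (G.obj (G.obj M.obj)) ≫
        F.map (φ.app (G.obj M.obj))
      = M.θ ≫ (F.map (M.ρ ≫ G.δ.app M.obj) ≫ F.δ.app (G.obj (G.obj M.obj))) ≫
        F.map (φ.app (G.obj M.obj)) := by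
        simp only [total, Functor.map_comp, Category.assoc]
    _ = M.θ ≫ F.map M.θ ≫ F.map (F.map (M.ρ ≫ G.map M.ρ) ≫ φ.app (G.obj M.obj)) := by
        rw [h1, ← M.ρ_coassoc, ← Category.assoc, ← Category.assoc, M.θ_coassoc]
        simp only [Functor.map_comp, Category.assoc]
    _ = M.θ ≫ F.map (M.θ ≫ F.map M.ρ ≫ φ.app M.obj) ≫ F.map (G.map (F.map M.ρ)) := by
        rw [h2]
        simp only [Functor.map_comp, Category.assoc]
    _ = M.total ≫ F.map (G.map M.total) := by
        rw [M.compat]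
        simp only [total, Functor.map_comp, Category.assoc]

theorem total_natural {M N : Bicomodule φ} (f : M ⟶ N) :
    M.total ≫ F.map (G.map f.hom) = f.hom ≫ N.total := by
  rw [total, total, ← Category.assoc, ← f.comm_θ, Category.assoc, Category.assoc, ← F.map_comp,
    ← F.map_comp, f.comm_ρ]

end Bicomodule

end composite

/-! ### The projections of the cosmash product onto its factors -/

section smash_comodule

open HomVec

variable {k : Type u} [Field k] {V W : Type u} [AddCommGroup V] [Module k V]
  [AddCommGroup W] [Module k W]

namespace Cosmash

/-- The projection `f ⊗ h ↦ ε(f) h`. -/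
def projRight (B : HomCoalgebra k W) (V : Type u) [AddCommGroup V] [Module k V] :
    W ⊗[k] V →ₗ[k] V :=
  (TensorProduct.lid k V).toLinearMap ∘ₗ B.counit.rTensor V

/-- The projection `f ⊗ h ↦ ε(h) α^m(f)`. -/
def projLeft (B : HomCoalgebra k W) (H : HomCoalgebra k V) (m : ℤ) : W ⊗[k] V →ₗ[k] W :=
  (TensorProduct.rid k W).toLinearMap ∘ₗ TensorProduct.map (B.α ^ m).toLinearMap H.counit

theorem projRight_tmul (B : HomCoalgebra k W) (f : W) (h : V) :
    projRight B V (f ⊗ₜ h) = B.counit f • h := rfl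

theorem projLeft_tmul (B : HomCoalgebra k W) (H : HomCoalgebra k V) (m : ℤ) (f : W) (h : V) :
    projLeft B H m (f ⊗ₜ h) = H.counit h • (B.α ^ m) f := rfl

variable {B : HomBialgebra k W} {H : HomBialgebra k V} {φ : W ⊗[k] V →ₗ[k] V ⊗[k] W}
  (C : Cosmash B H φ)

include C in
/-- `∑ ε(h^φ) ε(f^φ) = ε(f) ε(h)` -/
theorem counit_counit (f : W) (h : V) :
    TensorProduct.lid k k (TensorProduct.map H.counit B.counit (φ (f ⊗ₜ h))) =
      B.counit f * H.counit h := by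
  have e := congrArg B.counit (C.counit_left f h)
  rw [map_smul, smul_eq_mul, mul_comm] at e
  rw [← e]
  induction φ (f ⊗ₜ h) using TensorProduct.induction_on with
  | zero => simp
  | add x y hx hy => simp only [map_add, hx, hy]
  | tmul x y => simp

include C in
theorem projLeft_projRight_swapMiddle (m : ℤ) (s : W ⊗[k] W) (t : V ⊗[k] V) :
    TensorProduct.map (projLeft B.toHomCoalgebra H.toHomCoalgebra m)
        (projRight B.toHomCoalgebra V) (swapMiddle φ (s ⊗ₜ t)) =
      (B.α ^ m) (TensorProduct.rid k W (B.counit.lTensor W s)) ⊗ₜ[k]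
        TensorProduct.lid k V (H.counit.rTensor V t) := by
  have e : ∀ (f : W) (l : V) (z : V ⊗[k] W),
      TensorProduct.map (projLeft B.toHomCoalgebra H.toHomCoalgebra m)
        (projRight B.toHomCoalgebra V) (TensorProduct.map (TensorProduct.mk k W V f)
        ((TensorProduct.mk k W V).flip l) z) =
      TensorProduct.lid k k (TensorProduct.map H.counit B.counit z) • ((B.α ^ m) f ⊗ₜ l) :=
    fun f l z => by
      induction z using TensorProduct.induction_on with
      | zero => simp
      | add x y hx hy => simp only [map_add, add_smul, hx, hy]
      | tmul a b =>
        simp [projLeft_tmul, projRight_tmul, TensorProduct.smul_tmul', TensorProduct.tmul_smul,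
          smul_smul, mul_comm]
  induction s using TensorProduct.induction_on with
  | zero => simp
  | add x y hx hy => simp only [TensorProduct.add_tmul, map_add, hx, hy]
  | tmul f f' =>
    induction t using TensorProduct.induction_on with
    | zero => simp
    | add x y hx hy => simp only [TensorProduct.tmul_add, map_add, hx, hy]
    | tmul l l' =>
      rw [swapMiddle_tmul, e, C.counit_counit]
      simp [TensorProduct.smul_tmul', TensorProduct.tmul_smul, smul_smul, mul_comm]

theorem projRight_projLeft_swapMiddle (m : ℤ) (s : W ⊗[k] W) (t : V ⊗[k] V) :
    TensorProduct.map (projRight B.toHomCoalgebra V)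
        (projLeft B.toHomCoalgebra H.toHomCoalgebra m) (swapMiddle φ (s ⊗ₜ t)) =
      LinearMap.lTensor V (B.α ^ m).toLinearMap
        (φ (TensorProduct.lid k W (B.counit.rTensor W s) ⊗ₜ[k]
          TensorProduct.rid k V (H.counit.lTensor V t))) := by
  have e : ∀ (f : W) (l : V) (z : V ⊗[k] W),
      TensorProduct.map (projRight B.toHomCoalgebra V)
        (projLeft B.toHomCoalgebra H.toHomCoalgebra m) (TensorProduct.map (TensorProduct.mk k W V f)
        ((TensorProduct.mk k W V).flip l) z) =
      (B.counit f * H.counit l) • LinearMap.lTensor V (B.α ^ m).toLinearMap z :=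
    fun f l z => by
      induction z using TensorProduct.induction_on with
      | zero => simp
      | add x y hx hy => simp only [map_add, smul_add, hx, hy]
      | tmul a b =>
        simp [projLeft_tmul, projRight_tmul, TensorProduct.smul_tmul', TensorProduct.tmul_smul,
          smul_smul, mul_comm]
  induction s using TensorProduct.induction_on with
  | zero => simp
  | add x y hx hy => simp only [TensorProduct.add_tmul, map_add, hx, hy]
  | tmul f f' =>
    induction t using TensorProduct.induction_on with
    | zero => simp
    | add x y hx hy => simp only [TensorProduct.tmul_add, map_add, hx, hy]
    | tmul l l' =>
      rw [swapMiddle_tmul, e]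
      simp only [LinearMap.rTensor_tmul, LinearMap.lTensor_tmul, TensorProduct.lid_tmul,
        TensorProduct.rid_tmul, TensorProduct.tmul_smul, ← TensorProduct.smul_tmul', map_smul,
        smul_smul, mul_comm]

include C in
theorem projRight_projRight_swapMiddle (s : W ⊗[k] W) (t : V ⊗[k] V) :
    TensorProduct.map (projRight B.toHomCoalgebra V) (projRight B.toHomCoalgebra V)
        (swapMiddle φ (s ⊗ₜ t)) =
      B.counit (TensorProduct.lid k W (B.counit.rTensor W s)) • t := by
  have e : ∀ (f : W) (l : V) (z : V ⊗[k] W),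
      TensorProduct.map (projRight B.toHomCoalgebra V) (projRight B.toHomCoalgebra V)
        (TensorProduct.map (TensorProduct.mk k W V f) ((TensorProduct.mk k W V).flip l) z) =
      B.counit f • (TensorProduct.rid k V (B.counit.lTensor V z) ⊗ₜ l) :=
    fun f l z => by
      induction z using TensorProduct.induction_on with
      | zero => simp
      | add x y hx hy => simp only [map_add, smul_add, TensorProduct.add_tmul, hx, hy]
      | tmul a b =>
        simp [projRight_tmul, TensorProduct.smul_tmul', TensorProduct.tmul_smul, smul_smul,
          mul_comm]
  induction s using TensorProduct.induction_on with
  | zero => simp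
  | add x y hx hy => simp only [TensorProduct.add_tmul, map_add, add_smul, hx, hy]
  | tmul f f' =>
    induction t using TensorProduct.induction_on with
    | zero => simp
    | add x y hx hy => simp only [TensorProduct.tmul_add, map_add, smul_add, hx, hy]
    | tmul l l' =>
      rw [swapMiddle_tmul, e, C.counit_right]
      simp [TensorProduct.smul_tmul', smul_smul]

include C in
theorem projLeft_projLeft_swapMiddle (m : ℤ) (s : W ⊗[k] W) (t : V ⊗[k] V) :
    TensorProduct.map (projLeft B.toHomCoalgebra H.toHomCoalgebra m)
        (projLeft B.toHomCoalgebra H.toHomCoalgebra m) (swapMiddle φ (s ⊗ₜ t)) =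
      H.counit (TensorProduct.rid k V (H.counit.lTensor V t)) •
        TensorProduct.map (B.α ^ m).toLinearMap (B.α ^ m).toLinearMap s := by
  have e : ∀ (f : W) (l : V) (z : V ⊗[k] W),
      TensorProduct.map (projLeft B.toHomCoalgebra H.toHomCoalgebra m)
        (projLeft B.toHomCoalgebra H.toHomCoalgebra m) (TensorProduct.map (TensorProduct.mk k W V f)
        ((TensorProduct.mk k W V).flip l) z) =
      H.counit l • ((B.α ^ m) f ⊗ₜ (B.α ^ m) (TensorProduct.lid k W (H.counit.rTensor W z))) :=
    fun f l z => by
      induction z using TensorProduct.induction_on with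
      | zero => simp
      | add x y hx hy => simp only [map_add, smul_add, TensorProduct.tmul_add, hx, hy]
      | tmul a b =>
        simp [projLeft_tmul, TensorProduct.smul_tmul', TensorProduct.tmul_smul, smul_smul]
  induction s using TensorProduct.induction_on with
  | zero => simp
  | add x y hx hy => simp only [TensorProduct.add_tmul, map_add, smul_add, hx, hy]
  | tmul f f' =>
    induction t using TensorProduct.induction_on with
    | zero => simp
    | add x y hx hy => simp only [TensorProduct.tmul_add, map_add, add_smul, hx, hy]
    | tmul l l' =>
      rw [swapMiddle_tmul, e, C.counit_left]
      simp [TensorProduct.smul_tmul', TensorProduct.tmul_smul, smul_smul, mul_comm]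

end Cosmash

end smash_comodule

/-! ### Corestriction and the comparison of comonads -/

section corepresentations

open HomVec

variable {k : Type u} [Field k] {V W : Type u} [AddCommGroup V] [Module k V]
  [AddCommGroup W] [Module k W] [FiniteDimensional k V] [FiniteDimensional k W]

namespace HomComodule

variable {S : HomCoalgebra k V} {T : HomCoalgebra k W} {i j : ℤ}

/-- The corestriction of a Hom-comodule along a map of Hom-coalgebras. -/
@[simps]
def push (N : HomComodule S i j) (g : V →ₗ[k] W) (hα : ∀ s, g (S.α s) = T.α (g s))
    (hcomul : ∀ s, T.comul (g s) = TensorProduct.map g g (S.comul s))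
    (hcounit : ∀ s, T.counit (g s) = S.counit s) : HomComodule T i j where
  obj := N.obj
  coact := LinearMap.lTensor _ g ∘ₗ N.coact
  coassoc u := by
    have e := congrArg (TensorProduct.map (LinearMap.id (M := N.obj.carrier))
      (TensorProduct.map g g)) (N.coassoc u)
    have h1 : ∀ z : N.obj.carrier ⊗[k] V, TensorProduct.map N.obj.α.toLinearMap T.comul
        (LinearMap.lTensor _ g z) = TensorProduct.map LinearMap.id (TensorProduct.map g g)
          (TensorProduct.map N.obj.α.toLinearMap S.comul z) := fun z => by
      induction z using TensorProduct.induction_on with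
      | zero => simp
      | add x y hx hy => simp only [map_add, hx, hy]
      | tmul x s => simp [hcomul]
    have h2 : ∀ z : N.obj.carrier ⊗[k] V, TensorProduct.assoc k _ _ _ (TensorProduct.map
        (LinearMap.lTensor _ g ∘ₗ N.coact) T.α.toLinearMap (LinearMap.lTensor _ g z)) =
        TensorProduct.map LinearMap.id (TensorProduct.map g g) (TensorProduct.assoc k _ _ _
          (TensorProduct.map N.coact S.α.toLinearMap z)) := fun z => by
      induction z using TensorProduct.induction_on with
      | zero => simp
      | add x y hx hy => simp only [map_add, hx, hy]
      | tmul x s =>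
        simp only [LinearMap.lTensor_tmul, TensorProduct.map_tmul, LinearMap.comp_apply,
          LinearEquiv.coe_coe, ← hα]
        induction N.coact x using TensorProduct.induction_on with
        | zero => simp
        | add x y hx hy => simp only [map_add, TensorProduct.add_tmul, hx, hy]
        | tmul x t => simp
    rw [LinearMap.comp_apply, h1, h2, e]
  counit u := by
    rw [← N.counit, LinearMap.comp_apply]
    induction N.coact u using TensorProduct.induction_on with
    | zero => simp
    | add x y hx hy => simp only [map_add, hx, hy]
    | tmul x s => simp [hcounit]

/-- `∑ u₀₀ ⊗ p(u₀₁) ⊗ q(u₁) = ∑ α(u₀) ⊗ p(u₁₁) ⊗ q(α⁻¹(u₁₂))` -/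
theorem rTensor_coact_map (N : HomComodule S i j) {P Q : Type u} [AddCommGroup P] [Module k P]
    [AddCommGroup Q] [Module k Q] (p : V →ₗ[k] P) (q : V →ₗ[k] Q) (u : N.obj.carrier) :
    LinearMap.rTensor Q (LinearMap.lTensor N.obj.carrier p ∘ₗ N.coact)
        (LinearMap.lTensor N.obj.carrier q (N.coact u)) =
      (TensorProduct.assoc k _ _ _).symm (TensorProduct.map N.obj.α.toLinearMap
        (TensorProduct.map p (q ∘ₗ S.α.symm.toLinearMap) ∘ₗ S.comul) (N.coact u)) := by
  have e : (TensorProduct.assoc k N.obj.carrier V V).symm (TensorProduct.map N.obj.α.toLinearMap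
      (LinearMap.lTensor V S.α.symm.toLinearMap ∘ₗ S.comul) (N.coact u)) =
        LinearMap.rTensor V N.coact (N.coact u) :=
    LinearMap.congr_fun (congrArg HomVec.Hom.toLin N.hom_coassoc) u
  have e' := congrArg (TensorProduct.map (LinearMap.lTensor N.obj.carrier p) q) e
  have h1 : ∀ z : N.obj.carrier ⊗[k] V,
      LinearMap.rTensor Q (LinearMap.lTensor N.obj.carrier p ∘ₗ N.coact)
        (LinearMap.lTensor N.obj.carrier q z) =
      TensorProduct.map (LinearMap.lTensor N.obj.carrier p) q (LinearMap.rTensor V N.coact z) :=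
    fun z => by
      induction z using TensorProduct.induction_on with
      | zero => simp
      | add x y hx hy => simp only [map_add, hx, hy]
      | tmul x s => rfl
  have h2 : ∀ z : N.obj.carrier ⊗[k] V,
      (TensorProduct.assoc k _ _ _).symm (TensorProduct.map N.obj.α.toLinearMap
        (TensorProduct.map p (q ∘ₗ S.α.symm.toLinearMap) ∘ₗ S.comul) z) =
      TensorProduct.map (LinearMap.lTensor N.obj.carrier p) q
        ((TensorProduct.assoc k N.obj.carrier V V).symm (TensorProduct.map N.obj.α.toLinearMap
          (LinearMap.lTensor V S.α.symm.toLinearMap ∘ₗ S.comul) z)) := fun z => by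
    induction z using TensorProduct.induction_on with
    | zero => simp
    | add x y hx hy => simp only [map_add, hx, hy]
    | tmul x s =>
      simp only [TensorProduct.map_tmul, LinearMap.comp_apply]
      induction S.comul s using TensorProduct.induction_on with
      | zero => simp
      | add x y hx hy => simp only [map_add, TensorProduct.tmul_add, hx, hy]
      | tmul x t => rfl
  rw [h1, h2, e']

end HomComodule

namespace Cosmash

variable {B : HomBialgebra k W} {H : HomBialgebra k V} {φ : W ⊗[k] V →ₗ[k] V ⊗[k] W}
  (C : Cosmash B H φ)

theorem projRight_α (s : W ⊗[k] V) : projRight B.toHomCoalgebra V (C.bialgebra.α s) =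
    H.α (projRight B.toHomCoalgebra V s) := by
  induction s using TensorProduct.induction_on with
  | zero => simp
  | add x y hx hy => simp only [map_add, hx, hy]
  | tmul f h =>
    change B.counit (B.α f) • H.α h = H.α (B.counit f • h)
    rw [B.counit_α, map_smul]

theorem projRight_comul (s : W ⊗[k] V) : H.comul (projRight B.toHomCoalgebra V s) =
    TensorProduct.map (projRight B.toHomCoalgebra V) (projRight B.toHomCoalgebra V)
      (C.bialgebra.comul s) := by
  induction s using TensorProduct.induction_on with
  | zero => simp
  | add x y hx hy => simp only [map_add, hx, hy]
  | tmul f h =>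
    refine Eq.trans ?_ (C.projRight_projRight_swapMiddle (B.comul f) (H.comul h)).symm
    rw [B.counit_comul, B.counit_α, projRight_tmul, map_smul]

theorem projRight_counit (s : W ⊗[k] V) : H.counit (projRight B.toHomCoalgebra V s) =
    C.bialgebra.counit s := by
  induction s using TensorProduct.induction_on with
  | zero => simp
  | add x y hx hy => simp only [map_add, hx, hy]
  | tmul f h =>
    change H.counit (B.counit f • h) = B.counit f * H.counit h
    rw [map_smul, smul_eq_mul]

theorem projLeft_α (m : ℤ) (s : W ⊗[k] V) :
    projLeft B.toHomCoalgebra H.toHomCoalgebra m (C.bialgebra.α s) =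
      B.α (projLeft B.toHomCoalgebra H.toHomCoalgebra m s) := by
  induction s using TensorProduct.induction_on with
  | zero => simp
  | add x y hx hy => simp only [map_add, hx, hy]
  | tmul f h =>
    change H.counit (H.α h) • (B.α ^ m) (B.α f) = B.α (H.counit h • (B.α ^ m) f)
    rw [H.counit_α, map_smul, zpow_apply_one, apply_zpow]

theorem projLeft_comul (m : ℤ) (s : W ⊗[k] V) :
    B.comul (projLeft B.toHomCoalgebra H.toHomCoalgebra m s) =
      TensorProduct.map (projLeft B.toHomCoalgebra H.toHomCoalgebra m)
        (projLeft B.toHomCoalgebra H.toHomCoalgebra m) (C.bialgebra.comul s) := by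
  induction s using TensorProduct.induction_on with
  | zero => simp
  | add x y hx hy => simp only [map_add, hx, hy]
  | tmul f h =>
    refine Eq.trans ?_ (C.projLeft_projLeft_swapMiddle m (B.comul f) (H.comul h)).symm
    rw [H.comul_counit, H.counit_α, projLeft_tmul, map_smul, B.zpow_comul]

theorem projLeft_counit (m : ℤ) (s : W ⊗[k] V) :
    B.counit (projLeft B.toHomCoalgebra H.toHomCoalgebra m s) = C.bialgebra.counit s := by
  induction s using TensorProduct.induction_on with
  | zero => simp
  | add x y hx hy => simp only [map_add, hx, hy]
  | tmul f h =>
    change B.counit (H.counit h • (B.α ^ m) f) = B.counit f * H.counit h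
    rw [map_smul, smul_eq_mul, B.zpow_counit, mul_comm]

/-- Projecting the two tensor factors of `Δ(f ⊗ h)` to `B` and `H` recovers `f ⊗ h`, so that a
comodule over the cosmash product is determined by its two corestrictions. -/
theorem projLeft_projRight_comul (m : ℤ) (s : W ⊗[k] V) :
    TensorProduct.map (projLeft B.toHomCoalgebra H.toHomCoalgebra m)
      (projRight B.toHomCoalgebra V ∘ₗ C.bialgebra.α.symm.toLinearMap) (C.bialgebra.comul s) =
    (B.α ^ (m + 1)).toLinearMap.rTensor V s := by
  have h : projRight B.toHomCoalgebra V ∘ₗ C.bialgebra.α.symm.toLinearMap =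
      H.α.symm.toLinearMap ∘ₗ projRight B.toHomCoalgebra V := LinearMap.ext fun s => by
    apply H.α.injective
    simp [← C.projRight_α]
  rw [h, ← LinearMap.lTensor_comp_map, LinearMap.comp_apply]
  induction s using TensorProduct.induction_on with
  | zero => simp
  | add x y hx hy => simp only [map_add, hx, hy]
  | tmul f h =>
    refine (congrArg _ (C.projLeft_projRight_swapMiddle m (B.comul f) (H.comul h))).trans ?_
    rw [B.comul_counit, H.counit_comul, zpow_apply_one]
    simp

/-- Projecting the two tensor factors of `Δ(f ⊗ h)` to `H` and `B`, in the order opposite to that of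
the product, gives `φ`. This is the source of the compatibility of the two corestrictions. -/
theorem projRight_projLeft_comul (m : ℤ) (f : W) (h : V) :
    TensorProduct.map (projRight B.toHomCoalgebra V)
      (projLeft B.toHomCoalgebra H.toHomCoalgebra m ∘ₗ C.bialgebra.α.symm.toLinearMap)
        (C.bialgebra.comul (f ⊗ₜ h)) =
    LinearMap.lTensor V (B.α ^ (m - 1)).toLinearMap (φ (B.α f ⊗ₜ H.α h)) := by
  have e : projLeft B.toHomCoalgebra H.toHomCoalgebra m ∘ₗ C.bialgebra.α.symm.toLinearMap =
      B.α.symm.toLinearMap ∘ₗ projLeft B.toHomCoalgebra H.toHomCoalgebra m :=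
    LinearMap.ext fun s => by
      apply B.α.injective
      simp [← C.projLeft_α]
  rw [e, ← LinearMap.lTensor_comp_map, LinearMap.comp_apply]
  refine (congrArg _ (projRight_projLeft_swapMiddle (φ := φ) m (B.comul f) (H.comul h))).trans ?_
  rw [B.counit_comul, H.comul_counit, ← LinearMap.lTensor_comp_apply]
  congr 2
  refine LinearMap.ext fun f => ?_
  rw [LinearMap.comp_apply, symm_eq_zpow, LinearEquiv.coe_coe, LinearEquiv.coe_coe,
    zpow_zpow_apply, neg_add_eq_sub]
  rfl

/-- The isomorphism `(x ⊗ f) ⊗ h ↦ α⁻¹(x) ⊗ (α^m(f) ⊗ h)` from the composite of the comonads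
`_ ⊗ B` and `_ ⊗ H` to the comonad `_ ⊗ (B ⊗ H)`. -/
def regroupLin (B : HomSpace k W) (V : Type u) [AddCommGroup V] [Module k V] (m : ℤ) {M : Type u}
    [AddCommGroup M] [Module k M] (α : M ≃ₗ[k] M) : (M ⊗[k] W) ⊗[k] V →ₗ[k] M ⊗[k] (W ⊗[k] V) :=
  TensorProduct.map α.symm.toLinearMap ((B.α ^ m).toLinearMap.rTensor V) ∘ₗ
    (TensorProduct.assoc k M W V).toLinearMap

theorem regroupLin_tmul (B : HomSpace k W) (V : Type u) [AddCommGroup V] [Module k V] (m : ℤ)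
    {M : Type u} [AddCommGroup M] [Module k M] (α : M ≃ₗ[k] M) (x : M) (f : W) (h : V) :
    regroupLin B V m α ((x ⊗ₜ f) ⊗ₜ h) = α.symm x ⊗ₜ ((B.α ^ m) f ⊗ₜ h) := rfl

variable {i j n : ℤ}

/-- `regroupLin` as a morphism of the category of pairs. -/
def regroup (m : ℤ) (X : HomVec k i j) :
    (H.comonad i j).obj ((B.comonad i j).obj X) ⟶ (C.bialgebra.comonad i j).obj X where
  toLin := regroupLin B.toHomSpace V m X.α
  comm z := LinearMap.congr_fun
    (f := regroupLin B.toHomSpace V m X.α ∘ₗ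
      (TensorProduct.congr (TensorProduct.congr X.α B.α) H.α).toLinearMap)
    (g := (TensorProduct.congr X.α (TensorProduct.congr B.α H.α)).toLinearMap ∘ₗ
      regroupLin B.toHomSpace V m X.α)
    (TensorProduct.ext_threefold fun x f h => by
      simp [regroupLin_tmul, zpow_apply_one, apply_zpow]) z

theorem regroup_natural (m : ℤ) {X Y : HomVec k i j} (f : X ⟶ Y) :
    (H.comonad i j).map ((B.comonad i j).map f) ≫ C.regroup m Y =
      C.regroup m X ≫ (C.bialgebra.comonad i j).map f :=
  hom_ext (TensorProduct.ext_threefold fun x b h => by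
    change Y.α.symm (Hom.toLin f x) ⊗ₜ[k] ((B.α ^ m) b ⊗ₜ[k] h) =
      Hom.toLin f (X.α.symm x) ⊗ₜ[k] ((B.α ^ m) b ⊗ₜ[k] h)
    congr 1
    rw [LinearEquiv.symm_apply_eq, ← f.comm, LinearEquiv.apply_symm_apply])

theorem regroup_counit (m : ℤ) (X : HomVec k i j) :
    C.regroup m X ≫ (C.bialgebra.comonad i j).ε.app X =
      (H.comonad i j).map ((B.comonad i j).ε.app X) ≫ (H.comonad i j).ε.app X :=
  hom_ext (TensorProduct.ext_threefold fun x b h => by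
    change TensorProduct.rid k X.carrier (X.α.symm (X.α.symm x) ⊗ₜ[k]
        (B.counit ((B.α ^ m) b) * H.counit h)) =
      TensorProduct.rid k X.carrier (X.α.symm (TensorProduct.rid k X.carrier
        (X.α.symm x ⊗ₜ B.counit b)) ⊗ₜ H.counit h)
    rw [B.zpow_counit]
    simp [smul_smul, mul_comm])

/-- `regroup (-n - 2)` intertwines the comultiplication of the composite comonad, formed with
`φ̈(n)`, and that of the cosmash product. About the exponent: `φ̈(n)` applies `φ` after
`α^{-n-1}`, and one more `α⁻¹` comes from the comultiplication of the comonad `_ ⊗ B`. -/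
theorem regroup_comul (X : HomVec k i j) :
    C.regroup (-n - 2) X ≫ (C.bialgebra.comonad i j).δ.app X =
      ((H.comonad i j).map ((B.comonad i j).δ.app X) ≫
        (H.comonad i j).δ.app ((B.comonad i j).obj ((B.comonad i j).obj X)) ≫
        (H.comonad i j).map ((C.distLaw i j n).φ.app ((B.comonad i j).obj X))) ≫
      (H.comonad i j).map ((B.comonad i j).map (C.regroup (-n - 2) X)) ≫
        C.regroup (-n - 2) ((C.bialgebra.comonad i j).obj X) :=
  hom_ext (TensorProduct.ext_threefold fun x b h => by
    change (TensorProduct.assoc k X.carrier (W ⊗[k] V) (W ⊗[k] V)).symm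
        (X.α (X.α.symm x) ⊗ₜ LinearMap.lTensor (W ⊗[k] V)
          (TensorProduct.congr B.α H.α).symm.toLinearMap
          (swapMiddle φ (B.comul ((B.α ^ (-n - 2)) b) ⊗ₜ H.comul h))) =
      regroupLin B.toHomSpace V (-n - 2) (TensorProduct.congr X.α (TensorProduct.congr B.α H.α))
        (LinearMap.rTensor V (LinearMap.rTensor W (regroupLin B.toHomSpace V (-n - 2) X.α))
          (LinearMap.rTensor V (phiLin B.toHomSpace H.toHomSpace φ n (X.carrier ⊗[k] W))
          ((TensorProduct.assoc k ((X.carrier ⊗[k] W) ⊗[k] W) V V).symm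
            ((TensorProduct.congr (TensorProduct.congr X.α B.α) B.α
              ((TensorProduct.assoc k X.carrier W W).symm
                (X.α x ⊗ₜ LinearMap.lTensor W B.α.symm.toLinearMap (B.comul b)))) ⊗ₜ
            LinearMap.lTensor V H.α.symm.toLinearMap (H.comul h)))))
    rw [B.zpow_comul, LinearEquiv.apply_symm_apply]
    induction B.comul b using TensorProduct.induction_on with
    | zero => simp
    | add y z hy hz => simp only [map_add, TensorProduct.tmul_add, TensorProduct.add_tmul, hy, hz]
    | tmul f g =>
    induction H.comul h using TensorProduct.induction_on with
    | zero => simp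
    | add y z hy hz => simp only [map_add, TensorProduct.tmul_add, hy, hz]
    | tmul h l =>
      have e : φ ((B.α ^ (-n - 2)) g ⊗ₜ h) =
          TensorProduct.map (H.α ^ (-1 : ℤ)).toLinearMap (B.α ^ (-1 : ℤ)).toLinearMap
            (φ ((B.α ^ (-n - 1)) g ⊗ₜ H.α h)) := by
        rw [← C.zpow_equivariant, zpow_zpow_apply, zpow_apply_one, neg_add_cancel,
          zpow_zero_apply, show -1 + (-n - 1) = -n - 2 by ring]
      simp only [TensorProduct.map_tmul, LinearMap.lTensor_tmul, LinearEquiv.coe_coe,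
        TensorProduct.assoc_symm_tmul, TensorProduct.congr_tmul, LinearEquiv.apply_symm_apply,
        LinearMap.rTensor_tmul, swapMiddle_tmul, phiLin_tmul, phiCoeff_tmul, e]
      induction φ ((B.α ^ (-n - 1)) g ⊗ₜ H.α h) using TensorProduct.induction_on with
      | zero => simp
      | add y z hy hz => simp only [map_add, TensorProduct.tmul_add, TensorProduct.add_tmul, hy, hz]
      | tmul h' g =>
        simp only [TensorProduct.map_tmul, LinearMap.lTensor_tmul, LinearEquiv.coe_coe,
          TensorProduct.assoc_symm_tmul, LinearMap.rTensor_tmul, LinearMap.flip_apply,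
          TensorProduct.mk_apply, regroupLin_tmul, TensorProduct.congr_symm_tmul,
          LinearEquiv.symm_apply_apply]
        simp only [symm_eq_zpow B.α, symm_eq_zpow H.α, zpow_zpow_apply, zpow_apply_one]
        simp only [show -1 + (-n - 2 + 1) = -n - 2 by ring, show -n - 2 + n = -2 by ring]
        rfl)

end Cosmash

end corepresentations

/-! ### Bicomodules and comodules over the cosmash product -/

section corep_iso

open HomVec

variable {k : Type u} [Field k] {V W : Type u} [AddCommGroup V] [Module k V]
  [AddCommGroup W] [Module k W] [FiniteDimensional k V] [FiniteDimensional k W]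

namespace HomComodule

variable {S : HomCoalgebra k V} {i j : ℤ}

/-- A coalgebra of the comonad `_ ⊗ S`, as a Hom-comodule. -/
def ofCoalgebra {X : HomVec k i j} (a : X ⟶ (S.comonad i j).obj X)
    (h1 : a ≫ (S.comonad i j).ε.app X = 𝟙 X)
    (h2 : a ≫ (S.comonad i j).δ.app X = a ≫ (S.comonad i j).map a) : HomComodule S i j where
  obj := X
  coact := HomVec.Hom.toLin a
  coassoc := (of_coalgebra a h1 h2 _ rfl).1
  counit := (of_coalgebra a h1 h2 _ rfl).2

/-- Two comodules with the same underlying pair are equal if their coactions are. -/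
theorem eq_of_coact {M N : HomComodule S i j} (X : HomVec k i j)
    (a b : X.carrier →ₗ[k] X.carrier ⊗[k] V) (hM hM' hN hN') (h : a = b)
    (eM : M = ⟨X, a, hM, hM'⟩) (eN : N = ⟨X, b, hN, hN'⟩) : M = N := by
  subst h
  rw [eM, eN]

variable (S i j) in
/-- The forgetful functor from Hom-comodules to pairs. -/
def forget : HomComodule S i j ⥤ HomVec k i j where
  obj M := M.obj
  map f := Hom.toHom f

instance : (forget S i j).Faithful where
  map_injective h := Hom.ext (congrArg HomVec.Hom.toLin h)

end HomComodule

namespace Cosmash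

variable {B : HomBialgebra k W} {H : HomBialgebra k V} {φ : W ⊗[k] V →ₗ[k] V ⊗[k] W}
  (C : Cosmash B H φ) {i j n : ℤ}

/-- `regroup` preserves the units of the two lax monoidal structures. -/
theorem regroup_unit (m : ℤ) :
    (Functor.LaxMonoidal.ε (H.bicomonad i j).toFunctor ≫
      (H.bicomonad i j).map (Functor.LaxMonoidal.ε (B.bicomonad i j).toFunctor)) ≫
        C.regroup m (𝟙_ (HomVec k i j)) =
      Functor.LaxMonoidal.ε (C.bialgebra.bicomonad i j).toFunctor :=
  hom_ext (LinearMap.ext fun c => by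
    change (LinearEquiv.refl k k).symm c ⊗ₜ[k] ((B.α ^ m) B.one ⊗ₜ[k] H.one) =
      c ⊗ₜ[k] (B.one ⊗ₜ[k] H.one)
    rw [B.zpow_one]
    rfl)

/-- `regroup` preserves the tensor products of the two lax monoidal structures. -/
theorem regroup_tensor (m : ℤ) (X Y : HomVec k i j) :
    (C.regroup m X ⊗ₘ C.regroup m Y) ≫
        Functor.LaxMonoidal.μ (C.bialgebra.bicomonad i j).toFunctor X Y =
      (Functor.LaxMonoidal.μ (H.bicomonad i j).toFunctor ((B.comonad i j).obj X)
          ((B.comonad i j).obj Y) ≫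
        (H.bicomonad i j).map (Functor.LaxMonoidal.μ (B.bicomonad i j).toFunctor X Y)) ≫
        C.regroup m (X ⊗ Y) :=
  hom_ext (tensor_ext₆ fun x f h y g l => by
    change C.bialgebra.muLin i j X.carrier Y.carrier
      ((X.α.symm x ⊗ₜ[k] ((B.α ^ m) f ⊗ₜ[k] h)) ⊗ₜ[k] (Y.α.symm y ⊗ₜ[k] ((B.α ^ m) g ⊗ₜ[k] l))) =
      (X.α.symm x ⊗ₜ[k] Y.α.symm y) ⊗ₜ[k] ((B.α ^ m) (B.mul ((B.α ^ i) f ⊗ₜ (B.α ^ j) g)) ⊗ₜ[k]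
        H.mul ((H.α ^ i) h ⊗ₜ (H.α ^ j) l))
    rw [HomAlgebra.muLin_tmul]
    change _ ⊗ₜ[k] C.bialgebra.mul ((TensorProduct.congr B.α H.α ^ i) _ ⊗ₜ
      (TensorProduct.congr B.α H.α ^ j) _) = _
    rw [congr_zpow_tmul, congr_zpow_tmul, B.zpow_mul]
    simp only [zpow_zpow_apply, add_comm m]
    rfl)

/-- The coaction `Bicomodule.total`, with values in the composite of the underlying comonads. -/
def totalHom (M : Bicomodule (C.distLaw i j n).φ) :
    M.obj ⟶ (H.comonad i j).obj ((B.comonad i j).obj M.obj) := M.total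

theorem totalHom_counit (M : Bicomodule (C.distLaw i j n).φ) :
    C.totalHom M ≫ (H.comonad i j).map ((B.comonad i j).ε.app M.obj) ≫
      (H.comonad i j).ε.app M.obj = 𝟙 M.obj :=
  (Category.assoc _ _ _).symm.trans
    ((congrArg (· ≫ (H.bicomonad i j).ε.app M.obj) M.total_counit_right).trans M.θ_counit)

theorem totalHom_coassoc (M : Bicomodule (C.distLaw i j n).φ) :
    C.totalHom M ≫ (H.comonad i j).map ((B.comonad i j).δ.app M.obj) ≫
        (H.comonad i j).δ.app ((B.comonad i j).obj ((B.comonad i j).obj M.obj)) ≫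
        (H.comonad i j).map ((C.distLaw i j n).φ.app ((B.comonad i j).obj M.obj)) =
      C.totalHom M ≫ (H.comonad i j).map ((B.comonad i j).map (C.totalHom M)) :=
  M.total_coassoc

theorem totalHom_natural {M N : Bicomodule (C.distLaw i j n).φ} (f : M ⟶ N) :
    C.totalHom M ≫ (H.comonad i j).map ((B.comonad i j).map f.hom) = f.hom ≫ C.totalHom N :=
  Bicomodule.total_natural f

/-- The comodule over the cosmash product with coaction
`u ↦ α⁻¹(u₀₀) ⊗ (α^{-n-2}(u₀₁) ⊗ u₁)`, where `θ(u) = u₀ ⊗ u₁` and `ρ(u₀) = u₀₀ ⊗ u₀₁`. -/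
def toCorep (M : Bicomodule (C.distLaw i j n).φ) :
    HomComodule C.bialgebra.toHomCoalgebra i j :=
  HomComodule.ofCoalgebra (C.totalHom M ≫ C.regroup (-n - 2) M.obj) (by
    rw [Category.assoc, C.regroup_counit, totalHom_counit]) (by
    let t := (H.comonad i j).map ((B.comonad i j).map (C.regroup (-n - 2) M.obj)) ≫
      C.regroup (-n - 2) ((C.bialgebra.comonad i j).obj M.obj)
    have e : (C.totalHom M ≫ (H.comonad i j).map ((B.comonad i j).map (C.totalHom M))) ≫ t =
        (C.totalHom M ≫ C.regroup (-n - 2) M.obj) ≫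
          (C.bialgebra.comonad i j).map (C.totalHom M ≫ C.regroup (-n - 2) M.obj) := by
      have e' := C.regroup_natural (-n - 2) (C.totalHom M)
      rw [Functor.map_comp, Category.assoc, Category.assoc, ← reassoc_of% e']
      rw [← C.regroup_natural]
    refine Eq.trans ?_ e
    refine Eq.trans ?_ (congrArg (· ≫ t) (C.totalHom_coassoc M))
    refine (Category.assoc _ _ _).trans ?_
    exact (congrArg (C.totalHom M ≫ ·) (C.regroup_comul M.obj)).trans
      (Category.assoc _ _ _).symm)

theorem toCorep_colinear {M N : Bicomodule (C.distLaw i j n).φ} (f : M ⟶ N) :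
    (C.totalHom M ≫ C.regroup (-n - 2) M.obj) ≫ (C.bialgebra.comonad i j).map f.hom =
      f.hom ≫ C.totalHom N ≫ C.regroup (-n - 2) N.obj := by
  rw [Category.assoc, ← C.regroup_natural, ← Category.assoc, totalHom_natural, Category.assoc]

variable (i j n) in
/-- From bicomodules to comodules over the cosmash product. -/
def corepFunctor : Bicomodule (C.distLaw i j n).φ ⥤ HomComodule C.bialgebra.toHomCoalgebra i j where
  obj := C.toCorep
  map f := ⟨Hom.toLin f.hom, fun u =>
    (LinearMap.congr_fun (congrArg Hom.toLin (C.toCorep_colinear f)) u).symm⟩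

/-- The bicomodule of a comodule over the cosmash product, obtained by corestriction along
`f ⊗ h ↦ ε(f) h` and `f ⊗ h ↦ ε(h) α^{n+1}(f)`. -/
def ofCorep (n : ℤ) (N : HomComodule C.bialgebra.toHomCoalgebra i j) :
    Bicomodule (C.distLaw i j n).φ where
  obj := N.obj
  θ := (N.push (T := H.toHomCoalgebra) (projRight B.toHomCoalgebra V) C.projRight_α
    C.projRight_comul C.projRight_counit).hom
  θ_counit := HomComodule.hom_counit _
  θ_coassoc := HomComodule.hom_coassoc _
  ρ := (N.push (T := B.toHomCoalgebra) (projLeft B.toHomCoalgebra H.toHomCoalgebra (n + 1))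
    (C.projLeft_α (n + 1)) (C.projLeft_comul (n + 1)) (C.projLeft_counit (n + 1))).hom
  ρ_counit := HomComodule.hom_counit _
  ρ_coassoc := HomComodule.hom_coassoc _
  compat := hom_ext (LinearMap.ext fun u => by
    change phiLin B.toHomSpace H.toHomSpace φ n N.obj.carrier
      (LinearMap.rTensor V (LinearMap.lTensor N.obj.carrier
        (projLeft B.toHomCoalgebra H.toHomCoalgebra (n + 1)) ∘ₗ N.coact)
        (LinearMap.lTensor N.obj.carrier (projRight B.toHomCoalgebra V) (N.coact u))) =
      LinearMap.rTensor W (LinearMap.lTensor N.obj.carrier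
        (projRight B.toHomCoalgebra V) ∘ₗ N.coact)
        (LinearMap.lTensor N.obj.carrier
          (projLeft B.toHomCoalgebra H.toHomCoalgebra (n + 1)) (N.coact u))
    rw [N.rTensor_coact_map, N.rTensor_coact_map]
    induction N.coact u using TensorProduct.induction_on with
    | zero => simp only [map_zero]
    | add x y hx hy => simp only [map_add, hx, hy]
    | tmul x s =>
      simp only [TensorProduct.map_tmul, LinearMap.comp_apply, LinearEquiv.coe_coe]
      induction s using TensorProduct.induction_on with
      | zero => simp only [map_zero, TensorProduct.tmul_zero]
      | add x y hx hy => simp only [map_add, TensorProduct.tmul_add, hx, hy]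
      | tmul f h =>
        rw [C.projLeft_projRight_comul, C.projRight_projLeft_comul, LinearMap.rTensor_tmul,
          TensorProduct.assoc_symm_tmul, phiLin_tmul, phiCoeff_tmul, LinearEquiv.coe_coe,
          zpow_zpow_apply, show -n - 1 + (n + 1 + 1) = 1 by ring, add_sub_cancel_right, _root_.zpow_one]
        induction φ (B.α f ⊗ₜ H.α h) using TensorProduct.induction_on with
        | zero => simp
        | add x y hx hy => simp only [map_add, TensorProduct.tmul_add, hx, hy]
        | tmul a b => rfl)

/-- A colinear map is colinear for every corestriction of the coactions. -/
theorem lTensor_coact_colinear {M N : HomComodule C.bialgebra.toHomCoalgebra i j} (f : M ⟶ N)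
    {P : Type u} [AddCommGroup P] [Module k P] (p : W ⊗[k] V →ₗ[k] P) (u : M.obj.carrier) :
    LinearMap.rTensor P (HomComodule.Hom.toLin f) (LinearMap.lTensor _ p (M.coact u)) =
      LinearMap.lTensor _ p (N.coact (HomComodule.Hom.toLin f u)) := by
  rw [f.comm_coact]
  induction M.coact u using TensorProduct.induction_on with
  | zero => simp only [map_zero]
  | add x y hx hy => simp only [map_add, hx, hy]
  | tmul x s => rfl

variable (i j n) in
/-- From comodules over the cosmash product to bicomodules. -/
def bicomoduleFunctor :
    HomComodule C.bialgebra.toHomCoalgebra i j ⥤ Bicomodule (C.distLaw i j n).φ where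
  obj := C.ofCorep n
  map {M N} f :=
    { hom := HomComodule.Hom.toHom f
      comm_θ := hom_ext (LinearMap.ext (C.lTensor_coact_colinear f _))
      comm_ρ := hom_ext (LinearMap.ext (C.lTensor_coact_colinear f _)) }

variable (n) in
/-- The coaction of a comodule over the cosmash product is recovered from its corestrictions to the
two factors. -/
theorem regroup_coact (N : HomComodule C.bialgebra.toHomCoalgebra i j) (u : N.obj.carrier) :
    regroupLin B.toHomSpace V (-n - 2) N.obj.α
      (LinearMap.rTensor V (LinearMap.lTensor N.obj.carrier
        (projLeft B.toHomCoalgebra H.toHomCoalgebra (n + 1)) ∘ₗ N.coact)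
        (LinearMap.lTensor N.obj.carrier (projRight B.toHomCoalgebra V) (N.coact u))) =
      N.coact u := by
  rw [N.rTensor_coact_map]
  induction N.coact u using TensorProduct.induction_on with
  | zero => simp only [map_zero]
  | add x y hx hy => simp only [map_add, hx, hy]
  | tmul x s =>
    rw [TensorProduct.map_tmul, LinearMap.comp_apply, C.projLeft_projRight_comul]
    induction s using TensorProduct.induction_on with
    | zero => simp only [map_zero, TensorProduct.tmul_zero]
    | add x y hx hy => simp only [map_add, TensorProduct.tmul_add, hx, hy]
    | tmul f h =>
      rw [LinearMap.rTensor_tmul, TensorProduct.assoc_symm_tmul, regroupLin_tmul,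
        LinearEquiv.coe_coe, LinearEquiv.coe_coe, LinearEquiv.symm_apply_apply,
        zpow_zpow_apply, show -n - 2 + (n + 1 + 1) = 0 by ring, zpow_zero_apply]

theorem toCorep_ofCorep (N : HomComodule C.bialgebra.toHomCoalgebra i j) :
    C.toCorep (C.ofCorep n N) = N := by
  have h : (C.toCorep (C.ofCorep n N)).coact = N.coact := LinearMap.ext (C.regroup_coact n N)
  cases N
  exact HomComodule.eq_of_coact _ _ _ _ _ _ _ h rfl rfl

/-- Corestricting the composite coaction along `projRight` applies the counit of `_ ⊗ B`. -/
theorem regroup_projRight (m : ℤ) (X : HomVec k i j)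
    (z : ((H.comonad i j).obj ((B.comonad i j).obj X)).carrier) :
    LinearMap.lTensor X.carrier (projRight B.toHomCoalgebra V)
      (Hom.toLin (C.regroup m X) z) = Hom.toLin ((H.comonad i j).map ((B.comonad i j).ε.app X)) z :=
  LinearMap.congr_fun
    (f := LinearMap.lTensor X.carrier (projRight B.toHomCoalgebra V) ∘ₗ
      regroupLin B.toHomSpace V m X.α)
    (g := LinearMap.rTensor V ((TensorProduct.rid k X.carrier).toLinearMap ∘ₗ
      TensorProduct.map X.α.symm.toLinearMap B.counit))
    (TensorProduct.ext_threefold fun x f h => by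
      simp [regroupLin_tmul, projRight_tmul, B.zpow_counit, TensorProduct.smul_tmul']) z

/-- Corestricting the composite coaction along `projLeft` applies the counit of `_ ⊗ H`: the exponents
add up to `(n + 1) + (-n - 2) = -1`, the twist in that counit. -/
theorem regroup_projLeft (X : HomVec k i j)
    (z : ((H.comonad i j).obj ((B.comonad i j).obj X)).carrier) :
    LinearMap.lTensor X.carrier (projLeft B.toHomCoalgebra H.toHomCoalgebra (n + 1))
      (Hom.toLin (C.regroup (-n - 2) X) z) =
      Hom.toLin ((H.comonad i j).ε.app ((B.comonad i j).obj X)) z :=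
  LinearMap.congr_fun
    (f := LinearMap.lTensor X.carrier (projLeft B.toHomCoalgebra H.toHomCoalgebra (n + 1)) ∘ₗ
      regroupLin B.toHomSpace V (-n - 2) X.α)
    (g := (TensorProduct.rid k (X.carrier ⊗[k] W)).toLinearMap ∘ₗ
      TensorProduct.map (TensorProduct.congr X.α B.α).symm.toLinearMap H.counit)
    (TensorProduct.ext_threefold fun x f h => by
      simp only [LinearMap.comp_apply, regroupLin_tmul, LinearMap.lTensor_tmul, projLeft_tmul,
        TensorProduct.map_tmul, LinearEquiv.coe_coe, TensorProduct.rid_tmul,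
        TensorProduct.congr_symm_tmul, zpow_zpow_apply, show n + 1 + (-n - 2) = -1 by ring,
        symm_eq_zpow B.α, TensorProduct.tmul_smul]) z

theorem ofCorep_toCorep (M : Bicomodule (C.distLaw i j n).φ) :
    C.ofCorep n (C.toCorep M) = M := by
  have h1 : (C.ofCorep n (C.toCorep M)).θ = M.θ := hom_ext (LinearMap.ext fun u =>
    (C.regroup_projRight (-n - 2) M.obj _).trans
      (LinearMap.congr_fun (congrArg Hom.toLin M.total_counit_right) u))
  have h2 : (C.ofCorep n (C.toCorep M)).ρ = M.ρ := hom_ext (LinearMap.ext fun u =>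
    (C.regroup_projLeft M.obj _).trans
      (LinearMap.congr_fun (congrArg Hom.toLin M.total_counit_left) u))
  cases M
  exact Bicomodule.mk.injEq .. |>.mpr ⟨rfl, heq_of_eq h1, heq_of_eq h2⟩

end Cosmash

end corep_iso

/-! ### Tensor products of bicomodules and comodules -/

section composite_tensor

universe v w

variable {C : Type w} [Category.{v} C] [MonoidalCategory C] {F G : Bicomonad C}
  {L : MonoidalDistLaw F G}

open Functor.LaxMonoidal in
theorem Bicomodule.total_tensor (M N : Bicomodule L.φ) :
    (M ⊗ N).total = (M.total ⊗ₘ N.total) ≫ μ F.toFunctor (G.obj M.obj) (G.obj N.obj) ≫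
      F.map (μ G.toFunctor M.obj N.obj) := by
  change ((M.θ ⊗ₘ N.θ) ≫ μ F.toFunctor M.obj N.obj) ≫
    F.map ((M.ρ ⊗ₘ N.ρ) ≫ μ G.toFunctor M.obj N.obj) = _
  rw [total, total, ← MonoidalCategory.tensorHom_comp_tensorHom, Functor.map_comp]
  simp only [Category.assoc]
  rw [← μ_natural_assoc]

end composite_tensor

section corep_monoidal

open HomVec

variable {k : Type u} [Field k] {V W : Type u} [AddCommGroup V] [Module k V]
  [AddCommGroup W] [Module k W] [FiniteDimensional k V] [FiniteDimensional k W]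

namespace Cosmash

variable {B : HomBialgebra k W} {H : HomBialgebra k V} {φ : W ⊗[k] V →ₗ[k] V ⊗[k] W}
  (C : Cosmash B H φ) {i j n : ℤ}

/-- The functor to comodules over the cosmash product preserves the unit object. -/
theorem toCorep_unit (c : k) : (𝟙_ (HomComodule C.bialgebra.toHomCoalgebra i j)).coact c =
    (C.toCorep (𝟙_ (Bicomodule (C.distLaw i j n).φ))).coact c :=
  (LinearMap.congr_fun (congrArg HomVec.Hom.toLin
    (C.regroup_unit (i := i) (j := j) (-n - 2))) c).symm

/-- The functor to comodules over the cosmash product preserves tensor products. -/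
theorem toCorep_tensor (M N : Bicomodule (C.distLaw i j n).φ)
    (z : M.obj.carrier ⊗[k] N.obj.carrier) :
    (C.toCorep (M ⊗ N)).coact z = (C.toCorep M ⊗ C.toCorep N).coact z := by
  let X : HomVec k i j := (H.comonad i j).obj ((B.comonad i j).obj M.obj)
  let Y : HomVec k i j := (H.comonad i j).obj ((B.comonad i j).obj N.obj)
  let μ' : X ⊗ Y ⟶ (H.comonad i j).obj ((B.comonad i j).obj (M.obj ⊗ N.obj)) :=
    Functor.LaxMonoidal.μ (H.bicomonad i j).toFunctor ((B.comonad i j).obj M.obj)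
      ((B.comonad i j).obj N.obj) ≫
      (H.bicomonad i j).map (Functor.LaxMonoidal.μ (B.bicomonad i j).toFunctor M.obj N.obj)
  have h1 : C.totalHom (M ⊗ N) = (C.totalHom M ⊗ₘ C.totalHom N) ≫ μ' :=
    Bicomodule.total_tensor M N
  let μS : (C.bialgebra.comonad i j).obj M.obj ⊗ (C.bialgebra.comonad i j).obj N.obj ⟶
      (C.bialgebra.comonad i j).obj (M.obj ⊗ N.obj) :=
    Functor.LaxMonoidal.μ (C.bialgebra.bicomonad i j).toFunctor M.obj N.obj
  have h2 : (C.regroup (-n - 2) M.obj ⊗ₘ C.regroup (-n - 2) N.obj) ≫ μS =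
      μ' ≫ C.regroup (-n - 2) (M.obj ⊗ N.obj) := C.regroup_tensor (-n - 2) M.obj N.obj
  have h3 : C.totalHom (M ⊗ N) ≫ C.regroup (-n - 2) (M.obj ⊗ N.obj) =
      ((C.totalHom M ≫ C.regroup (-n - 2) M.obj) ⊗ₘ
        (C.totalHom N ≫ C.regroup (-n - 2) N.obj)) ≫ μS := by
    rw [← MonoidalCategory.tensorHom_comp_tensorHom, Category.assoc, h2, ← Category.assoc, ← h1]
    rfl
  exact LinearMap.congr_fun (congrArg HomVec.Hom.toLin h3) z

variable (i j n) in
/-- The functor `corepFunctor` is strictly monoidal. -/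
def corepFunctorMonoidal : (C.corepFunctor i j n).CoreMonoidal where
  εIso := HomComodule.mkIso (Iso.refl (𝟙_ (HomVec k i j))) fun c =>
    (C.toCorep_unit c).symm.trans (LinearMap.congr_fun (LinearMap.rTensor_id _ _) _).symm
  μIso M N := HomComodule.mkIso (Iso.refl (M.obj ⊗ N.obj)) fun z =>
    (C.toCorep_tensor M N z).trans (LinearMap.congr_fun (LinearMap.rTensor_id _ _) _).symm
  μIso_hom_natural_left {M N} f P := (HomComodule.forget _ i j).map_injective
    (show f.hom ▷ P.obj ≫ 𝟙 (N.obj ⊗ P.obj) = 𝟙 (M.obj ⊗ P.obj) ≫ f.hom ▷ P.obj by simp)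
  μIso_hom_natural_right {M N} P f := (HomComodule.forget _ i j).map_injective
    (show P.obj ◁ f.hom ≫ 𝟙 (P.obj ⊗ N.obj) = 𝟙 (P.obj ⊗ M.obj) ≫ P.obj ◁ f.hom by simp)
  associativity M N P := (HomComodule.forget _ i j).map_injective
    (show 𝟙 (M.obj ⊗ N.obj) ▷ P.obj ≫ 𝟙 ((M.obj ⊗ N.obj) ⊗ P.obj) ≫
        (α_ M.obj N.obj P.obj).hom =
      (α_ M.obj N.obj P.obj).hom ≫ M.obj ◁ 𝟙 (N.obj ⊗ P.obj) ≫
        𝟙 (M.obj ⊗ N.obj ⊗ P.obj) by simp)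
  left_unitality M := (HomComodule.forget _ i j).map_injective
    (show (λ_ M.obj).hom = 𝟙 (𝟙_ _) ▷ M.obj ≫ 𝟙 (𝟙_ _ ⊗ M.obj) ≫ (λ_ M.obj).hom by simp)
  right_unitality M := (HomComodule.forget _ i j).map_injective
    (show (ρ_ M.obj).hom = M.obj ◁ 𝟙 (𝟙_ _) ≫ 𝟙 (M.obj ⊗ 𝟙_ _) ≫ (ρ_ M.obj).hom by simp)

theorem monoidallyIsomorphic_corep :
    MonoidallyIsomorphic (Bicomodule (C.distLaw i j n).φ)
      (HomComodule C.bialgebra.toHomCoalgebra i j) :=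
  ⟨C.corepFunctor i j n, C.bicomoduleFunctor i j n,
    functor_eq_id (Bicomodule.forget _) _ rfl C.ofCorep_toCorep,
    functor_eq_id (HomComodule.forget _ i j) _ rfl C.toCorep_ofCorep,
    ⟨(C.corepFunctorMonoidal i j n).toMonoidal⟩⟩

end Cosmash

end corep_monoidal

/-! ### The cosmash product of a Hom-monoidal entwining datum -/

section induced

variable {k : Type u} [Field k] {V W : Type u} [AddCommGroup V] [Module k V]
  [FiniteDimensional k V] [AddCommGroup W] [Module k W] [FiniteDimensional k W]

open Module (Dual)

/-- Evaluation turns a map on the second factor into its transpose. -/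
theorem evalSnd_map {P : Type u} [AddCommGroup P] [Module k P] [FiniteDimensional k P]
    (p : V →ₗ[k] P) (q : Dual k W →ₗ[k] Dual k W) (a b : W) (h : ∀ f, q f a = f b)
    (z : V ⊗[k] Dual k W) :
    evalSnd a (TensorProduct.map p q z) = p (evalSnd b z) := by
  induction z using TensorProduct.induction_on with
  | zero => simp only [map_zero]
  | add x y hx hy => simp only [map_add, hx, hy]
  | tmul v f => rw [TensorProduct.map_tmul, evalSnd_tmul, evalSnd_tmul, map_smul, h]

theorem evalSnd_map_dualComul (A : HomAlgebra k W) {P : Type u} [AddCommGroup P] [Module k P]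
    [FiniteDimensional k P] (p : V →ₗ[k] P) (x y : W) (z : V ⊗[k] Dual k W) :
    evalSnd x (evalSnd y ((TensorProduct.assoc k P (Dual k W) (Dual k W)).symm
      (TensorProduct.map p A.dualComul z))) =
      p (evalSnd ((A.α ^ (-2 : ℤ)) (A.mul (y ⊗ₜ x))) z) := by
  induction z using TensorProduct.induction_on with
  | zero => simp only [map_zero]
  | add x y hx hy => simp only [map_add, hx, hy]
  | tmul v f =>
    obtain ⟨n, s, t, h⟩ := exists_rep (A.dualComul f)
    rw [evalSnd_tmul, ← A.dualComul_rep f h, TensorProduct.map_tmul, h]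
    simp only [TensorProduct.tmul_sum, map_sum, TensorProduct.assoc_symm_tmul, evalSnd_tmul,
      map_smul, smul_smul, Finset.sum_smul, mul_comm]

/-- `∑ f^ψ(x) g^φ(y) h^{φψ}`, one evaluation at a time. -/
theorem evalSnd_swapPair (φ : Dual k W ⊗[k] V →ₗ[k] V ⊗[k] Dual k W) (f g : Dual k W) (h : V)
    (x y : W) :
    evalSnd x (evalSnd y ((TensorProduct.assoc k V (Dual k W) (Dual k W)).symm
      (swapPair φ ((f ⊗ₜ g) ⊗ₜ h)))) = evalSnd x (φ (f ⊗ₜ evalSnd y (φ (g ⊗ₜ h)))) := by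
  simp only [swapPair, LinearMap.comp_apply, LinearEquiv.coe_coe, TensorProduct.assoc_tmul,
    LinearMap.lTensor_tmul, LinearEquiv.symm_apply_apply]
  induction φ (g ⊗ₜ h) using TensorProduct.induction_on with
  | zero => simp only [map_zero, TensorProduct.tmul_zero]
  | add x y hx hy => simp only [map_add, TensorProduct.tmul_add, hx, hy]
  | tmul v g => simp only [TensorProduct.assoc_symm_tmul, LinearMap.rTensor_tmul, evalSnd_tmul,
      map_smul, TensorProduct.tmul_smul]

/-- For the map induced by `Φ`: `∑ f^{φψ}(a) h^φ ⊗ l^ψ = ∑ f(a_{ΨΦ}) h^Φ ⊗ l^Ψ`. -/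
theorem evalSnd_pairSwap (Φ : V ⊗[k] W →ₗ[k] W ⊗[k] V) (f : Dual k W) (h l : V) (a : W) :
    evalSnd a (pairSwap (inducedPhi Φ) (f ⊗ₜ (h ⊗ₜ l))) =
      TensorProduct.lid k (V ⊗[k] V) (f.rTensor (V ⊗[k] V) (TensorProduct.assoc k W V V
        (Φ.rTensor V ((TensorProduct.assoc k V W V).symm (h ⊗ₜ Φ (l ⊗ₜ a)))))) := by
  obtain ⟨n, p, q, hp⟩ := exists_rep (Φ (l ⊗ₜ a))
  have e : ∀ z : V ⊗[k] Dual k W, evalSnd a ((TensorProduct.assoc k V V (Dual k W)).symm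
      ((inducedPhi Φ).lTensor V (TensorProduct.assoc k V (Dual k W) V (z ⊗ₜ l)))) =
      ∑ r, evalSnd (p r) z ⊗ₜ q r := fun z => by
    induction z using TensorProduct.induction_on with
    | zero => simp
    | add x y hx hy =>
      simp only [map_add, TensorProduct.add_tmul, hx, hy, Finset.sum_add_distrib]
    | tmul v g =>
      have e1 : ∀ t : V ⊗[k] Dual k W, evalSnd a ((TensorProduct.assoc k V V (Dual k W)).symm
          (v ⊗ₜ t)) = v ⊗ₜ evalSnd a t := fun t => by
        induction t using TensorProduct.induction_on with
        | zero => simp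
        | add x y hx hy => simp only [map_add, TensorProduct.tmul_add, hx, hy]
        | tmul w g => simp [evalSnd_tmul]
      rw [TensorProduct.assoc_tmul, LinearMap.lTensor_tmul, e1, evalSnd_inducedPhi, hp]
      simp [evalSnd_tmul, TensorProduct.tmul_sum, TensorProduct.smul_tmul']
  refine (e (inducedPhi Φ (f ⊗ₜ h))).trans ?_
  rw [hp]
  simp only [TensorProduct.tmul_sum, map_sum, TensorProduct.assoc_symm_tmul,
    LinearMap.rTensor_tmul, evalSnd_inducedPhi]
  refine Finset.sum_congr rfl fun r _ => ?_
  induction Φ (h ⊗ₜ p r) using TensorProduct.induction_on with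
  | zero => simp
  | add x y hx hy => simp only [map_add, TensorProduct.add_tmul, hx, hy]
  | tmul x y => simp [TensorProduct.smul_tmul']

/-- Evaluation of a product in `V ⊗ A^{*cop}`: `(f * g)(a) = ∑ f(α⁻²(a₁)) g(α⁻²(a₂))`. -/
theorem evalSnd_mul (A : HomBialgebra k W) (m : V ⊗[k] V →ₗ[k] V) (a : W) {n : ℕ}
    {p q : Fin n → W} (h : A.comul a = ∑ r, p r ⊗ₜ[k] q r) (s t : V ⊗[k] Dual k W) :
    evalSnd a (TensorProduct.map m A.dualCop.mul
      (TensorProduct.tensorTensorTensorComm k V (Dual k W) V (Dual k W) (s ⊗ₜ t))) =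
      ∑ r, m (evalSnd ((A.α ^ (-2 : ℤ)) (p r)) s ⊗ₜ evalSnd ((A.α ^ (-2 : ℤ)) (q r)) t) := by
  induction s using TensorProduct.induction_on with
  | zero => simp
  | add x y hx hy =>
    simp only [map_add, TensorProduct.add_tmul, hx, hy, Finset.sum_add_distrib]
  | tmul v f =>
    induction t using TensorProduct.induction_on with
    | zero => simp
    | add x y hx hy =>
      simp only [map_add, TensorProduct.tmul_add, hx, hy, Finset.sum_add_distrib]
    | tmul w g =>
      rw [TensorProduct.tensorTensorTensorComm_tmul, TensorProduct.map_tmul, evalSnd_tmul]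
      refine (congrArg (· • _) (A.dualMul_rep f g h)).trans ?_
      simp only [Finset.sum_smul, evalSnd_tmul, ← TensorProduct.smul_tmul',
        TensorProduct.tmul_smul, map_smul, smul_smul]
      simp only [mul_comm]

namespace EntwiningStructure

variable {H : HomCoalgebra k V} {A : HomAlgebra k W} (E : EntwiningStructure H A)

/-- Evaluated at `x ⊗ y`, this is `∑ f(α⁻²(yx)_Φ) α(h^Φ) = ∑ f(α⁻²(y_Φ x_Ψ)) α(h)^{ΦΨ}`, a consequence
of the multiplicativity of `Φ` in `A`. -/
theorem inducedPhi_comul_right (f : Dual k W) (h : V) :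
    TensorProduct.map H.α.toLinearMap A.dualCop.comul (inducedPhi E.Φ (f ⊗ₜ h)) =
      swapPair (inducedPhi E.Φ) (A.dualCop.comul f ⊗ₜ H.α h) := by
  apply (TensorProduct.assoc k V (Dual k W) (Dual k W)).symm.injective
  refine evalSnd_ext fun y => evalSnd_ext fun x => ?_
  refine (evalSnd_map_dualComul A _ x y _).trans ?_
  -- by equivariance, `(α⁻²(yx))_Φ ⊗ h^Φ = α⁻²((yx)_Φ) ⊗ α⁻²((α²h)^Φ)`
  have e := EntwinedModule.zpow_equivariant E (-2) (H.α (H.α h)) (A.mul (y ⊗ₜ x))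
  rw [zpow_apply_one, zpow_apply_one, show (-2 : ℤ) + 1 + 1 = 0 by norm_num, zpow_zero_apply,
    ← E.E1] at e
  rw [evalSnd_inducedPhi, e]
  obtain ⟨n, s, t, hf⟩ := exists_rep (A.dualComul f)
  obtain ⟨m, p, q, hp⟩ := exists_rep (E.Φ (H.α h ⊗ₜ y))
  choose l p' q' hp' using fun r => exists_rep (E.Φ (q r ⊗ₜ x))
  change _ = evalSnd x (evalSnd y ((TensorProduct.assoc k V (Dual k W) (Dual k W)).symm
    (swapPair (inducedPhi E.Φ) (A.dualComul f ⊗ₜ H.α h))))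
  simp only [hf, TensorProduct.sum_tmul, map_sum, evalSnd_swapPair, evalSnd_inducedPhi, hp,
    TensorProduct.assoc_tmul, LinearMap.lTensor_tmul, hp', TensorProduct.tmul_sum,
    TensorProduct.assoc_symm_tmul, TensorProduct.map_tmul, LinearMap.rTensor_tmul,
    TensorProduct.lid_tmul, map_smul, LinearEquiv.coe_coe, TensorProduct.tmul_smul,
    ← A.dualComul_rep f hf, apply_zpow, zpow_apply_one]
  rw [Finset.sum_comm]
  refine Finset.sum_congr rfl fun r _ => ?_
  rw [Finset.sum_comm]
  simp only [Finset.smul_sum, smul_smul, mul_comm (t _ _), show (-2 : ℤ) + 1 + 1 = 0 by norm_num,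
    zpow_zero_apply]

/-- Evaluated at `a`, this is the compatibility of `Φ` with the comultiplication of `H`. -/
theorem inducedPhi_comul_left (f : Dual k W) (h : V) :
    TensorProduct.map H.comul A.dualCop.α.toLinearMap (inducedPhi E.Φ (f ⊗ₜ h)) =
      pairSwap (inducedPhi E.Φ) (A.dualCop.α f ⊗ₜ H.comul h) := evalSnd_ext fun a => by
  rw [evalSnd_map _ _ a (A.α.symm a) fun f => rfl, evalSnd_inducedPhi]
  have e := congrArg ((TensorProduct.lid k (V ⊗[k] V)).toLinearMap ∘ₗ
    (A.dualCop.α f).rTensor (V ⊗[k] V)) (E.E2 h (A.α.symm a))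
  rw [LinearEquiv.apply_symm_apply] at e
  obtain ⟨n, s, t, hh⟩ := exists_rep (H.comul h)
  have e1 : ∀ z : W ⊗[k] V, ((TensorProduct.lid k (V ⊗[k] V)).toLinearMap ∘ₗ
      (A.dualCop.α f).rTensor (V ⊗[k] V)) (TensorProduct.map A.α.toLinearMap H.comul z) =
      H.comul (TensorProduct.lid k V (f.rTensor V z)) := fun z => by
    induction z using TensorProduct.induction_on with
    | zero => simp
    | add x y hx hy => simp only [map_add, hx, hy]
    | tmul x y =>
      change f (A.α.symm (A.α x)) • H.comul y = H.comul (f x • y)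
      rw [LinearEquiv.symm_apply_apply, map_smul]
  rw [← e1, ← e, hh]
  simp only [TensorProduct.sum_tmul, TensorProduct.tmul_sum, map_sum, evalSnd_pairSwap,
    TensorProduct.assoc_tmul, LinearMap.lTensor_tmul]
  rfl

theorem inducedPhi_counit_left (f : Dual k W) (h : V) :
    TensorProduct.lid k (Dual k W) (H.counit.rTensor (Dual k W) (inducedPhi E.Φ (f ⊗ₜ h))) =
      H.counit h • f := LinearMap.ext fun a => by
  have e : ∀ z : V ⊗[k] Dual k W, TensorProduct.lid k (Dual k W)
      (H.counit.rTensor (Dual k W) z) a = H.counit (evalSnd a z) := fun z => by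
    induction z using TensorProduct.induction_on with
    | zero => simp
    | add x y hx hy => simp only [map_add, LinearMap.add_apply, hx, hy]
    | tmul x y => simp [evalSnd_tmul, mul_comm]
  rw [e, evalSnd_inducedPhi, LinearMap.smul_apply, ← map_smul, ← E.E3]
  induction E.Φ (h ⊗ₜ a) using TensorProduct.induction_on with
  | zero => simp
  | add x y hx hy => simp only [map_add, hx, hy]
  | tmul x y => simp [mul_comm]

theorem inducedPhi_counit_right (f : Dual k W) (h : V) :
    TensorProduct.rid k V (A.dualCop.counit.lTensor V (inducedPhi E.Φ (f ⊗ₜ h))) =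
      A.dualCop.counit f • h := by
  refine (evalSnd_inducedPhi E.Φ f h A.one).trans ?_
  rw [E.E4]
  rfl

end EntwiningStructure

namespace MonoidalEntwiningDatum

variable {H : HomBialgebra k V} {A : HomBialgebra k W} (D : MonoidalEntwiningDatum H A)

theorem inducedPhi_one : inducedPhi D.Φ (A.dualCop.one ⊗ₜ H.one) = H.one ⊗ₜ A.dualCop.one :=
  evalSnd_ext fun a => by
    rw [evalSnd_inducedPhi, evalSnd_tmul]
    exact D.E6 a

/-- Evaluated at `a`, this is the compatibility of `Φ` with the comultiplication of `A` and the
multiplication of `H`. -/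
theorem inducedPhi_mul (f g : Dual k W) (h l : V) :
    inducedPhi D.Φ (A.dualCop.mul (f ⊗ₜ g) ⊗ₜ H.mul (h ⊗ₜ l)) =
      TensorProduct.map H.mul A.dualCop.mul
        (TensorProduct.tensorTensorTensorComm k V (Dual k W) V (Dual k W)
          (inducedPhi D.Φ (f ⊗ₜ h) ⊗ₜ inducedPhi D.Φ (g ⊗ₜ l))) := evalSnd_ext fun a => by
  obtain ⟨n, p, q, hp⟩ := exists_rep (A.comul a)
  rw [evalSnd_mul A H.mul a hp, evalSnd_inducedPhi]
  -- `K` evaluates `f ∘ α⁻²` and `g ∘ α⁻²` on the first two factors of the identity `E5`.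
  let f' : Dual k W := f ∘ₗ (A.α ^ (-2 : ℤ)).toLinearMap
  let g' : Dual k W := g ∘ₗ (A.α ^ (-2 : ℤ)).toLinearMap
  let K : (W ⊗[k] W) ⊗[k] V →ₗ[k] V := (TensorProduct.lid k V).toLinearMap ∘ₗ
    TensorProduct.map (TensorProduct.lid k k ∘ₗ TensorProduct.map f' g')
      (H.α ^ (-2 : ℤ)).toLinearMap
  have hK : ∀ x y v, K ((x ⊗ₜ y) ⊗ₜ v) = (f ((A.α ^ (-2 : ℤ)) x) * g ((A.α ^ (-2 : ℤ)) y)) •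
    (H.α ^ (-2 : ℤ)) v := fun _ _ _ => rfl
  have e := congrArg K (D.E5 h l a)
  have e1 : ∀ z : W ⊗[k] V, K (TensorProduct.map A.comul (H.α.toLinearMap ∘ₗ H.α.toLinearMap) z) =
      TensorProduct.lid k V ((A.dualCop.mul (f ⊗ₜ g)).rTensor V z) := fun z => by
    induction z using TensorProduct.induction_on with
    | zero => simp
    | add x y hx hy => simp only [map_add, hx, hy]
    | tmul x v =>
      obtain ⟨m, s, t, hs⟩ := exists_rep (A.comul x)
      change _ = A.dualMul (f ⊗ₜ g) x • v
      rw [A.dualMul_rep f g hs, TensorProduct.map_tmul, hs, TensorProduct.sum_tmul, map_sum,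
        Finset.sum_smul]
      refine Finset.sum_congr rfl fun r _ => ?_
      rw [hK, LinearMap.comp_apply, LinearEquiv.coe_coe, zpow_apply_one, zpow_apply_one,
        show (-2 : ℤ) + 1 + 1 = 0 by norm_num, zpow_zero_apply]
  have e2 : ∀ y z : W ⊗[k] V, K (H.mul.lTensor (W ⊗[k] W)
      (TensorProduct.tensorTensorTensorComm k W V W V (y ⊗ₜ z))) =
      H.mul (TensorProduct.lid k V (TensorProduct.map f' (H.α ^ (-2 : ℤ)).toLinearMap y) ⊗ₜ
        TensorProduct.lid k V (TensorProduct.map g' (H.α ^ (-2 : ℤ)).toLinearMap z)) :=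
    fun y z => by
      induction y using TensorProduct.induction_on with
      | zero => simp
      | add x y hx hy => simp only [map_add, TensorProduct.add_tmul, hx, hy]
      | tmul x v =>
        induction z using TensorProduct.induction_on with
        | zero => simp
        | add x y hx hy => simp only [map_add, TensorProduct.tmul_add, hx, hy]
        | tmul y w =>
          change K ((x ⊗ₜ y) ⊗ₜ H.mul (v ⊗ₜ w)) = H.mul ((f ((A.α ^ (-2 : ℤ)) x) •
            (H.α ^ (-2 : ℤ)) v) ⊗ₜ (g ((A.α ^ (-2 : ℤ)) y) • (H.α ^ (-2 : ℤ)) w))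
          rw [hK, H.zpow_mul, ← TensorProduct.smul_tmul', TensorProduct.tmul_smul, map_smul,
            map_smul, smul_smul]
  have e3 : ∀ (f : Dual k W) (h : V) (a : W),
      TensorProduct.lid k V (TensorProduct.map (f ∘ₗ (A.α ^ (-2 : ℤ)).toLinearMap)
        (H.α ^ (-2 : ℤ)).toLinearMap (D.Φ (H.α (H.α h) ⊗ₜ a))) =
      evalSnd ((A.α ^ (-2 : ℤ)) a) (inducedPhi D.Φ (f ⊗ₜ h)) := fun f h a => by
    have e := EntwinedModule.zpow_equivariant D.toEntwiningStructure (-2) (H.α (H.α h)) a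
    rw [zpow_apply_one, zpow_apply_one, show (-2 : ℤ) + 1 + 1 = 0 by norm_num,
      zpow_zero_apply] at e
    rw [evalSnd_inducedPhi, e]
    induction D.Φ (H.α (H.α h) ⊗ₜ a) using TensorProduct.induction_on with
    | zero => simp only [map_zero]
    | add x y hx hy => simp only [map_add, hx, hy]
    | tmul x y => rfl
  rw [← e1, ← e, hp]
  simp only [TensorProduct.tmul_sum, map_sum, TensorProduct.tensorTensorTensorComm_tmul,
    TensorProduct.map_tmul, e2]
  refine Finset.sum_congr rfl fun r _ => ?_
  rw [e3, e3]

/-- The map `A^{*cop} ⊗ H → H ⊗ A^{*cop}` of a Hom-monoidal entwining datum makes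
`A^{*cop} ⊗ H` a Hom-bialgebra. -/
theorem cosmash : Cosmash A.dualCop H (inducedPhi D.Φ) where
  equivariant := inducedPhi_equivariant D.toEntwiningStructure
  comul_right := D.inducedPhi_comul_right
  comul_left := D.inducedPhi_comul_left
  counit_left := D.inducedPhi_counit_left
  counit_right := D.inducedPhi_counit_right
  map_mul := D.inducedPhi_mul
  map_one := D.inducedPhi_one

end MonoidalEntwiningDatum

end induced

/-! ### Actions and coactions in duality -/

section duality

variable {k : Type u} [Field k] {W X : Type u} [AddCommGroup W] [Module k W]
  [FiniteDimensional k W] [AddCommGroup X] [Module k X] [FiniteDimensional k X]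

open Module (Dual)

/-- The action `u · a = u₍₁₎(a) u₍₀₎` of `W` obtained from a map `u ↦ u₍₀₎ ⊗ u₍₁₎` to `X ⊗ W*`. -/
def dualAct (ρ : X →ₗ[k] X ⊗[k] Dual k W) : X ⊗[k] W →ₗ[k] X :=
  TensorProduct.lift (dualTensorHom k W X ∘ₗ
    (TensorProduct.comm k X (Dual k W)).toLinearMap ∘ₗ ρ)

theorem dualAct_tmul (ρ : X →ₗ[k] X ⊗[k] Dual k W) (u : X) (a : W) :
    dualAct ρ (u ⊗ₜ a) = evalSnd a (ρ u) := by
  change dualTensorHom k W X (TensorProduct.comm k X (Dual k W) (ρ u)) a = _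
  induction ρ u using TensorProduct.induction_on with
  | zero => simp
  | add x y hx hy => simp only [map_add, LinearMap.add_apply, hx, hy]
  | tmul x f => simp [evalSnd_tmul]

/-- The map `X → X ⊗ W*` whose evaluation at `a` is the action of `a`. -/
noncomputable def dualCoact (act : X ⊗[k] W →ₗ[k] X) : X →ₗ[k] X ⊗[k] Dual k W :=
  (TensorProduct.comm k (Dual k W) X).toLinearMap ∘ₗ
    (dualTensorHomEquiv k W X).symm.toLinearMap ∘ₗ TensorProduct.curry act

theorem evalSnd_dualCoact (act : X ⊗[k] W →ₗ[k] X) (u : X) (a : W) :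
    evalSnd a (dualCoact act u) = act (u ⊗ₜ a) := by
  have e : ∀ z : Dual k W ⊗[k] X, evalSnd a (TensorProduct.comm k (Dual k W) X z) =
      dualTensorHomEquiv k W X z a := fun z => by
    induction z using TensorProduct.induction_on with
    | zero => simp
    | add x y hx hy => simp only [map_add, LinearMap.add_apply, hx, hy]
    | tmul x f => simp [evalSnd_tmul]
  refine (e _).trans ?_
  rw [LinearMap.comp_apply, LinearEquiv.coe_coe, LinearEquiv.apply_symm_apply]
  rfl

theorem dualAct_dualCoact (act : X ⊗[k] W →ₗ[k] X) : dualAct (dualCoact act) = act :=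
  TensorProduct.ext' fun u a => by rw [dualAct_tmul, evalSnd_dualCoact]

theorem dualCoact_dualAct (ρ : X →ₗ[k] X ⊗[k] Dual k W) : dualCoact (dualAct ρ) = ρ :=
  LinearMap.ext fun u => evalSnd_ext fun a => by rw [evalSnd_dualCoact, dualAct_tmul]

end duality

/-! ### Modules over an algebra and comodules over its dual -/

section entwined_bicomodule

open HomVec Module

variable {k : Type u} [Field k] {V W : Type u} [AddCommGroup V] [Module k V]
  [FiniteDimensional k V] [AddCommGroup W] [Module k W] [FiniteDimensional k W]

theorem evalSnd_rTensor {X Y : Type u} [AddCommGroup X] [Module k X] [FiniteDimensional k X]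
    [AddCommGroup Y] [Module k Y] [FiniteDimensional k Y] (f : X →ₗ[k] Y) (a : W)
    (z : X ⊗[k] Dual k W) : evalSnd a (f.rTensor (Dual k W) z) = f (evalSnd a z) :=
  evalSnd_map f LinearMap.id a a (fun _ => rfl) z

/-- A linear map of modules is colinear for the dual coactions. -/
theorem rTensor_dualCoact {X Y : Type u} [AddCommGroup X] [Module k X] [FiniteDimensional k X]
    [AddCommGroup Y] [Module k Y] [FiniteDimensional k Y] {a : X ⊗[k] W →ₗ[k] X}
    {b : Y ⊗[k] W →ₗ[k] Y} (f : X →ₗ[k] Y) (h : ∀ u w, f (a (u ⊗ₜ w)) = b (f u ⊗ₜ w)) (u : X) :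
    f.rTensor (Dual k W) (dualCoact a u) = dualCoact b (f u) := evalSnd_ext fun w => by
  rw [evalSnd_rTensor, evalSnd_dualCoact, evalSnd_dualCoact, h]

/-- A map that is colinear for two coactions of `W*` is linear for the dual actions. -/
theorem dualAct_linear {X Y : Type u} [AddCommGroup X] [Module k X] [FiniteDimensional k X]
    [AddCommGroup Y] [Module k Y] [FiniteDimensional k Y] (ρ : X →ₗ[k] X ⊗[k] Dual k W)
    (σ : Y →ₗ[k] Y ⊗[k] Dual k W) (f : X →ₗ[k] Y)
    (h : ∀ u, f.rTensor (Dual k W) (ρ u) = σ (f u)) (u : X) (a : W) :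
    f (dualAct ρ (u ⊗ₜ a)) = dualAct σ (f u ⊗ₜ a) := by
  rw [dualAct_tmul, dualAct_tmul, ← h, evalSnd_rTensor]

theorem dualCop_zpow_apply (A : HomAlgebra k W) (m : ℤ) (f : Dual k W) (a : W) :
    (A.dualCop.α ^ m) f a = f ((A.α ^ (-m)) a) := by
  have e := zpow_comm_apply (α := TensorProduct.congr A.dualCop.α A.α) (β := LinearEquiv.refl k k)
    (contractLeft k W) (LinearMap.congr_fun
      (f := contractLeft k W ∘ₗ (TensorProduct.congr A.dualCop.α A.α).toLinearMap)
      (g := contractLeft k W) (TensorProduct.ext' fun f a =>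
        congrArg f (A.α.symm_apply_apply a))) m (f ⊗ₜ (A.α ^ (-m)) a)
  rw [congr_zpow_tmul, refl_zpow, zpow_zpow_apply, add_neg_cancel, zpow_zero_apply] at e
  exact e

/-- Evaluated at `a`, the tensor product of two coactions of `A^{*cop}` is the tensor product of the
dual actions of `A`: the twists `α^i` and `α^j`, together with the `α⁻²` in the multiplication of
`A^{*cop}`, become `α^{-i-2}` and `α^{-j-2}`. -/
theorem evalSnd_muLin (A : HomBialgebra k W) (i j : ℤ) {X Y : Type u} [AddCommGroup X]
    [Module k X] [FiniteDimensional k X] [AddCommGroup Y] [Module k Y] [FiniteDimensional k Y]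
    (a : W) {n : ℕ} {p q : Fin n → W} (h : A.comul a = ∑ r, p r ⊗ₜ[k] q r)
    (z : X ⊗[k] Dual k W) (w : Y ⊗[k] Dual k W) :
    evalSnd a (A.dualCop.muLin i j X Y (z ⊗ₜ w)) =
      ∑ r, evalSnd ((A.α ^ (-i - 2)) (p r)) z ⊗ₜ evalSnd ((A.α ^ (-j - 2)) (q r)) w := by
  induction z using TensorProduct.induction_on with
  | zero => simp
  | add x y hx hy =>
    simp only [map_add, TensorProduct.add_tmul, hx, hy, Finset.sum_add_distrib]
  | tmul x f =>
    induction w using TensorProduct.induction_on with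
    | zero => simp
    | add x y hx hy =>
      simp only [map_add, TensorProduct.tmul_add, hx, hy, Finset.sum_add_distrib]
    | tmul y g =>
      rw [HomAlgebra.muLin_tmul, evalSnd_tmul]
      have e : ∀ (m : ℤ) (f : Dual k W) (a : W), (A.dualCop.α ^ m) f ((A.α ^ (-2 : ℤ)) a) =
          f ((A.α ^ (-m - 2)) a) := fun m f a =>
        (dualCop_zpow_apply A.toHomAlgebra m f _).trans (by rw [zpow_zpow_apply]; rfl)
      refine (congrArg (· • _) (A.dualMul_rep _ _ h)).trans ?_
      simp only [e, Finset.sum_smul, evalSnd_tmul, ← TensorProduct.smul_tmul',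
        TensorProduct.tmul_smul, smul_smul]
      simp only [mul_comm]

namespace HomComodule

variable {A : HomAlgebra k W} {i j : ℤ} (N : HomComodule A.dualCop i j)

theorem evalSnd_coact_α (u : N.obj.carrier) (a : W) :
    evalSnd (A.α a) (N.coact (N.obj.α u)) = N.obj.α (evalSnd a (N.coact u)) := by
  rw [N.coact_α]
  exact evalSnd_map _ _ _ _ (fun f => congrArg f (A.α.symm_apply_apply a)) _

/-- The action dual to a coaction of `A^{*cop}` is Hom-associative. -/
theorem dualAct_assoc (u : N.obj.carrier) (a b : W) :
    dualAct N.coact (dualAct N.coact (u ⊗ₜ a) ⊗ₜ A.α b) =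
      dualAct N.coact (N.obj.α u ⊗ₜ A.mul (a ⊗ₜ b)) := by
  simp only [dualAct_tmul]
  have e := congrArg (fun z => evalSnd (A.α b) (evalSnd (A.α a)
    ((TensorProduct.assoc k _ (Dual k W) (Dual k W)).symm z))) (N.coassoc u)
  rw [LinearEquiv.symm_apply_apply] at e
  have e1 := evalSnd_map_dualComul A N.obj.α.toLinearMap (A.α b) (A.α a) (N.coact u)
  have e2 := evalSnd_map N.coact A.dualCop.α.toLinearMap (A.α a) a
    (fun f => congrArg f (A.α.symm_apply_apply a)) (N.coact u)
  rw [← A.α_mul, zpow_apply_one] at e1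
  rw [← e2, ← e]
  refine Eq.trans e1 ?_
  rw [LinearEquiv.coe_coe, ← evalSnd_coact_α, apply_zpow]
  norm_num

theorem dualAct_one (u : N.obj.carrier) : dualAct N.coact (u ⊗ₜ A.one) = N.obj.α u := by
  rw [dualAct_tmul]
  exact N.counit u

/-- A right Hom-module over `A`, as a right Hom-comodule over `A^{*cop}`. -/
noncomputable def ofAct (X : HomVec k i j) (act : X.carrier ⊗[k] W →ₗ[k] X.carrier)
    (hα : ∀ u a, X.α (act (u ⊗ₜ a)) = act (X.α u ⊗ₜ A.α a))
    (hassoc : ∀ u a b, act (act (u ⊗ₜ a) ⊗ₜ A.α b) = act (X.α u ⊗ₜ A.mul (a ⊗ₜ b)))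
    (hone : ∀ u, act (u ⊗ₜ A.one) = X.α u) : HomComodule A.dualCop i j where
  obj := X
  coact := dualCoact act
  coassoc u := by
    apply (TensorProduct.assoc k X.carrier (Dual k W) (Dual k W)).symm.injective
    refine evalSnd_ext fun y => evalSnd_ext fun x => ?_
    refine (evalSnd_map_dualComul A X.α.toLinearMap x y (dualCoact act u)).trans ?_
    rw [LinearEquiv.symm_apply_apply, evalSnd_map _ _ y (A.α.symm y) fun f => rfl,
      evalSnd_dualCoact, evalSnd_dualCoact, evalSnd_dualCoact, LinearEquiv.coe_coe, hα]
    have e := hassoc u (A.α.symm y) (A.α.symm x)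
    rw [LinearEquiv.apply_symm_apply] at e
    rw [e]
    apply congrArg (fun b => act (X.α u ⊗ₜ b))
    apply A.α.injective
    rw [A.α_mul, LinearEquiv.apply_symm_apply, LinearEquiv.apply_symm_apply, apply_zpow,
      apply_zpow]
    norm_num
  counit u := (evalSnd_dualCoact act u A.one).trans (hone u)

end HomComodule

/-- Evaluated at `a`, the distributive law `φ̈(n)` gives the right-hand side of the compatibility
condition of `n`-th entwined modules. -/
theorem evalSnd_phiLin {H : HomBialgebra k V} {A : HomBialgebra k W}
    (D : MonoidalEntwiningDatum H A) (n : ℤ) {X : Type u} [AddCommGroup X] [Module k X]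
    [FiniteDimensional k X] (ρ : X →ₗ[k] X ⊗[k] Dual k W) (t : X ⊗[k] V) (a : W) :
    evalSnd a (phiLin A.dualCop.toHomSpace H.toHomSpace (inducedPhi D.Φ) n X
      (ρ.rTensor V t)) = D.compatLin n (dualAct ρ) (t ⊗ₜ a) := by
  induction t using TensorProduct.induction_on with
  | zero => simp
  | add x y hx hy => simp only [map_add, TensorProduct.add_tmul, hx, hy]
  | tmul x h =>
    rw [EntwinedModule.compatLin_tmul, LinearMap.rTensor_tmul]
    obtain ⟨m, p, q, hp⟩ := exists_rep (D.Φ ((H.α ^ (n + 1)) h ⊗ₜ a))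
    have e : ∀ z : X ⊗[k] Dual k W, evalSnd a (phiLin A.dualCop.toHomSpace H.toHomSpace
        (inducedPhi D.Φ) n X (z ⊗ₜ h)) =
        ∑ r, evalSnd (A.α (p r)) z ⊗ₜ (H.α ^ (-n)) (q r) := fun z => by
      induction z using TensorProduct.induction_on with
      | zero => simp
      | add x y hx hy =>
        simp only [map_add, TensorProduct.add_tmul, hx, hy, Finset.sum_add_distrib]
      | tmul y f =>
        have e1 := EntwinedModule.zpow_equivariant D.toEntwiningStructure (-n)
          ((H.α ^ (n + 1)) h) a
        rw [zpow_zpow_apply, neg_add_cancel_left, _root_.zpow_one, hp] at e1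
        rw [phiLin_tmul, phiCoeff_tmul]
        refine (evalSnd_map (TensorProduct.mk k X V y) LinearMap.id a a (fun _ => rfl) _).trans ?_
        refine (congrArg _ (evalSnd_map LinearMap.id (A.dualCop.α ^ n).toLinearMap a
          ((A.α ^ (-n)) a) (fun f => dualCop_zpow_apply A.toHomAlgebra n f a) _)).trans ?_
        rw [evalSnd_inducedPhi]
        refine (congrArg (fun z => TensorProduct.mk k X V y (LinearMap.id
          (TensorProduct.lid k V (LinearMap.rTensor V _ z)))) e1).trans ?_
        have e2 : ∀ b, (A.dualCop.α ^ (-n - 1)) f ((A.α ^ (-n)) b) = f (A.α b) := fun b =>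
          (dualCop_zpow_apply A.toHomAlgebra (-n - 1) f _).trans (by
            rw [zpow_zpow_apply, show -(-n - 1) + -n = 1 by ring, _root_.zpow_one])
        simp only [map_sum, TensorProduct.map_tmul, LinearMap.rTensor_tmul, LinearEquiv.coe_coe,
          e2, TensorProduct.lid_tmul, evalSnd_tmul, TensorProduct.mk_apply, LinearMap.id_apply,
          map_smul, ← TensorProduct.smul_tmul']
    rw [e, hp]
    simp only [map_sum, TensorProduct.map_tmul, LinearMap.comp_apply, LinearEquiv.coe_coe,
      TensorProduct.mk_apply, dualAct_tmul]

end entwined_bicomodule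

/-! ### Entwined modules and bicomodules -/

section entwined_iso

open HomVec Module

variable {k : Type u} [Field k] {V W : Type u} [AddCommGroup V] [Module k V]
  [FiniteDimensional k V] [AddCommGroup W] [Module k W] [FiniteDimensional k W]

namespace EntwinedModule

variable {H : HomBialgebra k V} {A : HomBialgebra k W} {D : MonoidalEntwiningDatum H A}
  {i j n : ℤ}

/-- The `A^{*cop}`-comodule dual to the `A`-module underlying an entwined module. -/
noncomputable def dualComodule (M : EntwinedModule D.toEntwiningStructure i j n) :
    HomComodule A.dualCop.toHomCoalgebra i j :=
  HomComodule.ofAct (A := A.toHomAlgebra) M.obj M.act M.act_α M.act_assoc M.act_one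

theorem evalSnd_dualComodule (M : EntwinedModule D.toEntwiningStructure i j n)
    (u : M.obj.carrier) (a : W) :
    evalSnd a ((dualComodule M).coact u) = M.act (u ⊗ₜ a) := evalSnd_dualCoact _ _ _

/-- Two entwined modules with the same underlying pair are equal if their coactions and actions
are. -/
theorem eq_of_coact_act {M N : EntwinedModule D.toEntwiningStructure i j n} (X : HomVec k i j)
    (c d : X.carrier →ₗ[k] X.carrier ⊗[k] V) (a b : X.carrier ⊗[k] W →ₗ[k] X.carrier)
    (h1 h2 h3 h4 h5 h1' h2' h3' h4' h5') (h : c = d) (h' : a = b)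
    (eM : M = ⟨⟨X, c, h1, h2⟩, a, h3, h4, h5⟩) (eN : N = ⟨⟨X, d, h1', h2'⟩, b, h3', h4', h5'⟩) :
    M = N := by
  subst h h'
  rw [eM, eN]

/-- The forgetful functor from entwined modules to pairs. -/
def forget : EntwinedModule D.toEntwiningStructure i j n ⥤ HomVec k i j where
  obj M := M.obj
  map f := Hom.toPair f

instance : (forget (D := D) (i := i) (j := j) (n := n)).Faithful where
  map_injective h := hom_ext h

/-- The bicomodule of an entwined module: the action of `A` becomes a coaction of `A^{*cop}`. -/
noncomputable def toBicomodule (M : EntwinedModule D.toEntwiningStructure i j n) :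
    Bicomodule (D.cosmash.distLaw i j n).φ where
  obj := M.obj
  θ := M.toHomComodule.hom
  θ_counit := M.hom_counit
  θ_coassoc := M.hom_coassoc
  ρ := (dualComodule M).hom
  ρ_counit := HomComodule.hom_counit _
  ρ_coassoc := HomComodule.hom_coassoc _
  compat := HomVec.hom_ext (LinearMap.ext fun u => evalSnd_ext fun a =>
    (evalSnd_phiLin D n (dualCoact M.act) (M.coact u) a).trans (by
      rw [dualAct_dualCoact, ← M.compat, ← evalSnd_dualCoact M.act u a]
      exact (evalSnd_map M.coact LinearMap.id a a (fun _ => rfl) (dualCoact M.act u)).symm))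

variable (D i j n) in
/-- From entwined modules to bicomodules. -/
noncomputable def bicomoduleFunctor :
    EntwinedModule D.toEntwiningStructure i j n ⥤ Bicomodule (D.cosmash.distLaw i j n).φ where
  obj M := toBicomodule M
  map {M N} f :=
    { hom := Hom.toPair f
      comm_θ := HomVec.hom_ext (LinearMap.ext fun u => (f.comm_coact u).symm)
      comm_ρ := HomVec.hom_ext (LinearMap.ext fun u =>
        rTensor_dualCoact (Hom.toHom f).toLin f.comm_act u) }

/-- The `H`-comodule underlying a bicomodule. -/
def leftComodule (N : Bicomodule (D.cosmash.distLaw i j n).φ) :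
    HomComodule H.toHomCoalgebra i j :=
  HomComodule.ofCoalgebra N.θ N.θ_counit N.θ_coassoc

/-- The `A^{*cop}`-coaction of a bicomodule, as a linear map. -/
def rightCoact (N : Bicomodule (D.cosmash.distLaw i j n).φ) :
    N.obj.carrier →ₗ[k] N.obj.carrier ⊗[k] Dual k W := HomVec.Hom.toLin N.ρ

/-- The `A^{*cop}`-comodule underlying a bicomodule. -/
noncomputable def rightComodule (N : Bicomodule (D.cosmash.distLaw i j n).φ) :
    HomComodule A.toHomAlgebra.dualCop i j :=
  HomComodule.ofCoalgebra N.ρ N.ρ_counit N.ρ_coassoc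

/-- The compatibility of the two coactions of a bicomodule is that of entwined modules. -/
theorem dualAct_compat (N : Bicomodule (D.cosmash.distLaw i j n).φ)
    (θ : N.obj.carrier →ₗ[k] N.obj.carrier ⊗[k] V) (hθ : θ = HomVec.Hom.toLin N.θ)
    (u : N.obj.carrier) (a : W) :
    θ (dualAct (rightCoact N) (u ⊗ₜ a)) = D.compatLin n (dualAct (rightCoact N)) (θ u ⊗ₜ a) := by
  have e : phiLin A.dualCop.toHomSpace H.toHomSpace (inducedPhi D.Φ) n N.obj.carrier
      ((rightCoact N).rTensor V (θ u)) = θ.rTensor (Dual k W) (rightCoact N u) := by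
    rw [hθ]
    exact LinearMap.congr_fun (congrArg HomVec.Hom.toLin N.compat) u
  rw [← evalSnd_phiLin, e, evalSnd_rTensor, dualAct_tmul]

/-- The entwined module of a bicomodule. -/
noncomputable def ofBicomodule (N : Bicomodule (D.cosmash.distLaw i j n).φ) :
    EntwinedModule D.toEntwiningStructure i j n where
  toHomComodule := leftComodule N
  act := dualAct (rightComodule N).coact
  act_assoc := (rightComodule N).dualAct_assoc
  act_one := (rightComodule N).dualAct_one
  compat := dualAct_compat N _ rfl

variable (D i j n) in
/-- From bicomodules to entwined modules. -/
noncomputable def ofBicomoduleFunctor :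
    Bicomodule (D.cosmash.distLaw i j n).φ ⥤ EntwinedModule D.toEntwiningStructure i j n where
  obj N := ofBicomodule N
  map {M N} f := ⟨⟨HomVec.Hom.toLin f.hom, fun u =>
      (LinearMap.congr_fun (congrArg HomVec.Hom.toLin f.comm_θ) u).symm⟩,
    dualAct_linear (rightCoact M) (rightCoact N) (HomVec.Hom.toLin f.hom) fun u =>
      LinearMap.congr_fun (congrArg HomVec.Hom.toLin f.comm_ρ) u⟩

theorem ofBicomodule_toBicomodule (M : EntwinedModule D.toEntwiningStructure i j n) :
    ofBicomodule (toBicomodule M) = M :=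
  eq_of_coact_act M.obj _ _ _ _ _ _ _ _ _ M.coassoc M.counit M.act_assoc M.act_one M.compat rfl
    (dualAct_dualCoact M.act) rfl rfl

theorem toBicomodule_ofBicomodule (N : Bicomodule (D.cosmash.distLaw i j n).φ) :
    toBicomodule (ofBicomodule N) = N := by
  have h : (toBicomodule (ofBicomodule N)).ρ = N.ρ :=
    HomVec.hom_ext (dualCoact_dualAct (HomVec.Hom.toLin N.ρ))
  cases N
  exact Bicomodule.mk.injEq .. |>.mpr ⟨rfl, HEq.rfl, heq_of_eq h⟩

/-- The coaction of `A^{*cop}` on the unit entwined module is `c ↦ c ⊗ 1`. -/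
theorem dualCoact_unit (c : k) :
    c ⊗ₜ[k] A.counit = (dualComodule (𝟙_ (EntwinedModule D.toEntwiningStructure i j n))).coact c :=
  evalSnd_ext fun a => by
    rw [evalSnd_tmul]
    exact (evalSnd_dualComodule (𝟙_ (EntwinedModule D.toEntwiningStructure i j n)) c a).symm

/-- The coaction of `A^{*cop}` dual to the action of `A` on a tensor product of entwined modules. -/
theorem dualCoact_tensor (M N : EntwinedModule D.toEntwiningStructure i j n)
    (z : M.obj.carrier ⊗[k] N.obj.carrier) :
    A.dualCop.muLin i j M.obj.carrier N.obj.carrier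
      (TensorProduct.map (dualComodule M).coact (dualComodule N).coact z) =
    (dualComodule (M ⊗ N)).coact z := evalSnd_ext fun a => by
  refine Eq.trans ?_ (evalSnd_dualComodule (M ⊗ N) z a).symm
  obtain ⟨n, p, q, hp⟩ := exists_rep (A.comul a)
  refine LinearMap.congr_fun (f := evalSnd a ∘ₗ A.dualCop.muLin i j M.obj.carrier N.obj.carrier ∘ₗ
    TensorProduct.map (dualCoact M.act) (dualCoact N.act))
    (g := tensorAct M N ∘ₗ (TensorProduct.mk k _ W).flip a) (TensorProduct.ext' fun u v => ?_) z
  refine (evalSnd_muLin A i j a hp _ _).trans (Eq.trans ?_ (tensorAct_rep M N u v hp).symm)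
  exact Finset.sum_congr rfl fun r _ =>
    congrArg₂ _ (evalSnd_dualCoact M.act u _) (evalSnd_dualCoact N.act v _)

variable (D i j n) in
/-- The functor `bicomoduleFunctor` is strictly monoidal. -/
noncomputable def bicomoduleFunctorMonoidal : (bicomoduleFunctor D i j n).CoreMonoidal where
  εIso := Bicomodule.mkIso (Iso.refl (𝟙_ (HomVec k i j)))
    (comp_map_id (H.bicomonad i j).toFunctor rfl)
    (comp_map_id (A.dualCop.bicomonad i j).toFunctor
      (HomVec.hom_ext (LinearMap.ext (dualCoact_unit (D := D) (n := n)))))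
  μIso M N := Bicomodule.mkIso (Iso.refl (M.obj ⊗ N.obj))
    (comp_map_id (H.bicomonad i j).toFunctor rfl)
    (comp_map_id (A.dualCop.bicomonad i j).toFunctor
      (HomVec.hom_ext (LinearMap.ext (dualCoact_tensor M N))))
  μIso_hom_natural_left {M N} f P := (Bicomodule.forget _).map_injective
    (show Hom.toPair f ▷ P.obj ≫ 𝟙 (N.obj ⊗ P.obj) =
      𝟙 (M.obj ⊗ P.obj) ≫ Hom.toPair f ▷ P.obj by simp)
  μIso_hom_natural_right {M N} P f := (Bicomodule.forget _).map_injective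
    (show P.obj ◁ Hom.toPair f ≫ 𝟙 (P.obj ⊗ N.obj) =
      𝟙 (P.obj ⊗ M.obj) ≫ P.obj ◁ Hom.toPair f by simp)
  associativity M N P := (Bicomodule.forget _).map_injective
    (show 𝟙 (M.obj ⊗ N.obj) ▷ P.obj ≫ 𝟙 ((M.obj ⊗ N.obj) ⊗ P.obj) ≫
        (α_ M.obj N.obj P.obj).hom =
      (α_ M.obj N.obj P.obj).hom ≫ M.obj ◁ 𝟙 (N.obj ⊗ P.obj) ≫
        𝟙 (M.obj ⊗ N.obj ⊗ P.obj) by simp)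
  left_unitality M := (Bicomodule.forget _).map_injective
    (show (λ_ M.obj).hom = 𝟙 (𝟙_ _) ▷ M.obj ≫ 𝟙 (𝟙_ _ ⊗ M.obj) ≫ (λ_ M.obj).hom by simp)
  right_unitality M := (Bicomodule.forget _).map_injective
    (show (ρ_ M.obj).hom = M.obj ◁ 𝟙 (𝟙_ _) ≫ 𝟙 (M.obj ⊗ 𝟙_ _) ≫ (ρ_ M.obj).hom by simp)

variable (D i j n) in
theorem monoidallyIsomorphic_bicomodule :
    MonoidallyIsomorphic (EntwinedModule D.toEntwiningStructure i j n)
      (Bicomodule (D.cosmash.distLaw i j n).φ) :=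
  ⟨bicomoduleFunctor D i j n, ofBicomoduleFunctor D i j n,
    functor_eq_id forget _ rfl ofBicomodule_toBicomodule,
    functor_eq_id (Bicomodule.forget _) _ rfl toBicomodule_ofBicomodule,
    ⟨(bicomoduleFunctorMonoidal D i j n).toMonoidal⟩⟩

end EntwinedModule

end entwined_iso

end HomEntwining

open HomEntwining in
theorem corollary5p10 {k : Type u} [Field k] {A H : Type u} [AddCommGroup A] [Module k A]
    [FiniteDimensional k A] [AddCommGroup H] [Module k H] [FiniteDimensional k H]
    (SH : HomBialgebra k H) (SA : HomBialgebra k A) (D : MonoidalEntwiningDatum SH SA) :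
    ∃ S : HomBialgebra k (Module.Dual k A ⊗[k] H),
      S.comul = smashComul SA.dualCop.toHomCoalgebra SH.toHomCoalgebra (inducedPhi D.Φ) ∧
      (∀ (f : Module.Dual k A) (h : H), S.counit (f ⊗ₜ[k] h) = SH.counit h * f SA.one) ∧
      (∀ (f : Module.Dual k A) (h : H),
        S.α (f ⊗ₜ[k] h) = (f ∘ₗ SA.α.symm.toLinearMap) ⊗ₜ[k] SH.α h) ∧
      (∀ (f f' : Module.Dual k A) (x y : H), S.mul ((f ⊗ₜ[k] x) ⊗ₜ[k] (f' ⊗ₜ[k] y)) =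
        SA.dualCop.mul (f ⊗ₜ[k] f') ⊗ₜ[k] SH.mul (x ⊗ₜ[k] y)) ∧
      S.one = SA.counit ⊗ₜ[k] SH.one ∧
      ∀ i j n : ℤ,
        MonoidallyIsomorphic (EntwinedModule D.toEntwiningStructure i j n)
          (HomComodule S.toHomCoalgebra i j) ∧
        ∃ L : MonoidalDistLaw (SH.bicomonad i j) (SA.dualCop.bicomonad i j),
          L.φ = phiTrans SA.dualCop.toHomCoalgebra SH.toHomCoalgebra (inducedPhi D.Φ)
            (inducedPhi_equivariant D.toEntwiningStructure) i j n ∧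
          MonoidallyIsomorphic (EntwinedModule D.toEntwiningStructure i j n)
            (Bicomodule L.φ) :=
  ⟨D.cosmash.bialgebra, rfl, fun _ _ => mul_comm _ _, fun _ _ => rfl, fun _ _ _ _ => rfl, rfl,
    fun i j n =>
      have h := EntwinedModule.monoidallyIsomorphic_bicomodule D i j n
      ⟨h.trans D.cosmash.monoidallyIsomorphic_corep, D.cosmash.distLaw i j n, rfl, h⟩⟩
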